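/- Write $\mathbb{D}=\{z\in\mathbb{C}:|z|<1\}$. For doubly indexed quantities, $\lim_{u(n)/N\to s}X_{n,N}=X$ means that $X_{n_i,N_i}\to X$ for all sequences $n_i,N_i\to\infty$ of positive integers with $u(n_i)/N_i\to s$. Given $a=(a_n)_{n\ge 0}\subset\mathbb{D}$, let $\Phi_0=1$, $\Phi_{n+1}(z)=z\Phi_n(z)-\overline{a_n}\,\Phi_n^*(z)$ with $\Phi_n^*(z)=z^n\overline{\Phi_n(1/\bar z)}$ be the monic orthogonal polynomials on the unit circle with Verblunsky coefficients $a$, and for $|\beta|=1$, $n\ge1$, let $\Phi_n^{(\beta)}(z)=z\Phi_{n-1}(z)-\bar\beta\,\Phi_{n-1}^*(z)$ be the paraorthogonal polynomials (POPUC). Given $a_0,\dots,a_{p-1}\in\mathbb{D}$, the discriminant is $$\Delta(z)=z^{-p/2}\operatorname{Tr}\bigl(A(a_{p-1},z)\cdots A(a_0,z)\bigr),\qquad A(a,z)=\frac{1}{\sqrt{1-|a|^2}}\begin{pmatrix} z&-\bar a\\ -az&1\end{pmatrix},\qquad z\in\mathbb{C}\setminus\{0\}$$ (the choice of the branch of $z^{-p/2}$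 is immaterial below), and $\nu_\Delta$ is the measure carried by $\Delta^{-1}([-2,2])$ with density $$\frac{d\nu_\Delta}{d\theta}(e^{i\theta})=\frac{1}{\pi p}\,\frac{|\Delta'(e^{i\theta})|}{\sqrt{4-\Delta(e^{i\theta})^2}},$$ where the prime denotes the derivative of $\Delta(e^{i\theta})$ with respect to $\theta$. **Theorem 4.5.** Let $t>0$, $p\in\mathbb{N}$, and let $\alpha_0,\dots,\alpha_{p-1}:[0,t]\to\mathbb{D}$ be measurable. Let $\{\alpha_{n,N}: n,N\in\mathbb{N}_0\}\subset\mathbb{D}$ be such that, for every $j\in\{0,\dots,p-1\}$, $$\lim_{kp/N\to s}\alpha_{kp+j,N}=\alpha_j(s)\qquad\text{for a.e. } s\in[0,t].$$ Let $|\beta|=1$, let $\Phi^{(\beta)}_{n,N}$ be the POPUC with Verblunsky coefficients $(\alpha_{m,N})_{m\ge0}$, and let $\nu^{(\beta)}_{n,N}=\frac1n\sum_{j=1}^n\delta_{z_j}$, where $z_1,\dots,z_n$ are the zeros of $\Phi^{(\beta)}_{n,N}$ counted with multiplicity. For $s\in[0,t]$ let $\Delta_s$ be the discriminant of $\alpha_0(s),\dots,\alpha_{p-1}(s)$.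 Then $\nu_{\Delta_s}$ is, for every $s\in[0,t]$, the equilibrium measure of $\Delta_s^{-1}([-2,2])$, that is, the unique minimizer of the logarithmic energy $\iint\log\frac{1}{|z-w|}\,d\mu(z)\,d\mu(w)$ among the probability measures $\mu$ on this set, with finite minimal energy; the map $s\mapsto\nu_{\Delta_s}$ is (a.e.) measurable; and, in the sense of weak convergence of measures, $$\lim_{n/N\to t}\nu^{(\beta)}_{n,N}=\frac1t\int_0^t\nu_{\Delta_s}\,ds .$$ -/

import Mathlib

open MeasureTheory Filter Topology Set Polynomial
open scoped ENNReal BoundedContinuousFunction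

noncomputable section

/-- The reversed polynomial `P^*(z) = z ^ n * conj (P (1 / conj z))` of a polynomial of degree at
most `n`: the coefficients are conjugated and their order is reversed. -/
def reversedPoly (n : ℕ) (P : ℂ[X]) : ℂ[X] :=
  (P.map (starRingEnd ℂ)).reflect n

/-- The monic orthogonal polynomials on the unit circle with Verblunsky coefficients `a`:
`Φ_0 = 1` and `Φ_{n+1}(z) = z Φ_n(z) - conj (a_n) Φ_n^*(z)` (Szegő recursion). -/
def opuc (a : ℕ → ℂ) : ℕ → ℂ[X]
  | 0 => 1
  | n + 1 => X * opuc a n - C (starRingEnd ℂ (a n)) * reversedPoly n (opuc a n)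

/-- The paraorthogonal polynomials `Φ_n^{(β)}(z) = z Φ_{n-1}(z) - conj β Φ_{n-1}^*(z)`, `n ≥ 1`
(with `Φ_0^{(β)} = 1`). -/
def popuc (β : ℂ) (a : ℕ → ℂ) : ℕ → ℂ[X]
  | 0 => 1
  | n + 1 => X * opuc a n - C (starRingEnd ℂ β) * reversedPoly n (opuc a n)

/-- The zero-counting measure `n⁻¹ ∑ δ_{z_j}` of the paraorthogonal polynomial of degree `n`,
where `z_1, …, z_n` are its zeros, counted with multiplicity. -/
def popucZeroMeasure (β : ℂ) (a : ℕ → ℂ) (n : ℕ) : Measure ℂ :=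
  (n : ℝ≥0∞)⁻¹ • ((popuc β a n).roots.map fun z => Measure.dirac z).sum

/-- The limit `lim_{u(n)/N → s} X_{n,N} = x` of a doubly indexed family: convergence along all
sequences `n_i, N_i → ∞` such that `u(n_i) / N_i → s`. -/
def HasRatioLimit {E : Type*} [TopologicalSpace E] (u : ℕ → ℕ) (X : ℕ → ℕ → E) (s : ℝ) (x : E) :
    Prop :=
  ∀ n N : ℕ → ℕ, Tendsto n atTop atTop → Tendsto N atTop atTop →
    Tendsto (fun i => (u (n i) : ℝ) / (N i : ℝ)) atTop (𝓝 s) →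
      Tendsto (fun i => X (n i) (N i)) atTop (𝓝 x)

/-- The transfer matrix `A(α, z)`. -/
def transferMatrix (α z : ℂ) : Matrix (Fin 2) (Fin 2) ℂ :=
  (((√(1 - ‖α‖ ^ 2))⁻¹ : ℝ) : ℂ) • !![z, -(starRingEnd ℂ α); -(α * z), 1]

/-- The discriminant `Δ(z) = z ^ (-p/2) * Tr (A(a_{p-1}, z) ⋯ A(a_0, z))`, `z ≠ 0`, of the
`p`-periodic sequence with period `a_0, …, a_{p-1}`. For odd `p` the principal branch of the power
is used; the other branch changes the sign of `Δ`, and neither `Δ⁻¹([-2,2])` nor the density below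
depends on that sign. -/
def discriminant {p : ℕ} (a : Fin p → ℂ) (z : ℂ) : ℂ :=
  z ^ (-(p : ℂ) / 2) * (List.ofFn fun j => transferMatrix (a j) z).reverse.prod.trace

/-- The finite-gap set `Δ⁻¹([-2,2])`, a subset of `ℂ \ {0}`. -/
def bandSet {p : ℕ} (a : Fin p → ℂ) : Set ℂ :=
  {z | z ≠ 0 ∧ ∃ x ∈ Icc (-2 : ℝ) 2, discriminant a z = (x : ℂ)}

/-- The measure `ν_Δ`: it lives on `Δ⁻¹([-2,2])`, and its density with respect to `dθ` at
`e^{iθ}` is `(π p)⁻¹ |Δ'(e^{iθ})| / √(4 - Δ(e^{iθ})²)`, where the prime is the derivative of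
`Δ(e^{iθ})` with respect to `θ` (recall that `Δ` is real on the unit circle). -/
def discriminantMeasure {p : ℕ} (a : Fin p → ℂ) : Measure ℂ :=
  Measure.map (fun θ : ℝ => Complex.exp (θ * Complex.I))
    ((volume.restrict
        {θ : ℝ | θ ∈ Ioc (-Real.pi) Real.pi ∧ Complex.exp (θ * Complex.I) ∈ bandSet a}).withDensity
      fun θ => ENNReal.ofReal
        ((Real.pi * p)⁻¹ *
          (‖deriv (fun φ : ℝ => discriminant a (Complex.exp (φ * Complex.I))) θ‖ /
            √(4 - (discriminant a (Complex.exp (θ * Complex.I))).re ^ 2))))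

/-- The logarithmic energy `∬ log (1 / |z - w|) dμ(z) dμ(w)`, as the integral of the positive part
minus the integral of the negative part. The kernel is `+∞` on the diagonal; for a finite measure
with bounded support the second integral is finite. -/
def logEnergy (μ : Measure ℂ) : EReal :=
  ((∫⁻ z, ∫⁻ w, (-ENNReal.log ‖z - w‖ₑ).toENNReal ∂μ ∂μ : ℝ≥0∞) : EReal) -
    ((∫⁻ z, ∫⁻ w, (ENNReal.log ‖z - w‖ₑ).toENNReal ∂μ ∂μ : ℝ≥0∞) : EReal)

/-- `ν` is the equilibrium measure of the compact set `K`: a probability measure on `K` of finite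
logarithmic energy which is the unique minimizer of the energy among the probability measures
on `K` (any competitor whose energy is not larger is `ν` itself). -/
def IsEquilibriumMeasure (K : Set ℂ) (ν : Measure ℂ) : Prop :=
  IsProbabilityMeasure ν ∧ ν Kᶜ = 0 ∧ logEnergy ν < ⊤ ∧
    ∀ μ : Measure ℂ, IsProbabilityMeasure μ → μ Kᶜ = 0 → logEnergy μ ≤ logEnergy ν → μ = ν

/-- The averaged measure `t⁻¹ ∫_0^t ν_s ds`, that is `E ↦ t⁻¹ ∫_0^t ν_s(E) ds`, for an
(almost everywhere) measurable family `ν_s`. -/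
def averageMeasure (t : ℝ) (ν : ℝ → Measure ℂ) : Measure ℂ :=
  ENNReal.ofReal t⁻¹ • Measure.bind (volume.restrict (Icc 0 t)) ν

end

/-! ### Orthogonal and paraorthogonal polynomials -/

/-! All measures involved live on the unit circle, where a probability measure is determined by its
logarithmic potential near the origin: expanding `log |1 - u|` in powers of `u` recovers the moments
one after another, and the moments control weak convergence (`tendsto_integral_of_potential`). It
therefore suffices to prove convergence of potentials for `0 < |z| ≤ 1/4`.

For the zeros of a POPUC the potential is `n⁻¹ log |Φ_n^{(β)}(z)|`. With `b_i = Φ_i / Φ_i^*` this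
is, up to one bounded term, the Birkhoff-type average `n⁻¹ ∑ log |1 - a_i z b_i|`
(`integral_log_popucZeroMeasure`). The step `b_i ↦ b_{i+1}` contracts the closed disk by the factor
`1/2` when `|z| ≤ 1/4`, so `b_i` remembers only the most recent coefficients. Where these are close
to the periodic sequence `α_j(s)`, the iterates are close to its periodic orbit
(`tendsto_schurIter_ratio`), and the sum over one period converges. Dominated convergence turns the
average over periods into an integral over `s` (`tendsto_riemannSum_of_hasRatioLimit`).

The periodic orbit must then be identified with `ν_Δ`. Its starting point `b` makes `(b, 1)` the
dominant eigenvector of the monodromy matrix, so the sum over a period is the logarithm of the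
dominant eigenvalue (`integral_log_eq_sum_schurIter`). On the other side, all solutions of `Δ² - 2 =
2 cos x` with `0 < x < π` are simple and lie on the circle. Both facts come from a quantitative
estimate of the indefinite form `|u|² - |v|²` under the transfer matrices. The change of variables
`Δ² - 2 = 2 cos x` then writes `ν_Δ` as an average of root-counting measures, and Jensen's formula
computes its potential (`integral_log_discriminantMeasure`). Working with `Δ² - 2` throughout avoids
the branch of `z^{-p/2}`.

The same formula shows that the potential is constant on the bands. Together with positive
definiteness of the logarithmic kernel on the circle (`norm_moment_sub_sq_le`), this gives the
unique energy minimizer. -/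

theorem natDegree_reversedPoly_le {n : ℕ} {P : ℂ[X]} (hP : P.natDegree ≤ n) :
    (reversedPoly n P).natDegree ≤ n :=
  (natDegree_reflect_le ..).trans (max_le le_rfl (natDegree_map_le.trans hP))

theorem natDegree_opuc_le (a : ℕ → ℂ) (n : ℕ) : (opuc a n).natDegree ≤ n := by
  induction n with
  | zero => simp [opuc]
  | succ n ih =>
    rw [opuc]
    refine (natDegree_sub_le _ _).trans (max_le ?_ ?_)
    · refine natDegree_mul_le.trans ?_
      rw [natDegree_X]; omega
    · exact (natDegree_C_mul_le _ _).trans ((natDegree_reversedPoly_le ih).trans n.le_succ)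

theorem monic_X_mul_sub {n : ℕ} {P Q : ℂ[X]} (hP : P.Monic) (hn : P.natDegree = n)
    (hQ : Q.natDegree ≤ n) (c : ℂ) :
    (X * P - C c * Q).Monic ∧ (X * P - C c * Q).natDegree = n + 1 := by
  have h1 : (X * P).Monic := monic_X.mul hP
  have h2 : (X * P).natDegree = n + 1 := by
    rw [monic_X.natDegree_mul hP, natDegree_X, hn, add_comm]
  have h3 : (C c * Q).natDegree < (X * P).natDegree := by
    have := natDegree_C_mul_le c Q
    omega
  have h4 : (C c * Q).degree < (X * P).degree := degree_lt_degree h3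
  refine ⟨h1.sub_of_left h4, ?_⟩
  rw [natDegree_sub_eq_left_of_natDegree_lt h3, h2]

theorem opuc_monic (a : ℕ → ℂ) (n : ℕ) : (opuc a n).Monic ∧ (opuc a n).natDegree = n := by
  induction n with
  | zero => simp [opuc]
  | succ n ih => exact monic_X_mul_sub ih.1 ih.2 (natDegree_reversedPoly_le ih.2.le) _

theorem popuc_monic (β : ℂ) (a : ℕ → ℂ) (n : ℕ) :
    (popuc β a n).Monic ∧ (popuc β a n).natDegree = n := by
  cases n with
  | zero => simp [popuc]
  | succ n =>
    have h := opuc_monic a n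
    exact monic_X_mul_sub h.1 h.2 (natDegree_reversedPoly_le h.2.le) _

/-- The second half of the Szegő recursion, which makes the pair `(Φ_n, Φ_n^*)` evolve linearly.
Reversal is multiplicative when the orders add: at order `1` it sends `X` to `1` and `1` to `X`. -/
theorem reversedPoly_opuc_succ (a : ℕ → ℂ) (n : ℕ) :
    reversedPoly (n + 1) (opuc a (n + 1)) =
      reversedPoly n (opuc a n) - C (a n) * (X * opuc a n) := by
  have hd := natDegree_opuc_le a n
  have hd' : ((opuc a n).map (starRingEnd ℂ)).natDegree ≤ n := natDegree_map_le.trans hd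
  have h1 : reflect (n + 1) ((opuc a n).map (starRingEnd ℂ) * X) = reversedPoly n (opuc a n) := by
    rw [reflect_mul _ _ hd' natDegree_X_le, reflect_one_X, mul_one, reversedPoly]
  have h2 : reflect (n + 1) ((reversedPoly n (opuc a n)).map (starRingEnd ℂ) * 1) =
      opuc a n * X := by
    have h3 : (reversedPoly n (opuc a n)).map (starRingEnd ℂ) = reflect n (opuc a n) := by
      rw [reversedPoly, ← reflect_map, Polynomial.map_map]
      simp
    rw [h3, reflect_mul _ _ ((natDegree_reflect_le ..).trans (by simpa using hd))
      (by simp : (1 : ℂ[X]).natDegree ≤ 1), reflect_one, pow_one]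
    congr 1
    ext i
    simp
  rw [reversedPoly, opuc]
  simp only [Polynomial.map_sub, Polynomial.map_mul, map_X, map_C, Complex.conj_conj]
  rw [reflect_sub, reflect_C_mul, mul_comm X, h1, ← mul_one (Polynomial.map _ (reversedPoly _ _)),
    h2, mul_comm X]

theorem eval_opuc_succ (a : ℕ → ℂ) (n : ℕ) (z : ℂ) :
    (opuc a (n + 1)).eval z =
      z * (opuc a n).eval z - starRingEnd ℂ (a n) * (reversedPoly n (opuc a n)).eval z := by
  simp [opuc]

theorem eval_reversedPoly_opuc_succ (a : ℕ → ℂ) (n : ℕ) (z : ℂ) :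
    (reversedPoly (n + 1) (opuc a (n + 1))).eval z =
      (reversedPoly n (opuc a n)).eval z - a n * (z * (opuc a n).eval z) := by
  simp [reversedPoly_opuc_succ]

/-- The matrix `!![1, -conj a; -a, 1]` multiplies the form `|u|² - |v|²` by `1 - |a|²`. -/
theorem normSq_sub_normSq_szego (a u v : ℂ) :
    ‖u - starRingEnd ℂ a * v‖ ^ 2 - ‖v - a * u‖ ^ 2 = (1 - ‖a‖ ^ 2) * (‖u‖ ^ 2 - ‖v‖ ^ 2) := by
  simp only [← Complex.normSq_eq_norm_sq, Complex.normSq_apply, Complex.sub_re, Complex.sub_im,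
    Complex.mul_re, Complex.mul_im, Complex.conj_re, Complex.conj_im]
  ring

/-- One Szegő step preserves the sign of the form `|u|² - |v|²` at `u = z Φ_n`, `v = Φ_n^*`; the
extra factor `|z| < 1` keeps the inequality strict for the next step. -/
theorem opuc_inside {a : ℕ → ℂ} (ha : ∀ n, ‖a n‖ < 1) {z : ℂ} (hz : ‖z‖ < 1) (n : ℕ) :
    ‖z * (opuc a n).eval z‖ < ‖(reversedPoly n (opuc a n)).eval z‖ := by
  induction n with
  | zero => simpa [opuc, reversedPoly] using hz
  | succ n ih =>
    have h := normSq_sub_normSq_szego (a n) (z * (opuc a n).eval z)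
      ((reversedPoly n (opuc a n)).eval z)
    rw [← eval_opuc_succ, ← eval_reversedPoly_opuc_succ] at h
    have h1 : 0 < 1 - ‖a n‖ ^ 2 := by nlinarith [ha n, norm_nonneg (a n)]
    have h2 : ‖z * (opuc a n).eval z‖ ^ 2 < ‖(reversedPoly n (opuc a n)).eval z‖ ^ 2 := by gcongr
    have h3 : ‖(opuc a (n + 1)).eval z‖ ^ 2 <
        ‖(reversedPoly (n + 1) (opuc a (n + 1))).eval z‖ ^ 2 := by nlinarith
    have h4 := lt_of_pow_lt_pow_left₀ 2 (norm_nonneg _) h3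
    rw [norm_mul]
    nlinarith [norm_nonneg ((opuc a (n + 1)).eval z)]

theorem opuc_outside {a : ℕ → ℂ} (ha : ∀ n, ‖a n‖ < 1) {z : ℂ} (hz : 1 < ‖z‖) (n : ℕ) :
    ‖(reversedPoly n (opuc a n)).eval z‖ < ‖z * (opuc a n).eval z‖ := by
  induction n with
  | zero => simpa [opuc, reversedPoly] using hz
  | succ n ih =>
    have h := normSq_sub_normSq_szego (a n) (z * (opuc a n).eval z)
      ((reversedPoly n (opuc a n)).eval z)
    rw [← eval_opuc_succ, ← eval_reversedPoly_opuc_succ] at h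
    have h1 : 0 < 1 - ‖a n‖ ^ 2 := by nlinarith [ha n, norm_nonneg (a n)]
    have h2 : ‖(reversedPoly n (opuc a n)).eval z‖ ^ 2 < ‖z * (opuc a n).eval z‖ ^ 2 := by gcongr
    have h3 : ‖(reversedPoly (n + 1) (opuc a (n + 1))).eval z‖ ^ 2 <
        ‖(opuc a (n + 1)).eval z‖ ^ 2 := by nlinarith
    have h4 := lt_of_pow_lt_pow_left₀ 2 (norm_nonneg _) h3
    rw [norm_mul]
    nlinarith [norm_nonneg ((opuc a (n + 1)).eval z)]

/-- At a zero, `z Φ_{n-1}` and `Φ_{n-1}^*` have equal modulus because `|β| = 1`. The two preceding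
lemmas exclude this off the circle. -/
theorem norm_eq_one_of_popuc_root {β : ℂ} (hβ : ‖β‖ = 1) {a : ℕ → ℂ} (ha : ∀ n, ‖a n‖ < 1)
    {n : ℕ} {z : ℂ} (hz : (popuc β a n).eval z = 0) : ‖z‖ = 1 := by
  cases n with
  | zero => simp [popuc] at hz
  | succ n =>
    have h : z * (opuc a n).eval z = starRingEnd ℂ β * (reversedPoly n (opuc a n)).eval z := by
      simpa [popuc, sub_eq_zero] using hz
    have h' := congrArg norm h
    rw [norm_mul (starRingEnd ℂ β), Complex.norm_conj, hβ, one_mul] at h'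
    rcases lt_trichotomy ‖z‖ 1 with h1 | h1 | h1
    · exact absurd h' (opuc_inside ha h1 n).ne
    · exact h1
    · exact absurd h' (opuc_outside ha h1 n).ne'

/-! ### Schur iterates -/

/-- The map `b ↦ (z b - conj a) / (1 - a z b)` by which `Φ_n / Φ_n^*` evolves. -/
noncomputable def schurStep (z a b : ℂ) : ℂ := (z * b - starRingEnd ℂ a) / (1 - a * (z * b))

/-- The iterates of `schurStep` started at `b`. -/
noncomputable def schurIter (z : ℂ) (a : ℕ → ℂ) (b : ℂ) : ℕ → ℂ
  | 0 => b
  | n + 1 => schurStep z (a n) (schurIter z a b n)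

theorem norm_mul_mul_le {z a b : ℂ} (ha : ‖a‖ < 1) (hb : ‖b‖ ≤ 1) : ‖a * (z * b)‖ ≤ ‖z‖ := by
  rw [norm_mul, norm_mul]
  have h1 : ‖z‖ * ‖b‖ ≤ ‖z‖ := mul_le_of_le_one_right (norm_nonneg _) hb
  exact (mul_le_of_le_one_left (by positivity) ha.le).trans h1

theorem one_sub_norm_le {z a b : ℂ} (ha : ‖a‖ < 1) (hb : ‖b‖ ≤ 1) :
    1 - ‖z‖ ≤ ‖1 - a * (z * b)‖ := by
  have h := norm_mul_mul_le (z := z) ha hb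
  have h2 := norm_sub_norm_le 1 (a * (z * b))
  rw [norm_one] at h2
  linarith

theorem one_sub_ne_zero {z a b : ℂ} (hz : ‖z‖ < 1) (ha : ‖a‖ < 1) (hb : ‖b‖ ≤ 1) :
    1 - a * (z * b) ≠ 0 :=
  norm_pos_iff.mp (lt_of_lt_of_le (by linarith) (one_sub_norm_le ha hb))

/-- The map is `b ↦ z b` followed by a disk automorphism; the form identity with `u = z b`, `v = 1`
compares numerator and denominator. -/
theorem norm_schurStep_le {z a b : ℂ} (hz : ‖z‖ < 1) (ha : ‖a‖ < 1) (hb : ‖b‖ ≤ 1) :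
    ‖schurStep z a b‖ ≤ 1 := by
  rw [schurStep, norm_div, div_le_one (norm_pos_iff.mpr (one_sub_ne_zero hz ha hb))]
  have h := normSq_sub_normSq_szego a (z * b) 1
  rw [mul_one, norm_one] at h
  have h1 : 0 < 1 - ‖a‖ ^ 2 := by nlinarith [norm_nonneg a]
  have h2 : ‖z * b‖ ≤ 1 := by
    rw [norm_mul]
    exact mul_le_one₀ hz.le (norm_nonneg _) hb
  refine le_of_sq_le_sq ?_ (norm_nonneg _)
  have h3 : ‖z * b‖ ^ 2 ≤ 1 := pow_le_one₀ (norm_nonneg _) h2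
  nlinarith [mul_nonneg h1.le (sub_nonneg.mpr h3)]

theorem norm_schurIter_le {z : ℂ} (hz : ‖z‖ < 1) {a : ℕ → ℂ} {b : ℂ} (hb : ‖b‖ ≤ 1) (n : ℕ)
    (ha : ∀ i < n, ‖a i‖ < 1) : ‖schurIter z a b n‖ ≤ 1 := by
  induction n with
  | zero => exact hb
  | succ n ih =>
    exact norm_schurStep_le hz (ha n n.lt_succ_self) (ih fun i hi => ha i (hi.trans n.lt_succ_self))

/-- The source of all memory loss. The difference quotient is `z (1 - |a|²)` over two denominators
of modulus at least `3/4`, hence at most `(1/4) / (9/16) = 4/9 ≤ 1/2`, uniformly in `a`. -/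
theorem norm_schurStep_sub_le {z a b b' : ℂ} (hz : ‖z‖ ≤ 1 / 4) (ha : ‖a‖ < 1) (hb : ‖b‖ ≤ 1)
    (hb' : ‖b'‖ ≤ 1) : ‖schurStep z a b - schurStep z a b'‖ ≤ 1 / 2 * ‖b - b'‖ := by
  have hz1 : ‖z‖ < 1 := by linarith
  have h1 := one_sub_ne_zero hz1 ha hb
  have h2 := one_sub_ne_zero hz1 ha hb'
  have h : schurStep z a b - schurStep z a b' =
      (z * ((1 - ‖a‖ ^ 2 : ℝ) : ℂ) * (b - b')) / ((1 - a * (z * b)) * (1 - a * (z * b'))) := by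
    have h3 : ((1 - ‖a‖ ^ 2 : ℝ) : ℂ) = 1 - a * starRingEnd ℂ a := by
      rw [Complex.mul_conj, Complex.normSq_eq_norm_sq]; push_cast; rfl
    rw [h3, schurStep, schurStep, div_sub_div _ _ h1 h2]
    congr 1
    ring
  have h5 : 3 / 4 ≤ ‖1 - a * (z * b)‖ := le_trans (by linarith) (one_sub_norm_le ha hb)
  have h6 : 3 / 4 ≤ ‖1 - a * (z * b')‖ := le_trans (by linarith) (one_sub_norm_le ha hb')
  have h7 : |1 - ‖a‖ ^ 2| ≤ 1 := by
    rw [abs_le]; constructor <;> nlinarith [norm_nonneg a]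
  rw [h, norm_div, norm_mul, norm_mul, norm_mul, Complex.norm_real, Real.norm_eq_abs,
    div_le_iff₀ (by positivity)]
  have h8 : 9 / 16 ≤ ‖1 - a * (z * b)‖ * ‖1 - a * (z * b')‖ := by nlinarith
  have h9 : ‖z‖ * |1 - ‖a‖ ^ 2| ≤ 1 / 4 := by nlinarith [abs_nonneg (1 - ‖a‖ ^ 2), norm_nonneg z]
  nlinarith [norm_nonneg (b - b')]

theorem norm_schurIter_sub_le {z : ℂ} (hz : ‖z‖ ≤ 1 / 4) {a : ℕ → ℂ} {b b' : ℂ} (hb : ‖b‖ ≤ 1)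
    (hb' : ‖b'‖ ≤ 1) (n : ℕ) (ha : ∀ i < n, ‖a i‖ < 1) :
    ‖schurIter z a b n - schurIter z a b' n‖ ≤ (1 / 2) ^ n * ‖b - b'‖ := by
  induction n with
  | zero => simp [schurIter]
  | succ n ih =>
    have hz1 : ‖z‖ < 1 := by linarith
    have ha' : ∀ i < n, ‖a i‖ < 1 := fun i hi => ha i (hi.trans n.lt_succ_self)
    have h := norm_schurStep_sub_le hz (ha n n.lt_succ_self) (norm_schurIter_le hz1 hb n ha')
      (norm_schurIter_le hz1 hb' n ha')
    simp only [schurIter]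
    rw [pow_succ']
    nlinarith [ih ha']

theorem schurIter_add (z : ℂ) (a : ℕ → ℂ) (b : ℂ) (m n : ℕ) :
    schurIter z a b (m + n) = schurIter z (fun i => a (m + i)) (schurIter z a b m) n := by
  induction n with
  | zero => rfl
  | succ n ih => rw [← add_assoc, schurIter, ih, schurIter]

/-- `Φ_n = b_n Φ_n^*` and `Φ_n^* = ∏_{i < n} (1 - a_i z b_i)` inside the unit disk. -/
theorem eval_opuc_eq_schurIter {a : ℕ → ℂ} (ha : ∀ n, ‖a n‖ < 1) {z : ℂ} (hz : ‖z‖ < 1) (n : ℕ) :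
    (opuc a n).eval z = schurIter z a 1 n * (reversedPoly n (opuc a n)).eval z ∧
    (reversedPoly n (opuc a n)).eval z =
      ∏ i ∈ Finset.range n, (1 - a i * (z * schurIter z a 1 i)) := by
  induction n with
  | zero => simp [opuc, reversedPoly, schurIter]
  | succ n ih =>
    have h1 : 1 - a n * (z * schurIter z a 1 n) ≠ 0 :=
      one_sub_ne_zero hz (ha n) (norm_schurIter_le hz (by simp) n fun i _ => ha i)
    have h2 : (reversedPoly (n + 1) (opuc a (n + 1))).eval z =
        (1 - a n * (z * schurIter z a 1 n)) * (reversedPoly n (opuc a n)).eval z := by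
      rw [eval_reversedPoly_opuc_succ]
      linear_combination (-(a n * z)) * ih.1
    constructor
    · rw [h2, eval_opuc_succ, schurIter, schurStep, ← mul_assoc, div_mul_cancel₀ _ h1]
      linear_combination z * ih.1
    · rw [h2, ih.2, Finset.prod_range_succ, mul_comm]

/-- The values of the paraorthogonal polynomials inside the unit disk. -/
theorem norm_eval_popuc_succ {β : ℂ} (hβ : ‖β‖ = 1) {a : ℕ → ℂ} (ha : ∀ n, ‖a n‖ < 1) {z : ℂ}
    (hz : ‖z‖ < 1) (n : ℕ) :
    ‖(popuc β a (n + 1)).eval z‖ = ‖1 - β * (z * schurIter z a 1 n)‖ *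
      ∏ i ∈ Finset.range n, ‖1 - a i * (z * schurIter z a 1 i)‖ := by
  obtain ⟨h1, h2⟩ := eval_opuc_eq_schurIter ha hz n
  have hβ' : starRingEnd ℂ β * β = 1 := by
    rw [mul_comm, Complex.mul_conj, Complex.normSq_eq_norm_sq, hβ]; simp
  have h : (popuc β a (n + 1)).eval z = -(starRingEnd ℂ β) *
      ((1 - β * (z * schurIter z a 1 n)) * (reversedPoly n (opuc a n)).eval z) := by
    simp only [popuc, eval_sub, eval_mul, eval_X, eval_C]
    linear_combination z * h1 - (z * schurIter z a 1 n * (reversedPoly n (opuc a n)).eval z) * hβ'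
  rw [h, norm_mul, norm_neg, Complex.norm_conj, hβ, one_mul, norm_mul, h2, norm_prod]

/-! ### Transfer matrices -/

noncomputable section

/-- The transfer matrix without its normalizing factor. -/
def szegoMatrix (a z : ℂ) : Matrix (Fin 2) (Fin 2) ℂ :=
  !![z, -(starRingEnd ℂ a); -(a * z), 1]

/-- The product `N(c_{n-1}, z) ⋯ N(c_0, z)` of unnormalized transfer matrices. -/
def szegoProd (c : ℕ → ℂ) (z : ℂ) : ℕ → Matrix (Fin 2) (Fin 2) ℂ
  | 0 => 1
  | n + 1 => szegoMatrix (c n) z * szegoProd c z n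

/-- `szegoProd` as a matrix of polynomials in `z`. -/
def szegoPoly (c : ℕ → ℂ) : ℕ → Matrix (Fin 2) (Fin 2) ℂ[X]
  | 0 => 1
  | n + 1 => !![X, -C (starRingEnd ℂ (c n)); -(C (c n) * X), 1] * szegoPoly c n

/-- The trace of the unnormalized monodromy matrix as a polynomial. -/
def tracePoly (c : ℕ → ℂ) (p : ℕ) : ℂ[X] := (szegoPoly c p).trace

/-- The product of `1 - |c_j|²` over a period. -/
def rhoSq (c : ℕ → ℂ) (p : ℕ) : ℝ := ∏ j ∈ Finset.range p, (1 - ‖c j‖ ^ 2)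

/-- The branch-free function `Δ² - 2` of the discriminant. -/
def discSq (c : ℕ → ℂ) (p : ℕ) (z : ℂ) : ℂ :=
  (tracePoly c p).eval z ^ 2 / (rhoSq c p * z ^ p) - 2

/-- The polynomial whose zeros are the solutions of `Δ(z)² - 2 = 2 cos x`. -/
def levelPoly (c : ℕ → ℂ) (p : ℕ) (x : ℝ) : ℂ[X] :=
  tracePoly c p ^ 2 - C ((rhoSq c p * (2 + 2 * Real.cos x) : ℝ) : ℂ) * X ^ p

end

theorem one_sub_sq_pos {a : ℂ} (ha : ‖a‖ < 1) : 0 < 1 - ‖a‖ ^ 2 := by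
  nlinarith [norm_nonneg a]

theorem rhoSq_pos {c : ℕ → ℂ} (hc : ∀ j, ‖c j‖ < 1) (p : ℕ) : 0 < rhoSq c p :=
  Finset.prod_pos fun j _ => one_sub_sq_pos (hc j)

theorem rhoSq_succ (c : ℕ → ℂ) (p : ℕ) : rhoSq c (p + 1) = rhoSq c p * (1 - ‖c p‖ ^ 2) :=
  Finset.prod_range_succ _ _

theorem szegoPoly_map_eval (c : ℕ → ℂ) (z : ℂ) (n : ℕ) :
    (szegoPoly c n).map (eval z) = szegoProd c z n := by
  induction n with
  | zero =>
    ext i j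
    fin_cases i <;> fin_cases j <;> simp [szegoPoly, szegoProd]
  | succ n ih =>
    ext i j
    rw [szegoPoly, szegoProd, ← ih, Matrix.map_apply, Matrix.mul_apply, Matrix.mul_apply,
      Fin.sum_univ_two, Fin.sum_univ_two]
    fin_cases i <;> fin_cases j <;> simp [szegoMatrix]

theorem eval_tracePoly (c : ℕ → ℂ) (p : ℕ) (z : ℂ) :
    (tracePoly c p).eval z = (szegoProd c z p).trace := by
  rw [← szegoPoly_map_eval]
  simp [tracePoly, Matrix.trace_fin_two]

/-- The four bounds are carried together because the recursion couples the rows. Only the upper left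
entry reaches degree `n` in the trace. -/
theorem szegoPoly_degree (c : ℕ → ℂ) (n : ℕ) :
    ((szegoPoly c n 0 0).Monic ∧ (szegoPoly c n 0 0).natDegree = n) ∧
    (szegoPoly c n 1 0).natDegree ≤ n ∧ (szegoPoly c n 0 1).natDegree ≤ n - 1 ∧
    (szegoPoly c n 1 1).natDegree ≤ n - 1 := by
  induction n with
  | zero => simp [szegoPoly]
  | succ n ih =>
    obtain ⟨⟨h1, h2⟩, h3, h4, h5⟩ := ih
    have e00 : szegoPoly c (n + 1) 0 0 =
        X * szegoPoly c n 0 0 - C (starRingEnd ℂ (c n)) * szegoPoly c n 1 0 := by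
      simp [szegoPoly, Matrix.mul_apply, Fin.sum_univ_two]; ring
    have e10 : szegoPoly c (n + 1) 1 0 =
        szegoPoly c n 1 0 - C (c n) * (X * szegoPoly c n 0 0) := by
      simp [szegoPoly, Matrix.mul_apply, Fin.sum_univ_two]; ring
    have e01 : szegoPoly c (n + 1) 0 1 =
        X * szegoPoly c n 0 1 - C (starRingEnd ℂ (c n)) * szegoPoly c n 1 1 := by
      simp [szegoPoly, Matrix.mul_apply, Fin.sum_univ_two]; ring
    have e11 : szegoPoly c (n + 1) 1 1 =
        szegoPoly c n 1 1 - C (c n) * (X * szegoPoly c n 0 1) := by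
      simp [szegoPoly, Matrix.mul_apply, Fin.sum_univ_two]; ring
    have hX : ∀ P : ℂ[X], (X * P).natDegree ≤ P.natDegree + 1 := fun P =>
      natDegree_mul_le.trans (by rw [natDegree_X, add_comm])
    have h01 : (X * szegoPoly c n 0 1).natDegree ≤ n := by
      rcases n with _ | n
      · simp [szegoPoly]
      · exact (hX _).trans (by omega)
    refine ⟨e00 ▸ monic_X_mul_sub h1 h2 h3 _, ?_, ?_, ?_⟩
    · rw [e10]
      exact (natDegree_sub_le _ _).trans (max_le (by omega)
        ((natDegree_C_mul_le _ _).trans ((hX _).trans (by omega))))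
    · rw [e01]
      exact (natDegree_sub_le _ _).trans (max_le (by simpa using h01)
        ((natDegree_C_mul_le _ _).trans (by omega)))
    · rw [e11]
      exact (natDegree_sub_le _ _).trans (max_le (by omega)
        ((natDegree_C_mul_le _ _).trans (by simpa using h01)))

theorem tracePoly_monic (c : ℕ → ℂ) {p : ℕ} (hp : 0 < p) :
    (tracePoly c p).Monic ∧ (tracePoly c p).natDegree = p := by
  obtain ⟨⟨h1, h2⟩, -, -, h5⟩ := szegoPoly_degree c p
  have h3 : (szegoPoly c p 1 1).natDegree < (szegoPoly c p 0 0).natDegree := by omega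
  rw [tracePoly, Matrix.trace_fin_two]
  exact ⟨h1.add_of_left (degree_lt_degree h3),
    by rw [natDegree_add_eq_left_of_natDegree_lt h3, h2]⟩

/-- Used to keep the origin out of the zero set of `levelPoly`, where `discSq` has no meaning. -/
theorem eval_tracePoly_zero (c : ℕ → ℂ) {p : ℕ} (hp : 0 < p) : (tracePoly c p).eval 0 = 1 := by
  have h : ∀ n, szegoProd c 0 (n + 1) 0 0 = 0 ∧ szegoProd c 0 (n + 1) 1 0 = 0 ∧
      szegoProd c 0 (n + 1) 1 1 = 1 := by
    intro n
    induction n with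
    | zero => simp [szegoProd, szegoMatrix]
    | succ n ih =>
      rw [szegoProd]
      obtain ⟨h1, h2, h3⟩ := ih
      simp [szegoMatrix, Matrix.mul_apply, Fin.sum_univ_two, h2, h3]
  obtain ⟨n, rfl⟩ := Nat.exists_eq_succ_of_ne_zero hp.ne'
  rw [eval_tracePoly, Matrix.trace_fin_two, (h n).1, (h n).2.2, zero_add]

theorem det_szegoProd (c : ℕ → ℂ) (z : ℂ) (n : ℕ) :
    (szegoProd c z n).det = rhoSq c n * z ^ n := by
  induction n with
  | zero => simp [szegoProd, rhoSq]
  | succ n ih =>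
    have h : (szegoMatrix (c n) z).det = ((1 - ‖c n‖ ^ 2 : ℝ) : ℂ) * z := by
      have h3 : ((1 - ‖c n‖ ^ 2 : ℝ) : ℂ) = 1 - c n * starRingEnd ℂ (c n) := by
        rw [Complex.mul_conj, Complex.normSq_eq_norm_sq]; push_cast; rfl
      rw [h3, szegoMatrix, Matrix.det_fin_two_of]
      ring
    rw [szegoProd, Matrix.det_mul, ih, h, rhoSq_succ, pow_succ]
    push_cast
    ring

/-- Symmetry of the trace under reflection in the unit circle. -/
theorem eval_tracePoly_reflection (c : ℕ → ℂ) (p : ℕ) {z : ℂ} (hz : z ≠ 0) :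
    (tracePoly c p).eval z =
      z ^ p * starRingEnd ℂ ((tracePoly c p).eval (starRingEnd ℂ z)⁻¹) := by
  have h : ∀ n, (szegoProd c z n 0 0 = z ^ n *
        starRingEnd ℂ (szegoProd c (starRingEnd ℂ z)⁻¹ n 1 1) ∧
      szegoProd c z n 0 1 = z ^ n * starRingEnd ℂ (szegoProd c (starRingEnd ℂ z)⁻¹ n 1 0)) ∧
      szegoProd c z n 1 0 = z ^ n * starRingEnd ℂ (szegoProd c (starRingEnd ℂ z)⁻¹ n 0 1) ∧
      szegoProd c z n 1 1 = z ^ n * starRingEnd ℂ (szegoProd c (starRingEnd ℂ z)⁻¹ n 0 0) := by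
    intro n
    induction n with
    | zero => simp [szegoProd]
    | succ n ih =>
      obtain ⟨⟨h1, h2⟩, h3, h4⟩ := ih
      simp only [szegoProd, szegoMatrix, Matrix.mul_apply, Fin.sum_univ_two, Matrix.of_apply,
        Matrix.cons_val', Matrix.cons_val_zero, Matrix.cons_val_one,
        Matrix.cons_val_fin_one, h1, h2, h3, h4, map_add, map_mul, map_neg, map_inv₀,
        Complex.conj_conj, map_one]
      refine ⟨⟨?_, ?_⟩, ?_, ?_⟩ <;> field_simp <;> ring
  obtain ⟨⟨h1, -⟩, -, h4⟩ := h p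
  rw [eval_tracePoly, eval_tracePoly, Matrix.trace_fin_two, Matrix.trace_fin_two, h1, h4, map_add]
  ring

theorem inv_conj_of_norm_one {z : ℂ} (hz : ‖z‖ = 1) : (starRingEnd ℂ z)⁻¹ = z := by
  have h : z * starRingEnd ℂ z = 1 := by
    rw [Complex.mul_conj, Complex.normSq_eq_norm_sq, hz]; simp
  exact (eq_inv_of_mul_eq_one_left h).symm

theorem discSq_reflection (c : ℕ → ℂ) (p : ℕ) {z : ℂ} (hz : z ≠ 0) :
    discSq c p z = starRingEnd ℂ (discSq c p (starRingEnd ℂ z)⁻¹) := by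
  have h : starRingEnd ℂ z ≠ 0 := by simpa using hz
  simp only [discSq, eval_tracePoly_reflection c p hz, map_sub, map_div₀, map_pow, map_mul,
    map_inv₀, Complex.conj_conj, Complex.conj_ofReal, map_ofNat]
  generalize starRingEnd ℂ (eval (starRingEnd ℂ z)⁻¹ (tracePoly c p)) = w
  by_cases hR : (rhoSq c p : ℂ) = 0
  · simp [hR]
  · rw [inv_pow]
    field_simp

/-- `Δ² - 2` is real on the unit circle. -/
theorem discSq_eq_re (c : ℕ → ℂ) (p : ℕ) {z : ℂ} (hz : ‖z‖ = 1) :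
    discSq c p z = ((discSq c p z).re : ℂ) := by
  have h0 : z ≠ 0 := norm_pos_iff.mp (by rw [hz]; exact one_pos)
  have h := discSq_reflection c p h0
  rw [inv_conj_of_norm_one hz] at h
  exact (Complex.conj_eq_iff_re.mp h.symm).symm

theorem eval_levelPoly {c : ℕ → ℂ} (hc : ∀ j, ‖c j‖ < 1) (p : ℕ) (x : ℝ) {z : ℂ} (hz : z ≠ 0) :
    (levelPoly c p x).eval z =
      rhoSq c p * z ^ p * (discSq c p z - ((2 * Real.cos x : ℝ) : ℂ)) := by
  have hR : (rhoSq c p : ℂ) ≠ 0 := by exact_mod_cast (rhoSq_pos hc p).ne'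
  simp only [levelPoly, discSq, eval_sub, eval_mul, eval_pow, eval_C, eval_X]
  push_cast
  field_simp
  ring

theorem levelPoly_monic (c : ℕ → ℂ) {p : ℕ} (hp : 0 < p) (x : ℝ) :
    (levelPoly c p x).Monic ∧ (levelPoly c p x).natDegree = 2 * p := by
  obtain ⟨h1, h2⟩ := tracePoly_monic c hp
  have h3 : (tracePoly c p ^ 2).natDegree = 2 * p := by rw [h1.natDegree_pow, h2]
  have h4 : (C ((rhoSq c p * (2 + 2 * Real.cos x) : ℝ) : ℂ) * X ^ p).natDegree <
      (tracePoly c p ^ 2).natDegree := by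
    have := natDegree_C_mul_X_pow_le ((rhoSq c p * (2 + 2 * Real.cos x) : ℝ) : ℂ) p
    omega
  exact ⟨(h1.pow 2).sub_of_left (degree_lt_degree h4),
    by rw [levelPoly, natDegree_sub_eq_left_of_natDegree_lt h4, h3]⟩

/-! ### The indefinite form -/

theorem form_szegoMatrix (a z u v : ℂ) :
    ‖z * u - starRingEnd ℂ a * v‖ ^ 2 - ‖v - a * (z * u)‖ ^ 2 =
      (1 - ‖a‖ ^ 2) * (‖z‖ ^ 2 * ‖u‖ ^ 2 - ‖v‖ ^ 2) := by
  rw [normSq_sub_normSq_szego, norm_mul, mul_pow]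

theorem szegoMatrix_mulVec (a z : ℂ) (v : Fin 2 → ℂ) :
    (szegoMatrix a z).mulVec v 0 = z * v 0 - starRingEnd ℂ a * v 1 ∧
    (szegoMatrix a z).mulVec v 1 = v 1 - a * (z * v 0) := by
  constructor <;> simp [szegoMatrix, Matrix.mulVec, dotProduct, Fin.sum_univ_two] <;> ring

/-- The two sides differ by `(1 - |a|²) (1 - |z|)² |v 1|²`. The right side is arranged as the
determinant's modulus times the old form, minus a definite loss proportional to `1 - |z|`. -/
theorem form_szegoMatrix_le {a z : ℂ} (ha : ‖a‖ < 1) (v : Fin 2 → ℂ) :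
    ‖(szegoMatrix a z).mulVec v 0‖ ^ 2 - ‖(szegoMatrix a z).mulVec v 1‖ ^ 2 ≤
      (1 - ‖a‖ ^ 2) * ‖z‖ * (‖v 0‖ ^ 2 - ‖v 1‖ ^ 2 - (1 - ‖z‖) * (‖v 0‖ ^ 2 + ‖v 1‖ ^ 2)) := by
  obtain ⟨h0, h1⟩ := szegoMatrix_mulVec a z v
  rw [h0, h1, form_szegoMatrix, mul_assoc]
  refine mul_le_mul_of_nonneg_left ?_ (one_sub_sq_pos ha).le
  nlinarith [mul_nonneg (sq_nonneg (1 - ‖z‖)) (sq_nonneg ‖v 1‖)]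

/-- The loss is kept only from the first factor, the one acting on `v` itself, and is discarded in
all later ones. One gain per period is enough. -/
theorem form_szegoProd_le {c : ℕ → ℂ} (hc : ∀ j, ‖c j‖ < 1) {z : ℂ} (hz0 : 0 < ‖z‖)
    (hz : ‖z‖ < 1) (v : Fin 2 → ℂ) (n : ℕ) :
    ‖(szegoProd c z (n + 1)).mulVec v 0‖ ^ 2 - ‖(szegoProd c z (n + 1)).mulVec v 1‖ ^ 2 ≤
      rhoSq c (n + 1) * ‖z‖ ^ (n + 1) *
        (‖v 0‖ ^ 2 - ‖v 1‖ ^ 2 - (1 - ‖z‖) * (‖v 0‖ ^ 2 + ‖v 1‖ ^ 2)) := by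
  induction n with
  | zero => simpa [szegoProd, rhoSq] using form_szegoMatrix_le (hc 0) v
  | succ n ih =>
    rw [szegoProd, ← Matrix.mulVec_mulVec]
    refine (form_szegoMatrix_le (hc _) _).trans ?_
    set w := (szegoProd c z (n + 1)).mulVec v
    have h1 : 0 < (1 - ‖c (n + 1)‖ ^ 2) * ‖z‖ := mul_pos (one_sub_sq_pos (hc _)) hz0
    have h2 : ‖w 0‖ ^ 2 - ‖w 1‖ ^ 2 - (1 - ‖z‖) * (‖w 0‖ ^ 2 + ‖w 1‖ ^ 2) ≤
        ‖w 0‖ ^ 2 - ‖w 1‖ ^ 2 := by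
      have : 0 ≤ (1 - ‖z‖) * (‖w 0‖ ^ 2 + ‖w 1‖ ^ 2) := by
        have : 0 ≤ 1 - ‖z‖ := by linarith
        positivity
      linarith
    calc _ ≤ _ := mul_le_mul_of_nonneg_left (h2.trans ih) h1.le
      _ = _ := by rw [rhoSq_succ c (n + 1), pow_succ]; ring

/-- The eigenvalue form of the previous estimate. -/
theorem form_eigenvector_le {c : ℕ → ℂ} (hc : ∀ j, ‖c j‖ < 1) {p : ℕ} (hp : 0 < p) {z : ℂ}
    (hz0 : 0 < ‖z‖) (hz : ‖z‖ < 1) {l : ℂ} {v : Fin 2 → ℂ}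
    (hv : (szegoProd c z p).mulVec v = l • v) :
    ‖l‖ ^ 2 * (‖v 0‖ ^ 2 - ‖v 1‖ ^ 2) ≤ rhoSq c p * ‖z‖ ^ p *
        (‖v 0‖ ^ 2 - ‖v 1‖ ^ 2 - (1 - ‖z‖) * (‖v 0‖ ^ 2 + ‖v 1‖ ^ 2)) := by
  obtain ⟨n, rfl⟩ := Nat.exists_eq_succ_of_ne_zero hp.ne'
  have h := form_szegoProd_le hc hz0 hz v n
  rw [hv] at h
  simp only [Pi.smul_apply, smul_eq_mul, norm_mul, mul_pow] at h
  rw [mul_sub]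
  exact h

theorem exists_eigenvector (c : ℕ → ℂ) (p : ℕ) (z : ℂ) {l : ℂ}
    (hl : l ^ 2 - (tracePoly c p).eval z * l + rhoSq c p * z ^ p = 0) :
    ∃ v : Fin 2 → ℂ, v ≠ 0 ∧ (szegoProd c z p).mulVec v = l • v := by
  have h : (szegoProd c z p - l • (1 : Matrix (Fin 2) (Fin 2) ℂ)).det = 0 := by
    rw [← hl, eval_tracePoly, ← det_szegoProd, Matrix.det_fin_two, Matrix.det_fin_two,
      Matrix.trace_fin_two]
    simp
    ring
  obtain ⟨v, hv, hv'⟩ := Matrix.exists_mulVec_eq_zero_iff.mpr h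
  refine ⟨v, hv, ?_⟩
  rw [Matrix.sub_mulVec, Matrix.smul_mulVec, Matrix.one_mulVec, sub_eq_zero] at hv'
  exact hv'

/-- If `l` and `D / l` are the eigenvalues, with `D = R z^p` the determinant, then `Δ² - 2` is `l²/D
+ D/l²`. So `Y` is a squared Floquet multiplier, and `l` is a square root of `Y D`, with the sign
fixed by the trace. -/
theorem exists_eigenvalue {c : ℕ → ℂ} (hc : ∀ j, ‖c j‖ < 1) (p : ℕ) {z Y : ℂ} (hz : z ≠ 0)
    (hY : Y ≠ 0) (h : Y + Y⁻¹ = discSq c p z) :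
    ∃ l : ℂ, l ^ 2 = Y * (rhoSq c p * z ^ p) ∧
      l ^ 2 - (tracePoly c p).eval z * l + rhoSq c p * z ^ p = 0 := by
  have hR : (rhoSq c p : ℂ) ≠ 0 := by exact_mod_cast (rhoSq_pos hc p).ne'
  set D : ℂ := rhoSq c p * z ^ p with hD
  have hD0 : D ≠ 0 := mul_ne_zero hR (pow_ne_zero _ hz)
  set τ := (tracePoly c p).eval z
  have hτ : τ ^ 2 = (Y + Y⁻¹ + 2) * D := by
    rw [h, discSq, ← hD, sub_add_cancel, div_mul_cancel₀ _ hD0]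
  obtain ⟨l, hl⟩ := IsAlgClosed.exists_eq_mul_self (Y * D)
  have hl2 : l ^ 2 = Y * D := by rw [hl, sq]
  have hl0 : l ≠ 0 := by
    rintro rfl
    exact mul_ne_zero hY hD0 (by rw [hl]; simp)
  have h4 : (l + D / l) ^ 2 = τ ^ 2 := by
    have : (l + D / l) ^ 2 = l ^ 2 + 2 * D + D ^ 2 / l ^ 2 := by field_simp; ring
    rw [this, hl2, hτ]
    field_simp
    ring
  rcases sq_eq_sq_iff_eq_or_eq_neg.mp h4 with h5 | h5
  · refine ⟨l, hl2, ?_⟩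
    rw [← h5]; field_simp; ring
  · refine ⟨-l, by rw [neg_sq, hl2], ?_⟩
    rw [show τ = -(l + D / l) by rw [h5, neg_neg]]; field_simp; ring

theorem exists_add_inv_eq (u : ℂ) : ∃ Y : ℂ, Y ≠ 0 ∧ Y + Y⁻¹ = u := by
  obtain ⟨s, hs⟩ := IsAlgClosed.exists_eq_mul_self (u ^ 2 - 4)
  have h : (u + s) / 2 * ((u - s) / 2) = 1 := by linear_combination (-1 / 4) * hs.symm
  refine ⟨(u + s) / 2, left_ne_zero_of_mul_eq_one h, ?_⟩
  rw [← eq_inv_of_mul_eq_one_right h]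
  ring

/-- Inside the unit disk the multipliers stay away from the unit circle. -/
theorem one_sub_norm_le_abs_norm_sub_one {c : ℕ → ℂ} (hc : ∀ j, ‖c j‖ < 1) {p : ℕ} (hp : 0 < p)
    {z Y : ℂ} (hz0 : 0 < ‖z‖) (hz : ‖z‖ < 1) (hY : Y ≠ 0) (h : Y + Y⁻¹ = discSq c p z) :
    1 - ‖z‖ ≤ |‖Y‖ - 1| := by
  obtain ⟨l, hl, hl'⟩ := exists_eigenvalue hc p (norm_pos_iff.mp hz0) hY h
  obtain ⟨v, hv0, hv⟩ := exists_eigenvector c p z hl'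
  have hq := form_eigenvector_le hc hp hz0 hz hv
  have hR := rhoSq_pos hc p
  have hl2 : ‖l‖ ^ 2 = ‖Y‖ * (rhoSq c p * ‖z‖ ^ p) := by
    rw [← norm_pow, hl, norm_mul, norm_mul, norm_pow, Complex.norm_real, Real.norm_eq_abs,
      abs_of_pos hR]
  have hD : 0 < rhoSq c p * ‖z‖ ^ p := by positivity
  rw [hl2, mul_comm ‖Y‖, mul_assoc] at hq
  have hq' := le_of_mul_le_mul_left hq hD
  have hN : 0 < ‖v 0‖ ^ 2 + ‖v 1‖ ^ 2 := by
    by_contra hcon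
    apply hv0
    have h0 : ‖v 0‖ ^ 2 = 0 := by nlinarith [sq_nonneg ‖v 0‖, sq_nonneg ‖v 1‖]
    have h1 : ‖v 1‖ ^ 2 = 0 := by nlinarith [sq_nonneg ‖v 0‖, sq_nonneg ‖v 1‖]
    ext i
    fin_cases i
    · simpa using h0
    · simpa using h1
  set q := ‖v 0‖ ^ 2 - ‖v 1‖ ^ 2
  have hqN : |q| ≤ ‖v 0‖ ^ 2 + ‖v 1‖ ^ 2 :=
    abs_le.mpr ⟨by simp only [q]; nlinarith [sq_nonneg ‖v 0‖], by
      simp only [q]; nlinarith [sq_nonneg ‖v 1‖]⟩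
  -- On an eigenvector, dividing the form inequality by `|D|` gives `|Y| q ≤ q - (1 - |z|) (|v 0|² +
  -- |v 1|²)`; the bound `|q| ≤ |v 0|² + |v 1|²` then isolates `||Y| - 1|`.
  have h6 : (1 - ‖z‖) * (‖v 0‖ ^ 2 + ‖v 1‖ ^ 2) ≤ -((‖Y‖ - 1) * q) := by linarith
  have h7 : -((‖Y‖ - 1) * q) ≤ |‖Y‖ - 1| * (‖v 0‖ ^ 2 + ‖v 1‖ ^ 2) :=
    calc -((‖Y‖ - 1) * q) ≤ |(‖Y‖ - 1) * q| := neg_le_abs _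
      _ = |‖Y‖ - 1| * |q| := abs_mul _ _
      _ ≤ _ := mul_le_mul_of_nonneg_left hqN (abs_nonneg _)
  exact le_of_mul_le_mul_right (h6.trans h7) hN

theorem exp_add_exp_neg (x : ℝ) :
    Complex.exp (x * Complex.I) + (Complex.exp (x * Complex.I))⁻¹ =
      ((2 * Real.cos x : ℝ) : ℂ) := by
  rw [← Complex.exp_neg]
  push_cast
  rw [Complex.cos]
  ring_nf

/-- With `|Y| ≤ 1`, `levelPoly` factors through `(Y - e^{ix})(Y - e^{-ix}) / Y`. Both distances are
at least `1 - |z|`, and the larger is at least `|sin x|` because the two points are `2 |sin x|`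
apart. This bound, linear in `1 - |z|`, locates the zeros and also shows that they are simple. -/
theorem abs_sin_le_norm_levelPoly {c : ℕ → ℂ} (hc : ∀ j, ‖c j‖ < 1) {p : ℕ} (hp : 0 < p)
    {z : ℂ} (hz0 : 0 < ‖z‖) (hz : ‖z‖ < 1) (x : ℝ) :
    rhoSq c p * ‖z‖ ^ p * ((1 - ‖z‖) * |Real.sin x|) ≤ ‖(levelPoly c p x).eval z‖ := by
  have hR := rhoSq_pos hc p
  obtain ⟨Y, hY, hYF, hY1⟩ : ∃ Y : ℂ, Y ≠ 0 ∧ Y + Y⁻¹ = discSq c p z ∧ ‖Y‖ ≤ 1 := by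
    obtain ⟨Y, hY, h⟩ := exists_add_inv_eq (discSq c p z)
    rcases le_total ‖Y‖ 1 with h1 | h1
    · exact ⟨Y, hY, h, h1⟩
    · exact ⟨Y⁻¹, inv_ne_zero hY, by rw [inv_inv, add_comm, h], by
        rw [norm_inv]; exact inv_le_one_of_one_le₀ h1⟩
  have h1 : 1 - ‖z‖ ≤ 1 - ‖Y‖ := by
    have := one_sub_norm_le_abs_norm_sub_one hc hp hz0 hz hY hYF
    rwa [abs_of_nonpos (by linarith), neg_sub] at this
  have hY0 : 0 < ‖Y‖ := norm_pos_iff.mpr hY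
  set e := Complex.exp (x * Complex.I) with he
  have he1 : ‖e‖ = 1 := Complex.norm_exp_ofReal_mul_I x
  have he0 : e ≠ 0 := Complex.exp_ne_zero _
  have hfac : discSq c p z - ((2 * Real.cos x : ℝ) : ℂ) = (Y - e) * (Y - e⁻¹) / Y := by
    rw [← hYF, ← exp_add_exp_neg]
    field_simp
    ring
  have hd : 2 * |Real.sin x| ≤ ‖Y - e‖ + ‖Y - e⁻¹‖ := by
    have h2 : e - e⁻¹ = ((2 * Real.sin x : ℝ) : ℂ) * Complex.I := by
      rw [he, ← Complex.exp_neg]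
      push_cast
      rw [Complex.sin]
      ring_nf
      simp
      ring
    have h3 : ‖e - e⁻¹‖ = 2 * |Real.sin x| := by
      rw [h2, norm_mul, Complex.norm_I, Complex.norm_real, mul_one, Real.norm_eq_abs, abs_mul,
        abs_two]
    rw [← h3, show e - e⁻¹ = (Y - e⁻¹) - (Y - e) by ring, add_comm ‖Y - e‖]
    exact norm_sub_le _ _
  have ha : 1 - ‖Y‖ ≤ ‖Y - e‖ := by
    rw [norm_sub_rev, ← he1]; exact norm_sub_norm_le _ _
  have hb : 1 - ‖Y‖ ≤ ‖Y - e⁻¹‖ := by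
    have : ‖e⁻¹‖ = 1 := by rw [norm_inv, he1, inv_one]
    rw [norm_sub_rev, ← this]; exact norm_sub_norm_le _ _
  have hprod : (1 - ‖z‖) * |Real.sin x| ≤ ‖Y - e‖ * ‖Y - e⁻¹‖ := by
    rcases le_total ‖Y - e‖ ‖Y - e⁻¹‖ with h | h
    · exact mul_le_mul (h1.trans ha) (by linarith) (abs_nonneg _) (norm_nonneg _)
    · rw [mul_comm ‖Y - e‖]
      exact mul_le_mul (h1.trans hb) (by linarith) (abs_nonneg _) (norm_nonneg _)
  rw [eval_levelPoly hc p x (norm_pos_iff.mp hz0), hfac, norm_mul, norm_mul, norm_pow, norm_div,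
    norm_mul, Complex.norm_real, Real.norm_eq_abs, abs_of_pos hR]
  refine mul_le_mul_of_nonneg_left (hprod.trans ?_) (by positivity)
  rw [le_div_iff₀ hY0]
  exact mul_le_of_le_one_right (by positivity) hY1

/-- On `0 < x < π`, all zeros of `levelPoly` lie on the unit circle. -/
theorem norm_eq_one_of_levelPoly_root {c : ℕ → ℂ} (hc : ∀ j, ‖c j‖ < 1) {p : ℕ} (hp : 0 < p)
    {x : ℝ} (hx : x ∈ Ioo 0 Real.pi) {z : ℂ} (h : (levelPoly c p x).eval z = 0) : ‖z‖ = 1 := by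
  have hs : 0 < |Real.sin x| := abs_pos.mpr (Real.sin_pos_of_pos_of_lt_pi hx.1 hx.2).ne'
  have hR := rhoSq_pos hc p
  have hin : ∀ w : ℂ, w ≠ 0 → ‖w‖ < 1 → (levelPoly c p x).eval w ≠ 0 := by
    intro w hw0 hw1 hw
    have hw0' := norm_pos_iff.mpr hw0
    have := abs_sin_le_norm_levelPoly hc hp hw0' hw1 x
    rw [hw, norm_zero] at this
    have h1 : 0 < 1 - ‖w‖ := by linarith
    exact absurd this (not_le.mpr (by positivity))
  have hz0 : z ≠ 0 := by
    rintro rfl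
    rw [levelPoly] at h
    simp [eval_tracePoly_zero c hp, hp.ne'] at h
  rcases lt_trichotomy ‖z‖ 1 with h1 | h1 | h1
  · exact absurd h (hin z hz0 h1)
  · exact h1
  -- A zero outside the disk reflects to a zero inside it.
  · have hw : (starRingEnd ℂ z)⁻¹ ≠ 0 := by simpa using hz0
    refine absurd ?_ (hin (starRingEnd ℂ z)⁻¹ hw ?_)
    · have hRc : (rhoSq c p : ℂ) ≠ 0 := by exact_mod_cast hR.ne'
      rw [eval_levelPoly hc p x hz0] at h
      have h2 : discSq c p z - ((2 * Real.cos x : ℝ) : ℂ) = 0 :=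
        (mul_eq_zero.mp h).resolve_left (mul_ne_zero hRc (pow_ne_zero _ hz0))
      rw [eval_levelPoly hc p x hw]
      have h3 := congrArg (starRingEnd ℂ) h2
      rw [discSq_reflection c p hz0, map_sub, Complex.conj_conj, Complex.conj_ofReal,
        map_zero] at h3
      rw [h3, mul_zero]
    · rw [norm_inv, Complex.norm_conj]
      exact inv_lt_one_of_one_lt₀ h1

/-- On `0 < x < π`, all zeros of `levelPoly` are simple. -/
theorem derivative_levelPoly_ne_zero {c : ℕ → ℂ} (hc : ∀ j, ‖c j‖ < 1) {p : ℕ} (hp : 0 < p)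
    {x : ℝ} (hx : x ∈ Ioo 0 Real.pi) {z : ℂ} (h : (levelPoly c p x).eval z = 0) :
    (derivative (levelPoly c p x)).eval z ≠ 0 := by
  intro h'
  have hs : 0 < |Real.sin x| := abs_pos.mpr (Real.sin_pos_of_pos_of_lt_pi hx.1 hx.2).ne'
  have hz1 := norm_eq_one_of_levelPoly_root hc hp hx h
  have hR := rhoSq_pos hc p
  have hne : levelPoly c p x ≠ 0 := (levelPoly_monic c hp x).1.ne_zero
  have hm : 1 < (levelPoly c p x).rootMultiplicity z :=
    (one_lt_rootMultiplicity_iff_isRoot hne).mpr ⟨h, h'⟩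
  obtain ⟨G, hG⟩ : (X - C z) ^ 2 ∣ levelPoly c p x := (le_rootMultiplicity_iff hne).mp hm
  -- A double zero makes `levelPoly` quadratically small along the radius, against the linear lower
  -- bound; one factor `1 - r` is cancelled before letting `r → 1`.
  have hev : ∀ r : ℝ, r ∈ Ioo (0 : ℝ) 1 →
      rhoSq c p * r ^ p * |Real.sin x| ≤ (1 - r) * ‖G.eval (r * z)‖ := by
    intro r hr
    have hn : ‖(r : ℂ) * z‖ = r := by
      rw [norm_mul, hz1, mul_one, Complex.norm_real, Real.norm_eq_abs, abs_of_pos hr.1]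
    have h1 := abs_sin_le_norm_levelPoly hc hp (z := r * z) (by rw [hn]; exact hr.1)
      (by rw [hn]; exact hr.2) x
    rw [hn, hG, eval_mul, eval_pow, eval_sub, eval_X, eval_C, norm_mul, norm_pow,
      show (r : ℂ) * z - z = ((r - 1 : ℝ) : ℂ) * z by push_cast; ring, norm_mul, hz1, mul_one,
      Complex.norm_real, Real.norm_eq_abs, sq_abs] at h1
    have h2 : 0 < 1 - r := by linarith [hr.2]
    refine le_of_mul_le_mul_left ?_ h2
    calc _ = rhoSq c p * r ^ p * ((1 - r) * |Real.sin x|) := by ring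
      _ ≤ _ := h1
      _ = _ := by ring
  have hl : Tendsto (fun r : ℝ => rhoSq c p * r ^ p * |Real.sin x|) (𝓝[<] 1)
      (𝓝 (rhoSq c p * 1 ^ p * |Real.sin x|)) :=
    (Continuous.tendsto (by fun_prop) 1).mono_left nhdsWithin_le_nhds
  have hr : Tendsto (fun r : ℝ => (1 - r) * ‖G.eval (r * z)‖) (𝓝[<] 1)
      (𝓝 ((1 - 1) * ‖G.eval (((1 : ℝ) : ℂ) * z)‖)) :=
    (Continuous.tendsto (by fun_prop) 1).mono_left nhdsWithin_le_nhds
  have hle := le_of_tendsto_of_tendsto hl hr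
    (Filter.eventually_of_mem (Ioo_mem_nhdsLT zero_lt_one) hev)
  rw [sub_self, zero_mul, one_pow, mul_one] at hle
  exact absurd hle (not_le.mpr (by positivity))

theorem levelPoly_roots_nodup {c : ℕ → ℂ} (hc : ∀ j, ‖c j‖ < 1) {p : ℕ} (hp : 0 < p)
    {x : ℝ} (hx : x ∈ Ioo 0 Real.pi) : (levelPoly c p x).roots.Nodup := by
  have hne : levelPoly c p x ≠ 0 := (levelPoly_monic c hp x).1.ne_zero
  rw [Multiset.nodup_iff_count_le_one]
  intro z
  rw [count_roots]
  by_contra hcon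
  obtain ⟨h1, h2⟩ := (one_lt_rootMultiplicity_iff_isRoot hne).mp (not_le.mp hcon)
  exact derivative_levelPoly_ne_zero hc hp hx h1 h2

/-! ### A one-dimensional area formula -/

theorem tsum_fiber_of_injOn {f : ℝ → ℝ} {s : Set ℝ} (hinj : InjOn f s) (g : ℝ → ℝ≥0∞) {x : ℝ}
    (hx : x ∈ s) : ∑' x', (s ∩ f ⁻¹' {f x}).indicator g x' = g x := by
  have hmem : x ∈ s ∩ f ⁻¹' {f x} := ⟨hx, rfl⟩
  rw [tsum_eq_single x, indicator_of_mem hmem]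
  intro x' hx'
  exact indicator_of_notMem (fun h => hx' (hinj h.1 hx h.2)) g

/-- Each fibre has at most one point, so preimages reduce to images of Borel sets under an injective
continuous map, which are Borel by the Lusin–Souslin theorem. -/
theorem measurable_tsum_fiber {f : ℝ → ℝ} {s : Set ℝ} (hs : MeasurableSet s)
    (hf : ContinuousOn f s) (hinj : InjOn f s) {g : ℝ → ℝ≥0∞} (hg : Measurable g) :
    Measurable fun y => ∑' x, (s ∩ f ⁻¹' {y}).indicator g x := by
  have hon : ∀ x ∈ s, ∑' x', (s ∩ f ⁻¹' {f x}).indicator g x' = g x :=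
    fun x hx => tsum_fiber_of_injOn hinj g hx
  have hoff : ∀ y, y ∉ f '' s → ∑' x', (s ∩ f ⁻¹' {y}).indicator g x' = 0 := by
    intro y hy
    refine ENNReal.tsum_eq_zero.mpr fun x => indicator_of_notMem ?_ g
    exact fun h => hy ⟨x, h.1, h.2⟩
  have himg : ∀ A : Set ℝ, MeasurableSet A → MeasurableSet (f '' (s ∩ A)) := fun A hA =>
    (hs.inter hA).image_of_continuousOn_injOn (hf.mono inter_subset_left)
      (hinj.mono inter_subset_left)
  intro A hA
  have : (fun y => ∑' x, (s ∩ f ⁻¹' {y}).indicator g x) ⁻¹' A =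
      f '' (s ∩ g ⁻¹' A) ∪ ((f '' (s ∩ univ))ᶜ ∩ {_y | (0 : ℝ≥0∞) ∈ A}) := by
    ext y
    simp only [mem_preimage, inter_univ, mem_union, mem_inter_iff, mem_compl_iff, mem_ofPred_eq]
    by_cases hy : y ∈ f '' s
    · obtain ⟨x, hx, rfl⟩ := hy
      rw [hon x hx]
      constructor
      · exact fun h => Or.inl ⟨x, ⟨hx, h⟩, rfl⟩
      · rintro (⟨x', ⟨hx', h'⟩, he⟩ | h)
        · rwa [← hinj hx' hx he]
        · exact absurd ⟨x, hx, rfl⟩ h.1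
    · rw [hoff y hy]
      constructor
      · exact fun h => Or.inr ⟨hy, h⟩
      · rintro (⟨x', ⟨hx', h'⟩, he⟩ | h)
        · exact absurd ⟨x', hx', he⟩ hy
        · exact h.2
  rw [this]
  exact (himg _ (hg hA)).union ((himg _ MeasurableSet.univ).compl.inter (.const _))

theorem lintegral_abs_deriv_mul_of_injOn {f f' : ℝ → ℝ} {s : Set ℝ} (hs : MeasurableSet s)
    (hf : ∀ x ∈ s, HasDerivAt f (f' x) x) (hinj : InjOn f s) (g : ℝ → ℝ≥0∞) :
    ∫⁻ x in s, ENNReal.ofReal |f' x| * g x = ∫⁻ y, ∑' x, (s ∩ f ⁻¹' {y}).indicator g x := by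
  have hc : ContinuousOn f s := fun x hx => (hf x hx).continuousAt.continuousWithinAt
  have himg : MeasurableSet (f '' s) := hs.image_of_continuousOn_injOn hc hinj
  have h1 := lintegral_image_eq_lintegral_abs_deriv_mul hs
    (fun x hx => (hf x hx).hasDerivWithinAt) hinj
    (fun y => ∑' x, (s ∩ f ⁻¹' {y}).indicator g x)
  have h2 : ∫⁻ y, ∑' x, (s ∩ f ⁻¹' {y}).indicator g x =
      ∫⁻ y in f '' s, ∑' x, (s ∩ f ⁻¹' {y}).indicator g x := by
    rw [← lintegral_indicator himg]
    congr 1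
    ext y
    by_cases hy : y ∈ f '' s
    · rw [indicator_of_mem hy]
    · rw [indicator_of_notMem hy]
      refine ENNReal.tsum_eq_zero.mpr fun x => indicator_of_notMem ?_ g
      exact fun h => hy ⟨x, h.1, h.2⟩
  rw [h2, h1]
  refine setLIntegral_congr_fun hs fun x hx => ?_
  congr 1
  exact (tsum_fiber_of_injOn hinj g hx).symm

/-- The area formula for a function on a subset of the line with nonvanishing derivative. -/
theorem lintegral_abs_deriv_mul {f f' : ℝ → ℝ} {s : Set ℝ} (hs : MeasurableSet s)
    (hf : ∀ x ∈ s, HasStrictDerivAt f (f' x) x) (hf' : ∀ x ∈ s, f' x ≠ 0) {g : ℝ → ℝ≥0∞}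
    (hg : Measurable g) :
    ∫⁻ x in s, ENNReal.ofReal |f' x| * g x = ∫⁻ y, ∑' x, (s ∩ f ⁻¹' {y}).indicator g x := by
  have hloc : ∀ x ∈ s, ∃ U ∈ 𝓝 x, IsOpen U ∧ InjOn f U := by
    intro x hx
    let e := ((hf x hx).hasStrictFDerivAt_equiv (hf' x hx)).toOpenPartialHomeomorph f
    exact ⟨e.source, e.open_source.mem_nhds
      ((hf x hx).hasStrictFDerivAt_equiv (hf' x hx)).mem_toOpenPartialHomeomorph_source,
      e.open_source, e.injOn⟩
  choose! U hU hUo hUi using hloc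
  obtain ⟨t, hts, htc, htU⟩ :=
    TopologicalSpace.countable_cover_nhdsWithin (fun x hx => mem_nhdsWithin_of_mem_nhds (hU x hx))
  rcases t.eq_empty_or_nonempty with rfl | htn
  · have : s = ∅ := by simpa using htU
    simp [this]
  obtain ⟨e, rfl⟩ := htc.exists_eq_range htn
  have hes : ∀ n, e n ∈ s := fun n => hts ⟨n, rfl⟩
  -- The inverse function theorem and the Lindelöf property give countably many open sets of
  -- injectivity covering `s`; making them disjoint lets the injective case be summed.
  set V : ℕ → Set ℝ := disjointed fun n => U (e n) with hV
  have hVm : ∀ n, MeasurableSet (V n) :=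
    MeasurableSet.disjointed fun n => (hUo _ (hes n)).measurableSet
  have hVd : Pairwise (Function.onFun Disjoint V) := disjoint_disjointed _
  have hsV : s = ⋃ n, s ∩ V n := by
    rw [← inter_iUnion, hV, iUnion_disjointed]
    refine (inter_eq_left.mpr ?_).symm
    simpa [biUnion_range] using htU
  have hd : Pairwise (Function.onFun Disjoint fun n => s ∩ V n) := fun i j hij =>
    (hVd hij).mono inter_subset_right inter_subset_right
  have hi : ∀ n, InjOn f (s ∩ V n) := fun n =>
    (hUi _ (hes n)).mono (inter_subset_right.trans (disjointed_subset _ n))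
  calc ∫⁻ x in s, ENNReal.ofReal |f' x| * g x
      = ∑' n, ∫⁻ x in s ∩ V n, ENNReal.ofReal |f' x| * g x := by
        conv_lhs => rw [hsV]
        exact lintegral_iUnion (fun n => hs.inter (hVm n)) hd _
    _ = ∑' n, ∫⁻ y, ∑' x, ((s ∩ V n) ∩ f ⁻¹' {y}).indicator g x := by
        congr 1
        ext n
        exact lintegral_abs_deriv_mul_of_injOn (hs.inter (hVm n))
          (fun x hx => (hf x hx.1).hasDerivAt) (hi n) g
    _ = ∫⁻ y, ∑' n, ∑' x, ((s ∩ V n) ∩ f ⁻¹' {y}).indicator g x := by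
        rw [lintegral_tsum]
        exact fun n => (measurable_tsum_fiber (hs.inter (hVm n))
          (fun x hx => (hf x hx.1).hasDerivAt.continuousAt.continuousWithinAt)
          (hi n) hg).aemeasurable
    _ = ∫⁻ y, ∑' x, (s ∩ f ⁻¹' {y}).indicator g x := by
        congr 1
        ext y
        rw [ENNReal.tsum_comm]
        congr 1
        ext x
        conv_rhs => rw [hsV, iUnion_inter]
        rw [indicator_iUnion_of_pairwise_disjoint]
        exact fun i j hij => (hd hij).mono inter_subset_left inter_subset_left

/-! ### The discriminant on the unit circle -/

theorem transferMatrix_eq_smul (a z : ℂ) :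
    transferMatrix a z = (((√(1 - ‖a‖ ^ 2))⁻¹ : ℝ) : ℂ) • szegoMatrix a z := rfl

theorem prod_transferMatrix {c : ℕ → ℂ} (hc : ∀ j, ‖c j‖ < 1) (z : ℂ) (p : ℕ) :
    (List.ofFn fun j : Fin p => transferMatrix (c j) z).reverse.prod =
      (((√(rhoSq c p))⁻¹ : ℝ) : ℂ) • szegoProd c z p := by
  have h : ∏ j ∈ Finset.range p, √(1 - ‖c j‖ ^ 2) = √(rhoSq c p) :=
    (Real.sqrt_prod _ fun j _ => (one_sub_sq_pos (hc j)).le).symm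
  rw [← h]
  clear h
  induction p with
  | zero => simp [szegoProd]
  | succ p ih =>
    rw [List.ofFn_succ', List.concat_eq_append, List.reverse_append, List.reverse_singleton,
      List.singleton_append, List.prod_cons]
    simp only [Fin.val_castSucc, Fin.val_last]
    rw [ih, transferMatrix_eq_smul, szegoProd, Matrix.smul_mul, Matrix.mul_smul, smul_smul,
      Finset.prod_range_succ, mul_inv]
    push_cast
    rw [mul_comm]

theorem discriminant_eq {c : ℕ → ℂ} (hc : ∀ j, ‖c j‖ < 1) (z : ℂ) (p : ℕ) :
    discriminant (fun j : Fin p => c j) z =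
      z ^ (-(p : ℂ) / 2) * ((((√(rhoSq c p))⁻¹ : ℝ) : ℂ) * (tracePoly c p).eval z) := by
  rw [discriminant, prod_transferMatrix hc, Matrix.trace_smul, eval_tracePoly, smul_eq_mul]

/-- Squaring turns `z^{-p/2}` into `z^{-p}` for any branch, which is why everything below is
expressed through `discSq`. -/
theorem discriminant_sq {c : ℕ → ℂ} (hc : ∀ j, ‖c j‖ < 1) (z : ℂ) (p : ℕ) :
    discriminant (fun j : Fin p => c j) z ^ 2 = discSq c p z + 2 := by
  have h1 : (z ^ (-(p : ℂ) / 2)) ^ 2 = (z ^ p)⁻¹ := by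
    rw [← Complex.cpow_nat_mul, show ((2 : ℕ) : ℂ) * (-(p : ℂ) / 2) = -(p : ℂ) by push_cast; ring,
      Complex.cpow_neg, Complex.cpow_natCast]
  have h2 : ((((√(rhoSq c p))⁻¹ : ℝ) : ℂ)) ^ 2 = (rhoSq c p : ℂ)⁻¹ := by
    rw [← Complex.ofReal_pow, inv_pow, Real.sq_sqrt (rhoSq_pos hc p).le, Complex.ofReal_inv]
  rw [discriminant_eq hc, mul_pow, mul_pow, h1, h2, discSq, sub_add_cancel, div_eq_mul_inv, mul_inv]
  ring

theorem discSq_of_norm_eq_one {c : ℕ → ℂ} (p : ℕ) {z : ℂ} (hz : ‖z‖ = 1) :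
    discSq c p z = ((‖(tracePoly c p).eval z‖ ^ 2 / rhoSq c p - 2 : ℝ) : ℂ) := by
  have h0 : z ≠ 0 := norm_pos_iff.mp (by rw [hz]; exact one_pos)
  have h := eval_tracePoly_reflection c p h0
  rw [inv_conj_of_norm_one hz] at h
  set τ := (tracePoly c p).eval z
  have h1 : τ ^ 2 = z ^ p * ((‖τ‖ ^ 2 : ℝ) : ℂ) := by
    rw [← Complex.normSq_eq_norm_sq, ← Complex.mul_conj]
    linear_combination τ * h
  rw [discSq, h1]
  push_cast
  have := pow_ne_zero p h0
  by_cases hR : (rhoSq c p : ℂ) = 0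
  · simp [hR]
  · field_simp

/-- The discriminant is real on the unit circle. -/
theorem discriminant_eq_re {c : ℕ → ℂ} (hc : ∀ j, ‖c j‖ < 1) {z : ℂ} (hz : ‖z‖ = 1) (p : ℕ) :
    discriminant (fun j : Fin p => c j) z =
      ((discriminant (fun j : Fin p => c j) z).re : ℂ) := by
  have h0 : z ≠ 0 := norm_pos_iff.mp (by rw [hz]; exact one_pos)
  have h := discriminant_sq hc z p
  rw [discSq_of_norm_eq_one p hz] at h
  set D := discriminant (fun j : Fin p => c j) z
  have hr : 0 ≤ ‖(tracePoly c p).eval z‖ ^ 2 / rhoSq c p :=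
    div_nonneg (sq_nonneg _) (rhoSq_pos hc p).le
  rw [show ((‖(tracePoly c p).eval z‖ ^ 2 / rhoSq c p - 2 : ℝ) : ℂ) + 2 =
    ((‖(tracePoly c p).eval z‖ ^ 2 / rhoSq c p : ℝ) : ℂ) by push_cast; ring] at h
  have hre := congrArg Complex.re h
  have him := congrArg Complex.im h
  rw [sq, Complex.mul_re, Complex.ofReal_re] at hre
  rw [sq, Complex.mul_im, Complex.ofReal_im] at him
  -- The square of `D` is a nonnegative real, so a purely imaginary nonzero value is impossible.
  have him' : D.im = 0 := by
    rcases mul_eq_zero.mp (show D.re * D.im = 0 by linarith) with h1 | h1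
    · rw [h1] at hre
      nlinarith [mul_self_nonneg D.im]
    · exact h1
  exact Complex.ext rfl (by simp [him'])

theorem discriminant_re_sq {c : ℕ → ℂ} (hc : ∀ j, ‖c j‖ < 1) {z : ℂ} (hz : ‖z‖ = 1) (p : ℕ) :
    (discriminant (fun j : Fin p => c j) z).re ^ 2 = (discSq c p z).re + 2 := by
  have h0 : z ≠ 0 := norm_pos_iff.mp (by rw [hz]; exact one_pos)
  have h := discriminant_sq hc z p
  rw [discriminant_eq_re hc hz, discSq_eq_re c p hz] at h
  exact_mod_cast h

/-- The bands lie on the unit circle. -/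
theorem mem_bandSet_iff {c : ℕ → ℂ} (hc : ∀ j, ‖c j‖ < 1) {p : ℕ} (hp : 0 < p) (z : ℂ) :
    z ∈ bandSet (fun j : Fin p => c j) ↔ ‖z‖ = 1 ∧ (discSq c p z).re ≤ 2 := by
  constructor
  · rintro ⟨hz, x, hx, hD⟩
    have hF : discSq c p z = ((x ^ 2 - 2 : ℝ) : ℂ) := by
      have h := discriminant_sq hc z p
      rw [hD] at h
      push_cast
      linear_combination -h
    have hx2 : x ^ 2 ≤ 4 := by nlinarith [hx.1, hx.2]
    refine ⟨?_, by rw [hF, Complex.ofReal_re]; linarith⟩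
    have hcos : 2 * Real.cos (Real.arccos ((x ^ 2 - 2) / 2)) = x ^ 2 - 2 := by
      rw [Real.cos_arccos (by nlinarith [sq_nonneg x]) (by linarith)]; ring
    -- A value `2 cos x` of `Δ² - 2` would have the unimodular multiplier `Y = e^{ix}`, which cannot
    -- occur inside the disk; the exterior follows by reflection.
    have hin : ∀ w : ℂ, w ≠ 0 → ‖w‖ < 1 → discSq c p w ≠ ((x ^ 2 - 2 : ℝ) : ℂ) := by
      intro w hw0 hw1 hw
      have h := one_sub_norm_le_abs_norm_sub_one hc hp (norm_pos_iff.mpr hw0) hw1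
        (Complex.exp_ne_zero _) (by rw [hw, ← hcos]; exact exp_add_exp_neg _)
      rw [Complex.norm_exp_ofReal_mul_I, sub_self, abs_zero] at h
      linarith
    rcases lt_trichotomy ‖z‖ 1 with h1 | h1 | h1
    · exact absurd hF (hin z hz h1)
    · exact h1
    · refine absurd ?_ (hin (starRingEnd ℂ z)⁻¹ (by simpa using hz) ?_)
      · have h2 := congrArg (starRingEnd ℂ) hF
        rwa [discSq_reflection c p hz, Complex.conj_conj, Complex.conj_ofReal] at h2
      · rw [norm_inv, Complex.norm_conj]
        exact inv_lt_one_of_one_lt₀ h1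
  · rintro ⟨hz, hF⟩
    refine ⟨norm_pos_iff.mp (by rw [hz]; exact one_pos), _, ?_, discriminant_eq_re hc hz p⟩
    have h := discriminant_re_sq hc hz p
    exact abs_le.mp (abs_le_of_sq_le_sq (by linarith) (by norm_num))

/-- The function `Δ(e^{iθ})² - 2`. -/
noncomputable def discAngle (c : ℕ → ℂ) (p : ℕ) (θ : ℝ) : ℝ :=
  ‖(tracePoly c p).eval (Complex.exp (θ * Complex.I))‖ ^ 2 / rhoSq c p - 2

theorem discSq_exp (c : ℕ → ℂ) (p : ℕ) (θ : ℝ) :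
    discSq c p (Complex.exp (θ * Complex.I)) = (discAngle c p θ : ℂ) :=
  discSq_of_norm_eq_one p (Complex.norm_exp_ofReal_mul_I θ)

theorem contDiff_eval_exp (P : ℂ[X]) :
    ContDiff ℝ 1 fun θ : ℝ => P.eval (Complex.exp (θ * Complex.I)) := by
  have h : ContDiff ℝ 1 fun θ : ℝ => Complex.exp (θ * Complex.I) :=
    (Complex.ofRealCLM.contDiff.mul contDiff_const).cexp
  simp only [eval_eq_sum_range]
  exact ContDiff.sum fun i _ => contDiff_const.mul (h.pow i)

theorem contDiff_discAngle (c : ℕ → ℂ) (p : ℕ) : ContDiff ℝ 1 (discAngle c p) :=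
  (((contDiff_eval_exp _).norm_sq ℝ).div_const _).sub contDiff_const

theorem neg_two_le_discAngle {c : ℕ → ℂ} (hc : ∀ j, ‖c j‖ < 1) (p : ℕ) (θ : ℝ) :
    -2 ≤ discAngle c p θ := by
  have : 0 ≤ ‖(tracePoly c p).eval (Complex.exp (θ * Complex.I))‖ ^ 2 / rhoSq c p :=
    div_nonneg (sq_nonneg _) (rhoSq_pos hc p).le
  rw [discAngle]
  linarith

theorem hasDerivAt_exp_mul_I (θ : ℝ) :
    HasDerivAt (fun θ : ℝ => Complex.exp (θ * Complex.I))
      (Complex.exp (θ * Complex.I) * Complex.I) θ := by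
  have h := ((hasDerivAt_id θ).ofReal_comp.mul_const Complex.I).cexp
  simpa using h

/-- The discriminant has no critical points in the interior of the bands. -/
theorem deriv_discAngle_ne_zero {c : ℕ → ℂ} (hc : ∀ j, ‖c j‖ < 1) {p : ℕ} (hp : 0 < p) {θ : ℝ}
    (h1 : -2 < discAngle c p θ) (h2 : discAngle c p θ < 2) : deriv (discAngle c p) θ ≠ 0 := by
  intro h0
  set x := Real.arccos (discAngle c p θ / 2) with hxdef
  have hx : x ∈ Ioo 0 Real.pi :=
    ⟨Real.arccos_pos.mpr (by linarith), Real.arccos_lt_pi.mpr (by linarith)⟩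
  have hcos : 2 * Real.cos x = discAngle c p θ := by
    rw [hxdef, Real.cos_arccos (by linarith) (by linarith)]; ring
  -- On the circle `levelPoly` is a nonvanishing factor times `discAngle - 2 cos x`, so a critical
  -- point at this level would be a double zero.
  have hev : (fun φ : ℝ => (levelPoly c p x).eval (Complex.exp (φ * Complex.I))) =
      fun φ : ℝ => rhoSq c p * Complex.exp (φ * Complex.I) ^ p *
        (((discAngle c p φ - 2 * Real.cos x : ℝ)) : ℂ) := by
    ext φ
    rw [eval_levelPoly hc p x (Complex.exp_ne_zero _), discSq_exp]
    push_cast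
    rfl
  have hroot : (levelPoly c p x).eval (Complex.exp (θ * Complex.I)) = 0 := by
    have := congrFun hev θ
    simpa [hcos] using this
  have hd1 : HasDerivAt (fun φ : ℝ => (levelPoly c p x).eval (Complex.exp (φ * Complex.I)))
      ((derivative (levelPoly c p x)).eval (Complex.exp (θ * Complex.I)) *
        (Complex.exp (θ * Complex.I) * Complex.I)) θ :=
    ((levelPoly c p x).hasDerivAt _).comp θ (hasDerivAt_exp_mul_I θ)
  have hW : HasDerivAt (discAngle c p) 0 θ := by
    rw [← h0]
    exact ((contDiff_discAngle c p).differentiable one_ne_zero θ).hasDerivAt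
  have hd2 : HasDerivAt (fun φ : ℝ => rhoSq c p * Complex.exp (φ * Complex.I) ^ p *
        (((discAngle c p φ - 2 * Real.cos x : ℝ)) : ℂ)) 0 θ := by
    have h3 := (((hasDerivAt_exp_mul_I θ).pow p).const_mul (rhoSq c p : ℂ)).mul
      (hW.sub_const (2 * Real.cos x)).ofReal_comp
    refine h3.congr_deriv ?_
    simp [hcos]
  rw [← hev] at hd2
  have h5 := hd1.unique hd2
  have h6 := derivative_levelPoly_ne_zero hc hp hx hroot
  exact mul_ne_zero h6 (mul_ne_zero (Complex.exp_ne_zero _) Complex.I_ne_zero) h5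

/-- The set of angles in the interior of the bands. -/
def bandAngles (c : ℕ → ℂ) (p : ℕ) : Set ℝ :=
  Ioc (-Real.pi) Real.pi ∩ discAngle c p ⁻¹' Ioo (-2) 2

theorem measurableSet_bandAngles (c : ℕ → ℂ) (p : ℕ) : MeasurableSet (bandAngles c p) :=
  measurableSet_Ioc.inter ((contDiff_discAngle c p).continuous.measurable measurableSet_Ioo)

theorem hasStrictDerivAt_arccos_discAngle (c : ℕ → ℂ) (p : ℕ) {θ : ℝ}
    (h1 : -2 < discAngle c p θ) (h2 : discAngle c p θ < 2) :
    HasStrictDerivAt (fun θ => Real.arccos (discAngle c p θ / 2))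
      (-(deriv (discAngle c p) θ / √(4 - discAngle c p θ ^ 2))) θ := by
  have h3 : HasStrictDerivAt (discAngle c p) (deriv (discAngle c p) θ) θ :=
    (contDiff_discAngle c p).hasStrictDerivAt one_ne_zero
  have h4 := (Real.hasStrictDerivAt_arccos (x := discAngle c p θ / 2) (by linarith)
    (by linarith)).comp θ (h3.div_const 2)
  refine h4.congr_deriv ?_
  have h5 : √(4 - discAngle c p θ ^ 2) = 2 * √(1 - (discAngle c p θ / 2) ^ 2) := by
    rw [show 4 - discAngle c p θ ^ 2 = 2 ^ 2 * (1 - (discAngle c p θ / 2) ^ 2) by ring,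
      Real.sqrt_mul (by norm_num), Real.sqrt_sq (by norm_num)]
  rw [h5]
  field_simp

/-- Since every root lies on the circle, the fibre over `x` is exactly the set of arguments of the
roots. Simplicity makes the sum over this set agree with the sum over the multiset. -/
theorem tsum_fiber_eq_sum_roots {c : ℕ → ℂ} (hc : ∀ j, ‖c j‖ < 1) {p : ℕ} (hp : 0 < p) {x : ℝ}
    (hx : x ∈ Ioo 0 Real.pi) (g : ℂ → ℝ≥0∞) :
    ∑' θ, (bandAngles c p ∩ (fun θ => Real.arccos (discAngle c p θ / 2)) ⁻¹' {x}).indicator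
        (fun θ => g (Complex.exp (θ * Complex.I))) θ =
      ((levelPoly c p x).roots.map g).sum := by
  have hR : (rhoSq c p : ℂ) ≠ 0 := by exact_mod_cast (rhoSq_pos hc p).ne'
  have hne : levelPoly c p x ≠ 0 := (levelPoly_monic c hp x).1.ne_zero
  set S := (levelPoly c p x).roots.toFinset with hS
  have hSmem : ∀ z, z ∈ S ↔ (levelPoly c p x).eval z = 0 := by
    intro z
    rw [hS, Multiset.mem_toFinset, mem_roots hne, IsRoot.def]
  have hS1 : ∀ z ∈ S, Complex.exp (z.arg * Complex.I) = z := by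
    intro z hz
    have h := Complex.norm_mul_exp_arg_mul_I z
    rwa [norm_eq_one_of_levelPoly_root hc hp hx ((hSmem z).mp hz), Complex.ofReal_one,
      one_mul] at h
  have hset : bandAngles c p ∩ (fun θ => Real.arccos (discAngle c p θ / 2)) ⁻¹' {x} =
      ↑(S.image Complex.arg) := by
    ext θ
    simp only [Finset.coe_image, mem_image, Finset.mem_coe]
    constructor
    · rintro ⟨⟨hθ, h1⟩, h2⟩
      refine ⟨Complex.exp (θ * Complex.I), ?_, ?_⟩
      · rw [hSmem, eval_levelPoly hc p x (Complex.exp_ne_zero _), discSq_exp,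
          ← mem_singleton_iff.mp h2, Real.cos_arccos (by linarith [h1.1]) (by linarith [h1.2])]
        push_cast
        ring
      · rw [Complex.arg_exp_mul_I, toIocMod_eq_self]
        convert hθ using 1
        ring_nf
    · rintro ⟨z, hz, rfl⟩
      have h0 : z ≠ 0 := by
        rw [← hS1 z hz]; exact Complex.exp_ne_zero _
      have h := (hSmem z).mp hz
      rw [eval_levelPoly hc p x h0] at h
      have h2 := (mul_eq_zero.mp h).resolve_left (mul_ne_zero hR (pow_ne_zero _ h0))
      rw [← hS1 z hz, discSq_exp, sub_eq_zero] at h2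
      have h3 : discAngle c p z.arg = 2 * Real.cos x := by exact_mod_cast h2
      have h4 : Real.arccos (discAngle c p z.arg / 2) = x := by
        rw [h3, mul_div_cancel_left₀ _ two_ne_zero, Real.arccos_cos hx.1.le hx.2.le]
      refine ⟨⟨Complex.arg_mem_Ioc z, ?_⟩, h4⟩
      have h5 : 0 < Real.arccos (discAngle c p z.arg / 2) := by rw [h4]; exact hx.1
      have h6 : Real.arccos (discAngle c p z.arg / 2) < Real.pi := by rw [h4]; exact hx.2
      exact ⟨by linarith [Real.arccos_lt_pi.mp h6], by linarith [Real.arccos_pos.mp h5]⟩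
  rw [hset, ← tsum_subtype, Finset.tsum_subtype' (S.image Complex.arg) fun θ : ℝ => g (Complex.exp (θ * Complex.I)),
    Finset.sum_image]
  · rw [Finset.sum_congr rfl fun z hz => by rw [hS1 z hz]]
    rw [Finset.sum, hS, Multiset.toFinset_val, (levelPoly_roots_nodup hc hp hx).dedup]
  · intro z hz w hw h
    rw [← hS1 z hz, h, hS1 w hw]

/-- Change of variables from the bands to the interval `(0, π)`. -/
theorem lintegral_bandAngles {c : ℕ → ℂ} (hc : ∀ j, ‖c j‖ < 1) {p : ℕ} (hp : 0 < p)
    {g : ℂ → ℝ≥0∞} (hg : Measurable g) :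
    ∫⁻ θ in bandAngles c p,
        ENNReal.ofReal (|deriv (discAngle c p) θ| / √(4 - discAngle c p θ ^ 2)) *
          g (Complex.exp (θ * Complex.I)) =
      ∫⁻ x in Ioo 0 Real.pi, ((levelPoly c p x).roots.map g).sum := by
  have h := lintegral_abs_deriv_mul (s := bandAngles c p) (measurableSet_bandAngles c p)
    (f := fun θ => Real.arccos (discAngle c p θ / 2))
    (f' := fun θ => -(deriv (discAngle c p) θ / √(4 - discAngle c p θ ^ 2)))
    (fun θ hθ => hasStrictDerivAt_arccos_discAngle c p hθ.2.1 hθ.2.2)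
    (fun θ hθ => neg_ne_zero.mpr (div_ne_zero (deriv_discAngle_ne_zero hc hp hθ.2.1 hθ.2.2)
      (Real.sqrt_pos.mpr (by nlinarith [hθ.2.1, hθ.2.2])).ne'))
    (g := fun θ => g (Complex.exp (θ * Complex.I))) (hg.comp (by fun_prop))
  simp only [abs_neg, abs_div, abs_of_nonneg (Real.sqrt_nonneg _)] at h
  rw [h, ← lintegral_indicator measurableSet_Ioo]
  congr 1
  ext x
  by_cases hx : x ∈ Ioo 0 Real.pi
  · rw [indicator_of_mem hx, tsum_fiber_eq_sum_roots hc hp hx]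
  · rw [indicator_of_notMem hx]
    refine ENNReal.tsum_eq_zero.mpr fun θ => indicator_of_notMem ?_ _
    rintro ⟨⟨-, h1⟩, rfl⟩
    exact hx ⟨Real.arccos_pos.mpr (by linarith [h1.2]), Real.arccos_lt_pi.mpr (by linarith [h1.1])⟩

/-! ### The measure of the discriminant -/

/-- For `|φ| < π` the principal power of `e^{iφ}` is the smooth function `e^{-ipφ/2}`. The endpoint
`π` is left out because for odd `p` the branch jumps there. -/
theorem hasDerivAt_discriminant_exp {c : ℕ → ℂ} (hc : ∀ j, ‖c j‖ < 1) (p : ℕ) {θ : ℝ}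
    (hθ : θ ∈ Ioo (-Real.pi) Real.pi) :
    HasDerivAt (fun φ : ℝ => discriminant (fun j : Fin p => c j) (Complex.exp (φ * Complex.I)))
      (deriv (fun φ : ℝ => discriminant (fun j : Fin p => c j) (Complex.exp (φ * Complex.I))) θ)
      θ := by
  have h : (fun φ : ℝ => discriminant (fun j : Fin p => c j) (Complex.exp (φ * Complex.I))) =ᶠ[𝓝 θ]
      fun φ : ℝ => Complex.exp (φ * Complex.I * (-(p : ℂ) / 2)) *
        ((((√(rhoSq c p))⁻¹ : ℝ) : ℂ) * (tracePoly c p).eval (Complex.exp (φ * Complex.I))) := by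
    filter_upwards [Ioo_mem_nhds hθ.1 hθ.2] with φ hφ
    rw [discriminant_eq hc, Complex.cpow_def_of_ne_zero (Complex.exp_ne_zero _), Complex.log_exp]
    · simpa using hφ.1
    · simpa using hφ.2.le
  refine DifferentiableAt.hasDerivAt ?_
  refine DifferentiableAt.congr_of_eventuallyEq ?_ h
  refine DifferentiableAt.mul ?_ (((contDiff_eval_exp _).differentiable one_ne_zero θ).const_mul _)
  exact ((hasDerivAt_id θ).ofReal_comp.mul_const _ |>.mul_const _).cexp.differentiableAt

/-- With `W = Δ² - 2` one has `W' = 2 Δ Δ'` and `4 - W² = Δ² (4 - Δ²)`, so the factor `|Δ|` cancels;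
it is nonzero because `W > -2`. -/
theorem norm_deriv_discriminant_div {c : ℕ → ℂ} (hc : ∀ j, ‖c j‖ < 1) {p : ℕ} {θ : ℝ}
    (hθ : θ ∈ Ioo (-Real.pi) Real.pi) (h1 : -2 < discAngle c p θ) (h2 : discAngle c p θ < 2) :
    ‖deriv (fun φ : ℝ => discriminant (fun j : Fin p => c j) (Complex.exp (φ * Complex.I))) θ‖ /
        √(4 - (discriminant (fun j : Fin p => c j) (Complex.exp (θ * Complex.I))).re ^ 2) =
      2⁻¹ * (|deriv (discAngle c p) θ| / √(4 - discAngle c p θ ^ 2)) := by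
  have hd := hasDerivAt_discriminant_exp hc p hθ
  set d := fun φ : ℝ => discriminant (fun j : Fin p => c j) (Complex.exp (φ * Complex.I))
  have hsq : (fun φ => d φ ^ 2) = fun φ => ((discAngle c p φ + 2 : ℝ) : ℂ) := by
    ext φ
    rw [discriminant_sq hc, discSq_exp]
    push_cast
    rfl
  have hW : HasDerivAt (discAngle c p) (deriv (discAngle c p) θ) θ :=
    ((contDiff_discAngle c p).differentiable one_ne_zero θ).hasDerivAt
  have hd2 := hd.pow 2
  have hd3 := (hW.add_const 2).ofReal_comp
  have h3 : 2 * d θ * deriv d θ = ((deriv (discAngle c p) θ : ℝ) : ℂ) := by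
    have h4 : HasDerivAt (fun φ => d φ ^ 2) (2 * d θ * deriv d θ) θ :=
      hd2.congr_deriv (by norm_num)
    rw [hsq] at h4
    exact h4.unique hd3
  have hn : ‖d θ‖ = √(2 + discAngle c p θ) := by
    have h5 := congrArg norm (congrFun hsq θ)
    rw [norm_pow, Complex.norm_real, Real.norm_eq_abs, abs_of_pos (by linarith)] at h5
    rw [add_comm, ← h5, Real.sqrt_sq (norm_nonneg _)]
  have hre : (d θ).re ^ 2 = discAngle c p θ + 2 := by
    have := discriminant_re_sq hc (Complex.norm_exp_ofReal_mul_I θ) p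
    rwa [discSq_exp, Complex.ofReal_re] at this
  have hpos : 0 < √(2 + discAngle c p θ) := Real.sqrt_pos.mpr (by linarith)
  have hpos2 : 0 < √(2 - discAngle c p θ) := Real.sqrt_pos.mpr (by linarith)
  have h6 : 2 * √(2 + discAngle c p θ) * ‖deriv d θ‖ = |deriv (discAngle c p) θ| := by
    have := congrArg norm h3
    rwa [norm_mul, norm_mul, Complex.norm_real, Real.norm_eq_abs, hn, Complex.norm_ofNat] at this
  rw [← h6, hre, show 4 - (discAngle c p θ + 2) = 2 - discAngle c p θ by ring,
    show 4 - discAngle c p θ ^ 2 = (2 + discAngle c p θ) * (2 - discAngle c p θ) by ring,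
    Real.sqrt_mul (by linarith)]
  field_simp

theorem finite_discAngle_eq_neg_two {c : ℕ → ℂ} (hc : ∀ j, ‖c j‖ < 1) {p : ℕ} (hp : 0 < p) :
    (Ioc (-Real.pi) Real.pi ∩ {θ | discAngle c p θ = -2}).Finite := by
  refine ((tracePoly c p).roots.toFinset.finite_toSet.image Complex.arg).subset ?_
  rintro θ ⟨hθ, h⟩
  refine ⟨Complex.exp (θ * Complex.I), ?_, ?_⟩
  · rw [Finset.mem_coe, Multiset.mem_toFinset, mem_roots (tracePoly_monic c hp).1.ne_zero,
      IsRoot.def]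
    have h1 : ‖(tracePoly c p).eval (Complex.exp (θ * Complex.I))‖ ^ 2 / rhoSq c p = 0 := by
      have : discAngle c p θ = -2 := h
      rw [discAngle] at this
      linarith
    simpa [(rhoSq_pos hc p).ne'] using h1
  · rw [Complex.arg_exp_mul_I, toIocMod_eq_self]
    convert hθ using 1
    ring_nf

theorem measurable_discriminant {c : ℕ → ℂ} (hc : ∀ j, ‖c j‖ < 1) (p : ℕ) :
    Measurable (discriminant fun j : Fin p => c j) := by
  have : discriminant (fun j : Fin p => c j) = fun z => _ := funext fun z => discriminant_eq hc z p
  rw [this]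
  have h1 : Measurable fun z => (tracePoly c p).eval z := (tracePoly c p).continuous.measurable
  fun_prop

/-- The measure `ν_Δ` in terms of `Δ² - 2`. -/
theorem lintegral_discriminantMeasure {c : ℕ → ℂ} (hc : ∀ j, ‖c j‖ < 1) {p : ℕ} (hp : 0 < p)
    {g : ℂ → ℝ≥0∞} (hg : Measurable g) :
    ∫⁻ w, g w ∂(discriminantMeasure fun j : Fin p => c j) =
      ENNReal.ofReal ((2 * Real.pi * p)⁻¹) * ∫⁻ θ in bandAngles c p,
        ENNReal.ofReal (|deriv (discAngle c p) θ| / √(4 - discAngle c p θ ^ 2)) *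
          g (Complex.exp (θ * Complex.I)) := by
  have hexp : Measurable fun θ : ℝ => Complex.exp (θ * Complex.I) := by fun_prop
  have hD : Measurable fun θ : ℝ =>
      (discriminant (fun j : Fin p => c j) (Complex.exp (θ * Complex.I))).re :=
    Complex.measurable_re.comp ((measurable_discriminant hc p).comp hexp)
  have hdens : Measurable fun θ : ℝ => ENNReal.ofReal ((Real.pi * p)⁻¹ *
      (‖deriv (fun φ : ℝ => discriminant (fun j : Fin p => c j) (Complex.exp (φ * Complex.I))) θ‖ /
        √(4 - (discriminant (fun j : Fin p => c j) (Complex.exp (θ * Complex.I))).re ^ 2))) :=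
    ((((measurable_deriv _).norm).div ((measurable_const.sub (hD.pow_const 2)).sqrt)).const_mul
      _).ennreal_ofReal
  have hset : {θ : ℝ | θ ∈ Ioc (-Real.pi) Real.pi ∧
      Complex.exp (θ * Complex.I) ∈ bandSet fun j : Fin p => c j} =
      Ioc (-Real.pi) Real.pi ∩ discAngle c p ⁻¹' Iic 2 := by
    ext θ
    have h := mem_bandSet_iff hc hp (Complex.exp (θ * Complex.I))
    rw [discSq_exp, Complex.ofReal_re] at h
    exact and_congr_right fun _ => h.trans
      (and_iff_right (Complex.norm_exp_ofReal_mul_I θ))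
  have hm : MeasurableSet (Ioc (-Real.pi) Real.pi ∩ discAngle c p ⁻¹' Iic 2) :=
    measurableSet_Ioc.inter ((contDiff_discAngle c p).continuous.measurable measurableSet_Iic)
  have hgm : Measurable fun θ : ℝ => g (Complex.exp (θ * Complex.I)) := hg.comp hexp
  rw [discriminantMeasure, lintegral_map hg hexp, lintegral_withDensity_eq_lintegral_mul _ hdens
    hgm, hset, ← lintegral_indicator hm, ← lintegral_indicator
    (measurableSet_bandAngles c p), ← lintegral_const_mul']
  swap
  · exact ENNReal.ofReal_ne_top
  refine lintegral_congr_ae ?_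
  -- Two null sets are removed: the zeros of `Δ`, where passing to `Δ²` loses information, and `θ =
  -- π`, where the branch may jump.
  filter_upwards [(measure_eq_zero_iff_ae_notMem.mp
      ((finite_discAngle_eq_neg_two hc hp).measure_zero volume)),
    (measure_eq_zero_iff_ae_notMem.mp (measure_singleton (μ := volume) Real.pi))] with θ hθ1 hθ2
  by_cases hI : θ ∈ Ioc (-Real.pi) Real.pi
  swap
  · rw [indicator_of_notMem fun h => hI h.1, indicator_of_notMem fun h => hI h.1, mul_zero]
  have h1 : -2 < discAngle c p θ :=
    lt_of_le_of_ne (neg_two_le_discAngle hc p θ) fun h => hθ1 ⟨hI, h.symm⟩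
  have hIo : θ ∈ Ioo (-Real.pi) Real.pi := ⟨hI.1, lt_of_le_of_ne hI.2 hθ2⟩
  rcases lt_trichotomy (discAngle c p θ) 2 with h2 | h2 | h2
  · have hmem : θ ∈ Ioc (-Real.pi) Real.pi ∩ discAngle c p ⁻¹' Iic 2 := ⟨hI, h2.le⟩
    have hmem' : θ ∈ bandAngles c p := ⟨hI, h1, h2⟩
    rw [indicator_of_mem hmem, indicator_of_mem hmem']
    simp only [Pi.mul_apply]
    rw [norm_deriv_discriminant_div hc hIo h1 h2, ← mul_assoc, ← mul_assoc,
      ENNReal.ofReal_mul (by positivity)]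
    congr 3
    rw [← mul_inv]
    ring_nf
  -- At a band edge or a closed gap `Δ² = 4`; the density is a quotient by `√0 = 0`, hence `0`, and
  -- the point contributes nothing.
  · have hmem : θ ∈ Ioc (-Real.pi) Real.pi ∩ discAngle c p ⁻¹' Iic 2 := ⟨hI, h2.le⟩
    rw [indicator_of_mem hmem, indicator_of_notMem fun h => h.2.2.ne h2]
    have h3 := discriminant_re_sq hc (Complex.norm_exp_ofReal_mul_I θ) p
    rw [discSq_exp, Complex.ofReal_re, h2] at h3
    simp only [Pi.mul_apply]
    rw [h3]
    norm_num
  · rw [indicator_of_notMem fun h => (not_le.mpr h2) h.2, indicator_of_notMem fun h =>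
      h2.not_gt h.2.2, mul_zero]

/-- The working description of `ν_Δ`: the average over `x` of the normalized root-counting measures
of `levelPoly c p x`. Total mass, absence of atoms and the potential are all read off from it. -/
theorem lintegral_discriminantMeasure_eq_roots {c : ℕ → ℂ} (hc : ∀ j, ‖c j‖ < 1) {p : ℕ}
    (hp : 0 < p) {g : ℂ → ℝ≥0∞} (hg : Measurable g) :
    ∫⁻ w, g w ∂(discriminantMeasure fun j : Fin p => c j) =
      ENNReal.ofReal ((2 * Real.pi * p)⁻¹) *
        ∫⁻ x in Ioo 0 Real.pi, ((levelPoly c p x).roots.map g).sum := by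
  rw [lintegral_discriminantMeasure hc hp hg, lintegral_bandAngles hc hp hg]

theorem card_roots_levelPoly (c : ℕ → ℂ) {p : ℕ} (hp : 0 < p) (x : ℝ) :
    (levelPoly c p x).roots.card = 2 * p := by
  rw [splits_iff_card_roots.mp (IsAlgClosed.splits _), (levelPoly_monic c hp x).2]

theorem isProbabilityMeasure_discriminantMeasure {c : ℕ → ℂ} (hc : ∀ j, ‖c j‖ < 1) {p : ℕ}
    (hp : 0 < p) : IsProbabilityMeasure (discriminantMeasure fun j : Fin p => c j) := by
  constructor
  have h := lintegral_discriminantMeasure_eq_roots hc hp (g := fun _ => 1) measurable_const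
  rw [lintegral_one] at h
  rw [h]
  have hpp : (0 : ℝ) < p := by exact_mod_cast hp
  have hr : ∀ x, ((levelPoly c p x).roots.map fun _ => (1 : ℝ≥0∞)).sum =
      ENNReal.ofReal (2 * p) := by
    intro x
    rw [Multiset.map_const', Multiset.sum_replicate, card_roots_levelPoly c hp, nsmul_one,
      ENNReal.ofReal_mul (by norm_num)]
    simp
  simp only [hr, lintegral_const, Measure.restrict_apply_univ, Real.volume_Ioo, sub_zero]
  rw [← ENNReal.ofReal_mul (by positivity), ← ENNReal.ofReal_mul (by positivity),
    ← ENNReal.ofReal_one]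
  congr 1
  have := Real.pi_pos
  field_simp

theorem measurableSet_bandSet {c : ℕ → ℂ} (hc : ∀ j, ‖c j‖ < 1) {p : ℕ} (hp : 0 < p) :
    MeasurableSet (bandSet fun j : Fin p => c j) := by
  have h : (bandSet fun j : Fin p => c j) =
      {z | ‖z‖ = 1} ∩ {z | (discSq c p z).re ≤ 2} := by
    ext z
    exact mem_bandSet_iff hc hp z
  rw [h]
  have h1 : Measurable fun z => (tracePoly c p).eval z := (tracePoly c p).continuous.measurable
  have h2 : Measurable fun z => (discSq c p z).re := by
    unfold discSq
    fun_prop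
  exact (measurableSet_eq_fun measurable_norm measurable_const).inter
    (measurableSet_le h2 measurable_const)

theorem discriminantMeasure_compl_bandSet {c : ℕ → ℂ} (hc : ∀ j, ‖c j‖ < 1) {p : ℕ} (hp : 0 < p) :
    discriminantMeasure (fun j : Fin p => c j) (bandSet fun j : Fin p => c j)ᶜ = 0 := by
  have hm := (measurableSet_bandSet hc hp).compl
  rw [← lintegral_indicator_one hm, lintegral_discriminantMeasure hc hp
    (measurable_one.indicator hm)]
  refine mul_eq_zero_of_right _ ?_
  rw [setLIntegral_congr_fun (g := fun _ => 0) (measurableSet_bandAngles c p), lintegral_zero]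
  intro θ hθ
  have : Complex.exp (θ * Complex.I) ∈ bandSet fun j : Fin p => c j := by
    rw [mem_bandSet_iff hc hp, discSq_exp, Complex.ofReal_re]
    exact ⟨Complex.norm_exp_ofReal_mul_I θ, hθ.2.2.le⟩
  simp [this]

/-! ### The logarithmic potential -/

theorem norm_add_inv_sub_two_cos {Y : ℂ} (hY : Y ≠ 0) (x : ℝ) :
    ‖Y + Y⁻¹ - ((2 * Real.cos x : ℝ) : ℂ)‖ =
      ‖circleMap 0 1 x - Y‖ * ‖circleMap 0 1 x - Y⁻¹‖ := by
  have he : circleMap 0 1 x = Complex.exp (x * Complex.I) := by simp [circleMap]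
  have h0 : Complex.exp (x * Complex.I) ≠ 0 := Complex.exp_ne_zero _
  have h1 : ‖Complex.exp (x * Complex.I)‖ = 1 := Complex.norm_exp_ofReal_mul_I x
  rw [he, ← norm_mul, ← exp_add_exp_neg]
  set e := Complex.exp (x * Complex.I)
  have : Y + Y⁻¹ - (e + e⁻¹) = -(e⁻¹ * ((e - Y) * (e - Y⁻¹))) + 0 := by
    field_simp
    ring
  rw [this, add_zero, norm_neg, norm_mul, norm_inv, h1, inv_one, one_mul]

theorem ae_circleMap_ne (a : ℂ) : ∀ᵐ x : ℝ, x ∈ Ioc 0 (2 * Real.pi) → circleMap 0 1 x ≠ a := by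
  have h : (Ioc 0 (2 * Real.pi) ∩ {x | circleMap 0 1 x = a}).Subsingleton := by
    rintro x ⟨hx, hxa⟩ y ⟨hy, hya⟩
    exact injOn_circleMap_of_abs_sub_le one_ne_zero (by
      rw [zero_sub, abs_neg, abs_of_pos Real.two_pi_pos])
      (by rwa [uIoc_of_le Real.two_pi_pos.le]) (by rwa [uIoc_of_le Real.two_pi_pos.le])
      (Eq.trans hxa (Eq.symm hya))
  filter_upwards [measure_eq_zero_iff_ae_notMem.mp (h.measure_zero volume)] with x hx hx' ha
  exact hx ⟨hx', ha⟩

/-- The logarithmic potential of the arcsine law, in the coordinate `u = Y + Y⁻¹`. -/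
theorem integral_log_sub_two_cos {Y : ℂ} (hY : Y ≠ 0) :
    IntegrableOn (fun x : ℝ => Real.log ‖Y + Y⁻¹ - ((2 * Real.cos x : ℝ) : ℂ)‖)
      (Ioo 0 Real.pi) ∧
    ∫ x in Ioo 0 Real.pi, Real.log ‖Y + Y⁻¹ - ((2 * Real.cos x : ℝ) : ℂ)‖ =
      Real.pi * |Real.log ‖Y‖| := by
  set h := fun x : ℝ => Real.log ‖Y + Y⁻¹ - ((2 * Real.cos x : ℝ) : ℂ)‖ with hdef
  have hint : ∀ a : ℂ, IntervalIntegrable (fun x => Real.log ‖circleMap 0 1 x - a‖) volume 0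
      (2 * Real.pi) := fun a => circleIntegrable_log_norm_sub_const (a := a) (c := 0) 1
  -- Jensen's formula for a linear factor. Applied to `Y` and `Y⁻¹` it yields `log⁺ |Y| + log⁺ |Y|⁻¹
  -- = |log |Y||`.
  have hval : ∀ a : ℂ, ∫ x in (0 : ℝ)..2 * Real.pi, Real.log ‖circleMap 0 1 x - a‖ =
      2 * Real.pi * Real.posLog ‖a‖ := by
    intro a
    have := circleAverage_log_norm_sub_const_eq_posLog (a := a)
    rw [Real.circleAverage_def, smul_eq_mul] at this
    rw [← this, ← mul_assoc, mul_inv_cancel₀ Real.two_pi_pos.ne', one_mul]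
  have hcongr : ∀ᵐ x : ℝ, x ∈ uIoc 0 (2 * Real.pi) →
      Real.log ‖circleMap 0 1 x - Y‖ + Real.log ‖circleMap 0 1 x - Y⁻¹‖ = h x := by
    rw [uIoc_of_le Real.two_pi_pos.le]
    filter_upwards [ae_circleMap_ne Y, ae_circleMap_ne Y⁻¹] with x h1 h2 hx
    rw [hdef]
    simp only
    rw [norm_add_inv_sub_two_cos hY, Real.log_mul (norm_ne_zero_iff.mpr (sub_ne_zero.mpr (h1 hx)))
      (norm_ne_zero_iff.mpr (sub_ne_zero.mpr (h2 hx)))]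
  have hI : IntervalIntegrable h volume 0 (2 * Real.pi) :=
    ((hint Y).add (hint Y⁻¹)).congr_ae ((ae_restrict_iff' measurableSet_uIoc).mpr hcongr)
  have hV : ∫ x in (0 : ℝ)..2 * Real.pi, h x = 2 * Real.pi * |Real.log ‖Y‖| := by
    rw [← intervalIntegral.integral_congr_ae hcongr, intervalIntegral.integral_add (hint _) (hint _),
      hval, hval, ← mul_add, norm_inv]
    congr 1
    rw [Real.posLog, Real.posLog, Real.log_inv]
    rcases le_total 0 (Real.log ‖Y‖) with h0 | h0
    · rw [max_eq_right h0, max_eq_left (by linarith), abs_of_nonneg h0, add_zero]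
    · rw [max_eq_left h0, max_eq_right (by linarith), abs_of_nonpos h0, zero_add]
  have hpi := Real.pi_pos
  have hI1 : IntervalIntegrable h volume 0 Real.pi := hI.mono_set (by
    rw [uIcc_of_le hpi.le, uIcc_of_le Real.two_pi_pos.le]
    exact Icc_subset_Icc_right (by linarith))
  have hI2 : IntervalIntegrable h volume Real.pi (2 * Real.pi) := hI.mono_set (by
    rw [uIcc_of_le (by linarith), uIcc_of_le Real.two_pi_pos.le]
    exact Icc_subset_Icc_left hpi.le)
  -- The cosine is even about `π`, so the half period carries exactly half of the integral.
  have hsymm : ∫ x in Real.pi..2 * Real.pi, h x = ∫ x in (0 : ℝ)..Real.pi, h x := by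
    have h1 := intervalIntegral.integral_comp_sub_left h (2 * Real.pi) (a := 0) (b := Real.pi)
    rw [sub_zero, show 2 * Real.pi - Real.pi = Real.pi by ring] at h1
    rw [← h1]
    congr 1
    ext x
    rw [hdef]
    simp only
    rw [Real.cos_two_pi_sub]
  have hsum := intervalIntegral.integral_add_adjacent_intervals hI1 hI2
  rw [hsymm, hV] at hsum
  rw [intervalIntegrable_iff_integrableOn_Ioo_of_le hpi.le] at hI1
  refine ⟨hI1, ?_⟩
  rw [← integral_Ioc_eq_integral_Ioo, ← intervalIntegral.integral_of_le hpi.le]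
  linarith

theorem log_norm_eval_levelPoly {c : ℕ → ℂ} (hc : ∀ j, ‖c j‖ < 1) {p : ℕ} {z : ℂ} (hz : z ≠ 0)
    {x : ℝ} (hx : (levelPoly c p x).eval z ≠ 0) :
    Real.log ‖(levelPoly c p x).eval z‖ = Real.log (rhoSq c p * ‖z‖ ^ p) +
      Real.log ‖discSq c p z - ((2 * Real.cos x : ℝ) : ℂ)‖ := by
  have hR := rhoSq_pos hc p
  have hz' := norm_pos_iff.mpr hz
  rw [eval_levelPoly hc p x hz] at hx ⊢
  rw [norm_mul, norm_mul, norm_pow, Complex.norm_real, Real.norm_eq_abs, abs_of_pos hR,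
    Real.log_mul (by positivity) (norm_ne_zero_iff.mpr (right_ne_zero_of_mul hx))]

theorem log_norm_eval_eq_sum {P : ℂ[X]} (hP : P.Monic) {z : ℂ} (hz : P.eval z ≠ 0) :
    Real.log ‖P.eval z‖ = (P.roots.map fun w => Real.log ‖z - w‖).sum := by
  have h := (IsAlgClosed.splits P).eval_eq_prod_roots_of_monic hP z
  have h0 : (P.roots.map fun w => z - w).prod ≠ 0 := h ▸ hz
  rw [h]
  clear h
  revert h0
  generalize P.roots = s
  intro h0
  induction s using Multiset.induction_on with
  | empty => simp
  | cons a s ih =>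
    rw [Multiset.map_cons, Multiset.prod_cons] at h0
    rw [Multiset.map_cons, Multiset.prod_cons, norm_mul, Real.log_mul
      (norm_ne_zero_iff.mpr (left_ne_zero_of_mul h0))
      (norm_ne_zero_iff.mpr (right_ne_zero_of_mul h0)), ih (right_ne_zero_of_mul h0),
      Multiset.map_cons, Multiset.sum_cons]

theorem log_norm_sub_le_log_two {z w : ℂ} (hz : ‖z‖ ≤ 1) (hw : ‖w‖ ≤ 1) :
    Real.log ‖z - w‖ ≤ Real.log 2 := by
  rcases eq_or_ne (z - w) 0 with h | h
  · rw [h, norm_zero, Real.log_zero]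
    exact Real.log_nonneg (by norm_num)
  · exact Real.log_le_log (norm_pos_iff.mpr h) ((norm_sub_le z w).trans (by linarith))

theorem sum_ofReal_eq {s : Multiset ℂ} {f : ℂ → ℝ} (hf : ∀ w ∈ s, 0 ≤ f w) :
    (s.map fun w => ENNReal.ofReal (f w)).sum = ENNReal.ofReal (s.map f).sum ∧
      0 ≤ (s.map f).sum := by
  induction s using Multiset.induction_on with
  | empty => simp
  | cons a s ih =>
    obtain ⟨h1, h2⟩ := ih fun w hw => hf w (Multiset.mem_cons_of_mem hw)
    have h3 := hf a (Multiset.mem_cons_self a s)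
    rw [Multiset.map_cons, Multiset.sum_cons, Multiset.map_cons, Multiset.sum_cons, h1,
      ENNReal.ofReal_add h3 h2]
    exact ⟨rfl, add_nonneg h3 h2⟩

theorem ae_eval_levelPoly_ne_zero {c : ℕ → ℂ} (hc : ∀ j, ‖c j‖ < 1) {p : ℕ} {z : ℂ}
    (hz : z ≠ 0) : ∀ᵐ x : ℝ, x ∈ Ioo 0 Real.pi → (levelPoly c p x).eval z ≠ 0 := by
  have hR : (rhoSq c p : ℂ) ≠ 0 := by exact_mod_cast (rhoSq_pos hc p).ne'
  have hkey : ∀ x, (levelPoly c p x).eval z = 0 →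
      discSq c p z = ((2 * Real.cos x : ℝ) : ℂ) := by
    intro x hx
    rw [eval_levelPoly hc p x hz] at hx
    exact sub_eq_zero.mp
      ((mul_eq_zero.mp hx).resolve_left (mul_ne_zero hR (pow_ne_zero _ hz)))
  have h : (Ioo 0 Real.pi ∩ {x | (levelPoly c p x).eval z = 0}).Subsingleton := by
    rintro x ⟨hx, hxa⟩ y ⟨hy, hya⟩
    have h1 : ((2 * Real.cos x : ℝ) : ℂ) = ((2 * Real.cos y : ℝ) : ℂ) :=
      (hkey x hxa).symm.trans (hkey y hya)
    have h2 : 2 * Real.cos x = 2 * Real.cos y := by exact_mod_cast h1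
    exact Real.injOn_cos ⟨hx.1.le, hx.2.le⟩ ⟨hy.1.le, hy.2.le⟩ (by linarith)
  filter_upwards [measure_eq_zero_iff_ae_notMem.mp (h.measure_zero volume)] with x hx hx' ha
  exact hx ⟨hx', ha⟩

/-- Summing over the `2p` roots gives `2p log 2 - log |levelPoly(z)|`, which the arcsine potential
integrates over `x`. Subtracting from `log 2` makes the kernel nonnegative for `|z| ≤ 1`, so no
integrability is needed in advance, even at points of the circle. -/
theorem lintegral_log_discriminantMeasure {c : ℕ → ℂ} (hc : ∀ j, ‖c j‖ < 1) {p : ℕ} (hp : 0 < p)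
    {z Y : ℂ} (hz0 : z ≠ 0) (hz : ‖z‖ ≤ 1) (hY : Y ≠ 0) (hYF : Y + Y⁻¹ = discSq c p z) :
    ∫⁻ w, ENNReal.ofReal (Real.log 2 - Real.log ‖z - w‖)
        ∂(discriminantMeasure fun j : Fin p => c j) =
      ENNReal.ofReal (Real.log 2 -
        (Real.log (rhoSq c p * ‖z‖ ^ p) + |Real.log ‖Y‖|) / (2 * p)) ∧
    0 ≤ Real.log 2 - (Real.log (rhoSq c p * ‖z‖ ^ p) + |Real.log ‖Y‖|) / (2 * p) := by
  obtain ⟨hI, hV⟩ := integral_log_sub_two_cos hY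
  rw [hYF] at hI hV
  have hpp : (0 : ℝ) < p := by exact_mod_cast hp
  have hpi := Real.pi_pos
  set k := fun x : ℝ => 2 * p * Real.log 2 - (Real.log (rhoSq c p * ‖z‖ ^ p) +
      Real.log ‖discSq c p z - ((2 * Real.cos x : ℝ) : ℂ)‖) with hk
  have hae : ∀ᵐ x ∂(volume.restrict (Ioo 0 Real.pi)),
      ((levelPoly c p x).roots.map fun w =>
        ENNReal.ofReal (Real.log 2 - Real.log ‖z - w‖)).sum = ENNReal.ofReal (k x) ∧ 0 ≤ k x := by
    rw [ae_restrict_iff' measurableSet_Ioo]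
    filter_upwards [ae_eval_levelPoly_ne_zero hc hz0] with x hx0 hx
    have h1 := sum_ofReal_eq (s := (levelPoly c p x).roots)
      (f := fun w => Real.log 2 - Real.log ‖z - w‖) (by
        intro w hw
        have hw1 := norm_eq_one_of_levelPoly_root hc hp hx (isRoot_of_mem_roots hw)
        exact sub_nonneg.mpr (log_norm_sub_le_log_two hz hw1.le))
    have h2 : ((levelPoly c p x).roots.map fun w => Real.log 2 - Real.log ‖z - w‖).sum = k x := by
      rw [Multiset.sum_map_sub, Multiset.map_const', Multiset.sum_replicate,
        card_roots_levelPoly c hp, ← log_norm_eval_eq_sum (levelPoly_monic c hp x).1 (hx0 hx),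
        log_norm_eval_levelPoly hc hz0 (hx0 hx), nsmul_eq_mul,
        Nat.cast_mul, Nat.cast_ofNat]
    rwa [h2] at h1
  have hconst : ∀ C : ℝ, IntegrableOn (fun _ : ℝ => C) (Ioo 0 Real.pi) := fun C =>
    integrableOn_const (by simp)
  have hkI : IntegrableOn k (Ioo 0 Real.pi) := (hconst _).sub ((hconst _).add hI)
  have hkV : ∫ x in Ioo 0 Real.pi, k x = Real.pi * (2 * p * Real.log 2 -
      (Real.log (rhoSq c p * ‖z‖ ^ p) + |Real.log ‖Y‖|)) := by
    simp only [hk, ← sub_sub]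
    rw [integral_sub (hconst _) hI, hV]
    rw [setIntegral_const, Real.volume_real_Ioo_of_le hpi.le, smul_eq_mul]
    ring
  have hval : Real.log 2 - (Real.log (rhoSq c p * ‖z‖ ^ p) + |Real.log ‖Y‖|) / (2 * p) =
      (2 * Real.pi * p)⁻¹ * ∫ x in Ioo 0 Real.pi, k x := by
    rw [hkV]
    field_simp
  constructor
  · rw [lintegral_discriminantMeasure_eq_roots hc hp (by fun_prop),
      lintegral_congr_ae (hae.mono fun x hx => hx.1),
      ← ofReal_integral_eq_lintegral_ofReal hkI (hae.mono fun x hx => hx.2),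
      ← ENNReal.ofReal_mul (by positivity), hval]
  · rw [hval]
    exact mul_nonneg (by positivity) (integral_nonneg_of_ae (hae.mono fun x hx => hx.2))

theorem ae_norm_eq_one_discriminantMeasure {c : ℕ → ℂ} (hc : ∀ j, ‖c j‖ < 1) {p : ℕ}
    (hp : 0 < p) : ∀ᵐ w ∂(discriminantMeasure fun j : Fin p => c j), ‖w‖ = 1 := by
  refine measure_mono_null (fun w hw => ?_) (discriminantMeasure_compl_bandSet hc hp)
  exact fun h => hw ((mem_bandSet_iff hc hp w).mp h).1

/-- The logarithmic potential of `ν_Δ` in the closed unit disk. -/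
theorem integral_log_discriminantMeasure {c : ℕ → ℂ} (hc : ∀ j, ‖c j‖ < 1) {p : ℕ} (hp : 0 < p)
    {z Y : ℂ} (hz0 : z ≠ 0) (hz : ‖z‖ ≤ 1) (hY : Y ≠ 0) (hYF : Y + Y⁻¹ = discSq c p z) :
    Integrable (fun w => Real.log ‖z - w‖) (discriminantMeasure fun j : Fin p => c j) ∧
    ∫ w, Real.log ‖z - w‖ ∂(discriminantMeasure fun j : Fin p => c j) =
      (Real.log (rhoSq c p * ‖z‖ ^ p) + |Real.log ‖Y‖|) / (2 * p) := by
  obtain ⟨h1, h2⟩ := lintegral_log_discriminantMeasure hc hp hz0 hz hY hYF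
  have := isProbabilityMeasure_discriminantMeasure hc hp
  set ν := discriminantMeasure fun j : Fin p => c j
  have hpos : 0 ≤ᵐ[ν] fun w => Real.log 2 - Real.log ‖z - w‖ :=
    (ae_norm_eq_one_discriminantMeasure hc hp).mono fun w hw =>
      sub_nonneg.mpr (log_norm_sub_le_log_two hz hw.le)
  have hm : AEStronglyMeasurable (fun w => Real.log 2 - Real.log ‖z - w‖) ν :=
    (by fun_prop : Measurable fun w => Real.log 2 - Real.log ‖z - w‖).aestronglyMeasurable
  have hi : Integrable (fun w => Real.log 2 - Real.log ‖z - w‖) ν := by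
    refine ⟨hm, ?_⟩
    rw [hasFiniteIntegral_iff_ofReal hpos, h1]
    exact ENNReal.ofReal_lt_top
  have hi' : Integrable (fun w => Real.log ‖z - w‖) ν := by
    exact ((integrable_const (Real.log 2)).sub hi).congr (ae_of_all _ fun w => by simp)
  refine ⟨hi', ?_⟩
  have h3 := integral_eq_lintegral_of_nonneg_ae hpos hm
  rw [h1, ENNReal.toReal_ofReal h2, integral_sub (integrable_const _) hi', integral_const,
    probReal_univ, one_smul] at h3
  linarith

/-! ### Weak convergence of measures on the unit circle -/

theorem tendsto_integral_of_approx {E ι : Type*} [NormedAddCommGroup E] [NormedSpace ℝ E]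
    {l : Filter ι} {μ : ι → Measure ℂ} {ν : Measure ℂ}
    [∀ i, IsProbabilityMeasure (μ i)] [IsProbabilityMeasure ν] (hμ : ∀ i, ∀ᵐ w ∂μ i, ‖w‖ = 1)
    (hν : ∀ᵐ w ∂ν, ‖w‖ = 1) {g : ℂ → E} (hg : ∀ i, Integrable g (μ i)) (hgν : Integrable g ν)
    (h : ∀ δ > 0, ∃ f : ℂ → E, (∀ i, Integrable f (μ i)) ∧ Integrable f ν ∧
      (∀ w, ‖w‖ = 1 → ‖g w - f w‖ ≤ δ) ∧
      Tendsto (fun i => ∫ w, f w ∂μ i) l (𝓝 (∫ w, f w ∂ν))) :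
    Tendsto (fun i => ∫ w, g w ∂μ i) l (𝓝 (∫ w, g w ∂ν)) := by
  rw [Metric.tendsto_nhds]
  intro ε hε
  obtain ⟨f, hf, hfν, hfg, hlim⟩ := h (ε / 4) (by positivity)
  have hb : ∀ (m : Measure ℂ) [IsProbabilityMeasure m], (∀ᵐ w ∂m, ‖w‖ = 1) → Integrable f m →
      Integrable g m → ‖∫ w, g w ∂m - ∫ w, f w ∂m‖ ≤ ε / 4 := by
    intro m _ hm hfm hgm
    rw [← integral_sub hgm hfm]
    have := norm_integral_le_of_norm_le_const (hm.mono fun w hw => hfg w hw)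
    simpa using this
  filter_upwards [(Metric.tendsto_nhds.mp hlim) (ε / 4) (by positivity)] with i hi
  have h1 := hb (μ i) (hμ i) (hf i) (hg i)
  have h2 := hb ν hν hfν hgν
  rw [dist_eq_norm] at hi ⊢
  calc ‖∫ w, g w ∂μ i - ∫ w, g w ∂ν‖
      = ‖(∫ w, g w ∂μ i - ∫ w, f w ∂μ i) + (∫ w, f w ∂μ i - ∫ w, f w ∂ν) -
          (∫ w, g w ∂ν - ∫ w, f w ∂ν)‖ := by congr 1; abel
    _ ≤ ‖∫ w, g w ∂μ i - ∫ w, f w ∂μ i‖ + ‖∫ w, f w ∂μ i - ∫ w, f w ∂ν‖ +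
          ‖∫ w, g w ∂ν - ∫ w, f w ∂ν‖ :=
        (norm_sub_le _ _).trans (by gcongr; exact norm_add_le _ _)
    _ < ε := by linarith

/-- The angular coordinate in `ℝ / ℤ`. -/
noncomputable def unitAngle (w : ℂ) : UnitAddCircle := ((w.arg / (2 * Real.pi) : ℝ) : UnitAddCircle)

theorem measurable_unitAngle : Measurable unitAngle :=
  (AddCircle.continuous_mk' (1 : ℝ)).measurable.comp (Complex.measurable_arg.div_const _)

theorem fourier_unitAngle (n : ℤ) {w : ℂ} (hw : ‖w‖ = 1) : fourier n (unitAngle w) = w ^ n := by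
  have h := Complex.norm_mul_exp_arg_mul_I w
  rw [hw, Complex.ofReal_one, one_mul] at h
  conv_rhs => rw [← h]
  rw [unitAngle, fourier_coe_apply, ← Complex.exp_int_mul]
  congr 1
  have : (Real.pi : ℂ) ≠ 0 := by exact_mod_cast Real.pi_ne_zero
  push_cast
  field_simp

theorem integrable_comp_unitAngle (q : C(UnitAddCircle, ℂ)) (m : Measure ℂ)
    [IsProbabilityMeasure m] : Integrable (fun w => q (unitAngle w)) m :=
  Integrable.of_bound (q.continuous.measurable.comp measurable_unitAngle).aestronglyMeasurable ‖q‖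
    (ae_of_all _ fun _ => q.norm_coe_le_norm _)

/-- Convergence of the moments implies weak convergence on the unit circle. -/
theorem tendsto_integral_of_moments {ι : Type*} {l : Filter ι} {μ : ι → Measure ℂ} {ν : Measure ℂ}
    [∀ i, IsProbabilityMeasure (μ i)] [IsProbabilityMeasure ν] (hμ : ∀ i, ∀ᵐ w ∂μ i, ‖w‖ = 1)
    (hν : ∀ᵐ w ∂ν, ‖w‖ = 1)
    (h : ∀ k : ℕ, Tendsto (fun i => ∫ w, w ^ k ∂μ i) l (𝓝 (∫ w, w ^ k ∂ν))) (f : ℂ →ᵇ ℝ) :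
    Tendsto (fun i => ∫ w, f w ∂μ i) l (𝓝 (∫ w, f w ∂ν)) := by
  have hspan : ∀ q ∈ Submodule.span ℂ (range (fourier (T := (1 : ℝ)))),
      Tendsto (fun i => ∫ w, q (unitAngle w) ∂μ i) l (𝓝 (∫ w, q (unitAngle w) ∂ν)) := by
    intro q hq
    induction hq using Submodule.span_induction with
    | mem q hq =>
      obtain ⟨n, rfl⟩ := hq
      have hcongr : ∀ m : Measure ℂ, (∀ᵐ w ∂m, ‖w‖ = 1) →
          ∫ w, fourier n (unitAngle w) ∂m = ∫ w, w ^ n ∂m := fun m hm =>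
        integral_congr_ae (hm.mono fun w hw => fourier_unitAngle n hw)
      simp only [hcongr _ (hμ _), hcongr _ hν]
      obtain ⟨k, rfl | rfl⟩ := n.eq_nat_or_neg
      · simpa using h k
      -- On the circle `w⁻¹` is the conjugate of `w`, so negative Fourier coefficients are
      -- conjugates of positive ones.
      · have hconj : ∀ m : Measure ℂ, (∀ᵐ w ∂m, ‖w‖ = 1) →
            ∫ w, w ^ (-(k : ℤ)) ∂m = starRingEnd ℂ (∫ w, w ^ k ∂m) := fun m hm => by
          rw [← integral_conj]
          refine integral_congr_ae (hm.mono fun w hw => ?_)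
          simp only
          rw [zpow_neg, zpow_natCast, map_pow, ← inv_pow]
          congr 1
          rw [inv_eq_iff_eq_inv, inv_conj_of_norm_one hw]
        simp only [hconj _ (hμ _), hconj _ hν]
        exact (Complex.continuous_conj.tendsto _).comp (h k)
    | zero => simpa using tendsto_const_nhds
    | add q r _ _ h1 h2 =>
      simp only [ContinuousMap.add_apply]
      simp_rw [fun m : ι => integral_add (integrable_comp_unitAngle q (μ m))
        (integrable_comp_unitAngle r (μ m))]
      rw [integral_add (integrable_comp_unitAngle q ν) (integrable_comp_unitAngle r ν)]
      exact h1.add h2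
    | smul c q _ h1 =>
      simp only [ContinuousMap.smul_apply, integral_smul]
      exact h1.const_smul c
  set F : C(UnitAddCircle, ℂ) :=
    ⟨fun x => (f (fourier 1 x) : ℂ), by fun_prop⟩ with hF
  have hFf : ∀ w : ℂ, ‖w‖ = 1 → F (unitAngle w) = (f w : ℂ) := by
    intro w hw
    change ((f (fourier 1 (unitAngle w)) : ℝ) : ℂ) = _
    rw [fourier_unitAngle 1 hw, zpow_one]
  have hlim : Tendsto (fun i => ∫ w, F (unitAngle w) ∂μ i) l (𝓝 (∫ w, F (unitAngle w) ∂ν)) := by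
    refine tendsto_integral_of_approx hμ hν (fun i => integrable_comp_unitAngle F _)
      (integrable_comp_unitAngle F _) fun δ hδ => ?_
    have hmem : F ∈ (Submodule.span ℂ (range (fourier (T := (1 : ℝ))))).topologicalClosure := by
      rw [span_fourier_closure_eq_top]; trivial
    obtain ⟨q, hq, hd⟩ := Metric.mem_closure_iff.mp hmem δ hδ
    refine ⟨fun w => q (unitAngle w), fun i => integrable_comp_unitAngle q _,
      integrable_comp_unitAngle q _, fun w _ => ?_, hspan q hq⟩
    rw [← dist_eq_norm]
    exact (ContinuousMap.dist_apply_le_dist _).trans hd.le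
  have hre : ∀ m : Measure ℂ, (∀ᵐ w ∂m, ‖w‖ = 1) →
      ∫ w, F (unitAngle w) ∂m = ((∫ w, f w ∂m : ℝ) : ℂ) := fun m hm => by
    rw [← integral_complex_ofReal]
    exact integral_congr_ae (hm.mono fun w hw => hFf w hw)
  simp only [hre _ (hμ _), hre _ hν] at hlim
  exact (Complex.continuous_re.tendsto _).comp hlim

/-! ### Moments from logarithmic potentials near the origin -/

theorem log_norm_sub_eq_log_norm_one_sub {z w : ℂ} (hw : ‖w‖ = 1) :
    ‖z - w‖ = ‖1 - z * starRingEnd ℂ w‖ := by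
  have h : w * starRingEnd ℂ w = 1 := by
    rw [Complex.mul_conj, Complex.normSq_eq_norm_sq, hw]; simp
  rw [norm_sub_rev, ← mul_one ‖w - z‖, ← hw, ← Complex.norm_conj w, ← norm_mul, sub_mul, h]

/-- Taylor remainder of `log (1 - u)`. The term `j = 0` is a division by zero and has the value `0`.
-/
theorem abs_log_norm_one_sub_add_sum_le {u : ℂ} (hu : ‖u‖ ≤ 1 / 4) (k : ℕ) :
    |Real.log ‖1 - u‖ + ∑ j ∈ Finset.range (k + 1), (u ^ j).re / j| ≤ 2 * ‖u‖ ^ (k + 1) := by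
  have hu1 : ‖-u‖ < 1 := by rw [norm_neg]; linarith
  have h := Complex.norm_log_sub_logTaylor_le k hu1
  have hT : Complex.logTaylor (k + 1) (-u) = -∑ j ∈ Finset.range (k + 1), u ^ j / j := by
    rw [Complex.logTaylor, ← Finset.sum_neg_distrib]
    refine Finset.sum_congr rfl fun j _ => ?_
    rw [← neg_one_mul u, mul_pow, ← mul_assoc, ← pow_add, show j + 1 + j = 2 * j + 1 by ring,
      pow_succ, pow_mul]
    simp
    ring
  rw [hT, sub_neg_eq_add, ← sub_eq_add_neg, norm_neg] at h
  have hre : (Complex.log (1 - u) + ∑ j ∈ Finset.range (k + 1), u ^ j / j).re =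
      Real.log ‖1 - u‖ + ∑ j ∈ Finset.range (k + 1), (u ^ j).re / j := by
    rw [Complex.add_re, Complex.log_re, Complex.re_sum]
    simp
  rw [← hre]
  refine (Complex.abs_re_le_norm _).trans (h.trans ?_)
  have h2 : (1 - ‖u‖)⁻¹ ≤ 2 := by
    rw [inv_le_comm₀ (by linarith) (by norm_num)]; linarith
  have h3 : 0 ≤ (1 - ‖u‖)⁻¹ := inv_nonneg.mpr (by linarith)
  calc ‖u‖ ^ (k + 1) * (1 - ‖u‖)⁻¹ / (k + 1) ≤ ‖u‖ ^ (k + 1) * (1 - ‖u‖)⁻¹ :=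
        div_le_self (by positivity) (by linarith [k.cast_nonneg (α := ℝ)])
    _ ≤ ‖u‖ ^ (k + 1) * 2 := by gcongr
    _ = _ := mul_comm _ _

theorem integrable_re_pow {m : Measure ℂ} [IsProbabilityMeasure m] (hm : ∀ᵐ w ∂m, ‖w‖ = 1) (ζ : ℂ)
    (k : ℕ) : Integrable (fun w => ((ζ * starRingEnd ℂ w) ^ k).re) m := by
  refine Integrable.of_bound (C := ‖ζ‖ ^ k) ?_ (hm.mono fun w hw => ?_)
  · exact (Continuous.measurable (by fun_prop)).aestronglyMeasurable
  · refine (Complex.abs_re_le_norm _).trans ?_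
    rw [norm_pow, norm_mul, Complex.norm_conj, hw, mul_one]

theorem abs_log_norm_sub_le {z w : ℂ} (hz : ‖z‖ ≤ 1 / 4) (hw : ‖w‖ = 1) :
    |Real.log ‖z - w‖| ≤ 1 := by
  rw [log_norm_sub_eq_log_norm_one_sub hw]
  have hu : ‖z * starRingEnd ℂ w‖ ≤ 1 / 4 := by
    rw [norm_mul, Complex.norm_conj, hw, mul_one]; exact hz
  have h := abs_log_norm_one_sub_add_sum_le hu 0
  simp at h
  have h2 : ‖z‖ * ‖w‖ ≤ 1 / 4 := by rw [hw, mul_one]; exact hz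
  linarith

theorem integrable_log_norm_sub {m : Measure ℂ} [IsProbabilityMeasure m]
    (hm : ∀ᵐ w ∂m, ‖w‖ = 1) {z : ℂ} (hz : ‖z‖ ≤ 1 / 4) :
    Integrable (fun w => Real.log ‖z - w‖) m :=
  Integrable.of_bound (by fun_prop : Measurable fun w => Real.log ‖z - w‖).aestronglyMeasurable 1
    (hm.mono fun _ hw => abs_log_norm_sub_le hz hw)

/-- Convergence of the logarithmic potentials near `0` implies convergence of the moments. -/
theorem tendsto_integral_re_pow_of_potential {ι : Type*} {l : Filter ι} {μ : ι → Measure ℂ}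
    {ν : Measure ℂ} [∀ i, IsProbabilityMeasure (μ i)] [IsProbabilityMeasure ν]
    (hμ : ∀ i, ∀ᵐ w ∂μ i, ‖w‖ = 1) (hν : ∀ᵐ w ∂ν, ‖w‖ = 1)
    (h : ∀ z : ℂ, z ≠ 0 → ‖z‖ ≤ 1 / 4 → Tendsto (fun i => ∫ w, Real.log ‖z - w‖ ∂μ i) l
      (𝓝 (∫ w, Real.log ‖z - w‖ ∂ν))) {ζ : ℂ} (hζ : ‖ζ‖ = 1) (k : ℕ) :
    Tendsto (fun i => ∫ w, ((ζ * starRingEnd ℂ w) ^ k).re ∂μ i) l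
      (𝓝 (∫ w, ((ζ * starRingEnd ℂ w) ^ k).re ∂ν)) := by
  induction k using Nat.strong_induction_on with
  | _ k ih =>
  rcases k.eq_zero_or_pos with rfl | hk
  · simpa using tendsto_const_nhds
  have hk' : (0 : ℝ) < k := by exact_mod_cast hk
  refine tendsto_integral_of_approx hμ hν (fun i => integrable_re_pow (hμ i) ζ k)
    (integrable_re_pow hν ζ k) fun δ hδ => ?_
  -- At `z = ε ζ` the `k`-th moment has coefficient `ε^k / k` in the potential and the remainder is
  -- at most `2 ε^{k+1}`; after rescaling the error is `2 k ε ≤ δ`. Lower moments converge by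
  -- induction.
  set ε := min (1 / 4) (δ / (2 * k)) with hε
  have hε0 : 0 < ε := lt_min (by norm_num) (by positivity)
  have hε1 : ε ≤ 1 / 4 := min_le_left _ _
  have hε2 : 2 * k * ε ≤ δ := by
    have : ε ≤ δ / (2 * k) := min_le_right _ _
    rwa [le_div_iff₀ (by positivity), mul_comm] at this
  have hn : ‖(ε : ℂ) * ζ‖ = ε := by
    rw [norm_mul, hζ, mul_one, Complex.norm_real, Real.norm_eq_abs, abs_of_pos hε0]
  set f : ℂ → ℝ := fun w => -(k / ε ^ k) * (Real.log ‖ε * ζ - w‖ +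
    ∑ j ∈ Finset.range k, ε ^ j / j * ((ζ * starRingEnd ℂ w) ^ j).re) with hf
  have hsum : ∀ (m : Measure ℂ) [IsProbabilityMeasure m], (∀ᵐ w ∂m, ‖w‖ = 1) →
      Integrable (fun w => ∑ j ∈ Finset.range k, ε ^ j / j * ((ζ * starRingEnd ℂ w) ^ j).re) m :=
    fun m _ hm => integrable_finsetSum _ fun j _ => (integrable_re_pow hm ζ j).const_mul _
  have hlog : ∀ (m : Measure ℂ) [IsProbabilityMeasure m], (∀ᵐ w ∂m, ‖w‖ = 1) →
      Integrable (fun w => Real.log ‖ε * ζ - w‖) m :=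
    fun m _ hm => integrable_log_norm_sub hm (by rw [hn]; exact hε1)
  have hfI : ∀ (m : Measure ℂ) [IsProbabilityMeasure m], (∀ᵐ w ∂m, ‖w‖ = 1) → Integrable f m :=
    fun m _ hm => ((hlog m hm).add (hsum m hm)).const_mul _
  have hfV : ∀ (m : Measure ℂ) [IsProbabilityMeasure m], (∀ᵐ w ∂m, ‖w‖ = 1) →
      ∫ w, f w ∂m = -(k / ε ^ k) * (∫ w, Real.log ‖ε * ζ - w‖ ∂m +
        ∑ j ∈ Finset.range k, ε ^ j / j * ∫ w, ((ζ * starRingEnd ℂ w) ^ j).re ∂m) := by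
    intro m _ hm
    rw [hf, integral_const_mul, integral_add (hlog m hm) (hsum m hm), integral_finsetSum _
      fun j _ => (integrable_re_pow hm ζ j).const_mul _]
    simp only [integral_const_mul]
  refine ⟨f, fun i => hfI _ (hμ i), hfI _ hν, fun w hw => ?_, ?_⟩
  · set u := ζ * starRingEnd ℂ w with hu
    have hu1 : ‖(ε : ℂ) * u‖ = ε := by
      rw [hu, ← mul_assoc, norm_mul, hn, Complex.norm_conj, hw, mul_one]
    have h1 := abs_log_norm_one_sub_add_sum_le (u := ε * u) (by rw [hu1]; exact hε1) k
    have hpow : ∀ j : ℕ, (((ε : ℂ) * u) ^ j).re = ε ^ j * (u ^ j).re := by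
      intro j
      rw [mul_pow, ← Complex.ofReal_pow, Complex.re_ofReal_mul]
    rw [hu1, Finset.sum_range_succ] at h1
    simp only [hpow] at h1
    have h2 : (u ^ k).re - f w = (k / ε ^ k) * (Real.log ‖1 - ε * u‖ +
        (∑ j ∈ Finset.range k, ε ^ j * (u ^ j).re / j + ε ^ k * (u ^ k).re / k)) := by
      rw [hf]
      simp only
      rw [log_norm_sub_eq_log_norm_one_sub hw, mul_assoc, ← hu]
      simp only [div_mul_eq_mul_div]
      field_simp
      ring
    rw [h2, norm_mul, Real.norm_eq_abs, Real.norm_eq_abs, abs_of_pos (by positivity)]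
    calc (k / ε ^ k) * |_| ≤ (k / ε ^ k) * (2 * ε ^ (k + 1)) := by gcongr
      _ = 2 * k * ε := by rw [pow_succ]; field_simp
      _ ≤ δ := hε2
  · simp only [hfV _ (hμ _), hfV _ hν]
    refine Tendsto.const_mul _ (Tendsto.add (h _ ?_ (by rw [hn]; exact hε1)) ?_)
    · rw [← norm_pos_iff, hn]; exact hε0
    · exact tendsto_finsetSum _ fun j hj => (ih j (Finset.mem_range.mp hj)).const_mul _

/-- Convergence of the logarithmic potentials near `0` implies weak convergence on the circle. -/
theorem tendsto_integral_of_potential {ι : Type*} {l : Filter ι} {μ : ι → Measure ℂ}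
    {ν : Measure ℂ} [∀ i, IsProbabilityMeasure (μ i)] [IsProbabilityMeasure ν]
    (hμ : ∀ i, ∀ᵐ w ∂μ i, ‖w‖ = 1) (hν : ∀ᵐ w ∂ν, ‖w‖ = 1)
    (h : ∀ z : ℂ, z ≠ 0 → ‖z‖ ≤ 1 / 4 → Tendsto (fun i => ∫ w, Real.log ‖z - w‖ ∂μ i) l
      (𝓝 (∫ w, Real.log ‖z - w‖ ∂ν))) (f : ℂ →ᵇ ℝ) :
    Tendsto (fun i => ∫ w, f w ∂μ i) l (𝓝 (∫ w, f w ∂ν)) := by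
  refine tendsto_integral_of_moments hμ hν (fun k => ?_) f
  rcases k.eq_zero_or_pos with rfl | hk
  · simpa using tendsto_const_nhds
  have hk' : (k : ℂ) ≠ 0 := by exact_mod_cast hk.ne'
  -- Real parts with `ζ = 1` give the real part of the moment; with `ζ^k = i` they give its
  -- imaginary part.
  set ζ := Complex.exp ((Real.pi / 2 / k : ℝ) * Complex.I) with hζ
  have hζk : ζ ^ k = Complex.I := by
    have harg : (k : ℂ) * ((Real.pi / 2 / k : ℝ) * Complex.I) = Real.pi / 2 * Complex.I := by
      push_cast
      field_simp
    rw [hζ, ← Complex.exp_nat_mul, harg, Complex.exp_pi_div_two_mul_I]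
  have hre := tendsto_integral_re_pow_of_potential hμ hν h (ζ := 1) (by simp) k
  have him := tendsto_integral_re_pow_of_potential hμ hν h (ζ := ζ)
    (Complex.norm_exp_ofReal_mul_I _) k
  have hdec : ∀ (m : Measure ℂ) [IsProbabilityMeasure m], (∀ᵐ w ∂m, ‖w‖ = 1) →
      ∫ w, w ^ k ∂m = ((∫ w, ((1 * starRingEnd ℂ w) ^ k).re ∂m : ℝ) : ℂ) +
        ((∫ w, ((ζ * starRingEnd ℂ w) ^ k).re ∂m : ℝ) : ℂ) * Complex.I := by
    intro m _ hm
    have h1 : Integrable (fun w => ((((1 * starRingEnd ℂ w) ^ k).re : ℝ) : ℂ)) m :=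
      (integrable_re_pow hm 1 k).ofReal
    have h2 : Integrable (fun w => ((((ζ * starRingEnd ℂ w) ^ k).re : ℝ) : ℂ)) m :=
      (integrable_re_pow hm ζ k).ofReal
    rw [← integral_complex_ofReal, ← integral_complex_ofReal, ← integral_mul_const,
      ← integral_add h1 (h2.mul_const _)]
    congr 1
    ext w
    rw [one_mul, mul_pow, hζk, ← map_pow]
    generalize w ^ k = v
    apply Complex.ext <;> simp
  simp only [hdec _ (hμ _), hdec _ hν]
  exact ((Complex.continuous_ofReal.tendsto _).comp hre).add
    (((Complex.continuous_ofReal.tendsto _).comp him).mul_const _)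

/-! ### Positivity of the logarithmic energy on the unit circle -/

/-- The logarithmic kernel is integrable against `μ × ν`, which does not charge the diagonal. -/
def FiniteMutualEnergy (μ ν : Measure ℂ) : Prop :=
  (∀ᵐ q ∂(μ.prod ν), q.1 ≠ q.2) ∧ Integrable (fun q : ℂ × ℂ => Real.log ‖q.1 - q.2‖) (μ.prod ν)

theorem ae_prod_norm_eq_one {μ ν : Measure ℂ} [SFinite μ] [SFinite ν]
    (hμ : ∀ᵐ w ∂μ, ‖w‖ = 1) (hν : ∀ᵐ w ∂ν, ‖w‖ = 1) :
    ∀ᵐ q ∂(μ.prod ν), ‖q.1‖ = 1 ∧ ‖q.2‖ = 1 :=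
  (Measure.quasiMeasurePreserving_fst.ae hμ).and (Measure.quasiMeasurePreserving_snd.ae hν)

/-- For `r < 1` the regularized kernel is `∑ r^n Re (z w̄)^n / n`, uniformly convergent, and each
term splits by Fubini into a product of moments. This diagonalizes the energy. -/
theorem hasSum_abel_energy {μ ν : Measure ℂ} [IsProbabilityMeasure μ] [IsProbabilityMeasure ν]
    (hμ : ∀ᵐ w ∂μ, ‖w‖ = 1) (hν : ∀ᵐ w ∂ν, ‖w‖ = 1) {r : ℝ} (hr0 : 0 ≤ r) (hr1 : r < 1) :
    HasSum (fun n : ℕ => r ^ n / n *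
        ((∫ z, z ^ n ∂μ) * starRingEnd ℂ (∫ w, w ^ n ∂ν)).re)
      (∫ q : ℂ × ℂ, -Real.log ‖1 - r * (q.1 * starRingEnd ℂ q.2)‖ ∂(μ.prod ν)) := by
  have hae := ae_prod_norm_eq_one hμ hν
  set F : ℕ → ℂ × ℂ → ℝ := fun n q => ((r * (q.1 * starRingEnd ℂ q.2)) ^ n / (n : ℂ)).re with hF
  have hu : ∀ q : ℂ × ℂ, ‖q.1‖ = 1 ∧ ‖q.2‖ = 1 → ‖(r : ℂ) * (q.1 * starRingEnd ℂ q.2)‖ = r := by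
    rintro q ⟨h1, h2⟩
    rw [norm_mul, norm_mul, Complex.norm_conj, h1, h2, mul_one, mul_one, Complex.norm_real,
      Real.norm_eq_abs, abs_of_nonneg hr0]
  have hbound : ∀ n, ∀ᵐ q ∂(μ.prod ν), ‖F n q‖ ≤ r ^ n := by
    intro n
    filter_upwards [hae] with q hq
    refine (Complex.abs_re_le_norm _).trans ?_
    rw [norm_div, norm_pow, hu q hq, Complex.norm_natCast]
    rcases n.eq_zero_or_pos with rfl | hn
    · simp
    · exact div_le_self (by positivity) (by exact_mod_cast hn)
  have hFm : ∀ n, AEStronglyMeasurable (F n) (μ.prod ν) := fun n =>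
    (Continuous.measurable (by fun_prop)).aestronglyMeasurable
  have hFI : ∀ n, Integrable (F n) (μ.prod ν) := fun n => Integrable.of_bound (hFm n) _ (hbound n)
  have hS : Summable fun n => ∫ q, ‖F n q‖ ∂(μ.prod ν) := by
    refine Summable.of_nonneg_of_le (fun n => integral_nonneg fun q => norm_nonneg _) (fun n => ?_)
      (summable_geometric_of_lt_one hr0 hr1)
    calc ∫ q, ‖F n q‖ ∂(μ.prod ν) ≤ ∫ _, r ^ n ∂(μ.prod ν) :=
          integral_mono_ae (hFI n).norm (integrable_const _) (hbound n)
      _ = r ^ n := by simp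
  have h := hasSum_integral_of_summable_integral_norm hFI hS
  have h2 : ∫ q, ∑' n, F n q ∂(μ.prod ν) =
      ∫ q : ℂ × ℂ, -Real.log ‖1 - r * (q.1 * starRingEnd ℂ q.2)‖ ∂(μ.prod ν) := by
    refine integral_congr_ae (hae.mono fun q hq => ?_)
    have h3 := Complex.hasSum_re
      (Complex.hasSum_taylorSeries_neg_log (z := r * (q.1 * starRingEnd ℂ q.2))
        (by rw [hu q hq]; exact hr1))
    rw [Complex.neg_re, Complex.log_re] at h3
    exact h3.tsum_eq
  rw [h2] at h
  suffices hterm : (fun n : ℕ => r ^ n / n *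
      ((∫ z, z ^ n ∂μ) * starRingEnd ℂ (∫ w, w ^ n ∂ν)).re) = fun n => ∫ q, F n q ∂(μ.prod ν) by
    rw [hterm]
    exact h
  funext n
  have hmI : Integrable (fun q : ℂ × ℂ => q.1 ^ n * starRingEnd ℂ (q.2 ^ n)) (μ.prod ν) :=
    Integrable.of_bound (Continuous.measurable (by fun_prop)).aestronglyMeasurable 1
      (hae.mono fun q hq => by
        rw [norm_mul, Complex.norm_conj, norm_pow, norm_pow, hq.1, hq.2]; simp)
  have hFn : F n = fun q : ℂ × ℂ => r ^ n / n * (q.1 ^ n * starRingEnd ℂ (q.2 ^ n)).re := by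
    ext q
    rw [hF]
    simp only
    rw [mul_pow, mul_pow, map_pow, mul_div_right_comm, ← Complex.ofReal_pow,
      ← Complex.ofReal_natCast, ← Complex.ofReal_div, Complex.re_ofReal_mul]
  have hre := Complex.reCLM.integral_comp_comm hmI
  simp only [Complex.reCLM_apply] at hre
  rw [hFn, integral_const_mul, hre, integral_prod_mul (fun z : ℂ => z ^ n)
    (fun w : ℂ => starRingEnd ℂ (w ^ n)), integral_conj]

/-- Provides the domination `-log |1 - r u| ≤ log 2 - log |1 - u|`, uniform in `r`. -/
theorem norm_one_sub_le_two_mul {u : ℂ} (hu : ‖u‖ = 1) {r : ℝ} (hr0 : 0 ≤ r) (hr1 : r ≤ 1) :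
    ‖1 - u‖ ≤ 2 * ‖1 - r * u‖ := by
  have h1 : 1 - r ≤ ‖1 - r * u‖ := by
    have h := norm_sub_norm_le (1 : ℂ) (r * u)
    rwa [norm_one, norm_mul, hu, mul_one, Complex.norm_real, Real.norm_eq_abs,
      abs_of_nonneg hr0] at h
  have h2 : 1 - u = (1 - r * u) - ((1 - r : ℝ) : ℂ) * u := by push_cast; ring
  calc ‖1 - u‖ ≤ ‖1 - r * u‖ + ‖((1 - r : ℝ) : ℂ) * u‖ := by rw [h2]; exact norm_sub_le _ _
    _ ≤ 2 * ‖1 - r * u‖ := by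
      rw [norm_mul, hu, mul_one, Complex.norm_real, Real.norm_eq_abs, abs_of_nonneg (by linarith)]
      linarith

theorem tendsto_abel_energy {μ ν : Measure ℂ} [IsProbabilityMeasure μ] [IsProbabilityMeasure ν]
    (hμ : ∀ᵐ w ∂μ, ‖w‖ = 1) (hν : ∀ᵐ w ∂ν, ‖w‖ = 1) (h : FiniteMutualEnergy μ ν) :
    Tendsto (fun r : ℝ =>
        ∫ q : ℂ × ℂ, -Real.log ‖1 - r * (q.1 * starRingEnd ℂ q.2)‖ ∂(μ.prod ν)) (𝓝[<] 1)
      (𝓝 (∫ q : ℂ × ℂ, -Real.log ‖q.1 - q.2‖ ∂(μ.prod ν))) := by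
  obtain ⟨hne, hI⟩ := h
  have hae := ae_prod_norm_eq_one hμ hν
  refine tendsto_integral_filter_of_dominated_convergence
    (fun q : ℂ × ℂ => Real.log 2 + |Real.log ‖q.1 - q.2‖|) ?_ ?_ ?_ ?_
  · exact Eventually.of_forall fun r =>
      (by fun_prop : Measurable fun q : ℂ × ℂ =>
        -Real.log ‖1 - r * (q.1 * starRingEnd ℂ q.2)‖).aestronglyMeasurable
  · filter_upwards [Ioo_mem_nhdsLT zero_lt_one] with r hr
    filter_upwards [hae, hne] with q hq hq'
    have hu : ‖q.1 * starRingEnd ℂ q.2‖ = 1 := by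
      rw [norm_mul, Complex.norm_conj, hq.1, hq.2, mul_one]
    have h0 : 0 < ‖q.1 - q.2‖ := norm_pos_iff.mpr (sub_ne_zero.mpr hq')
    have h1 := norm_one_sub_le_two_mul hu hr.1.le hr.2.le
    rw [← log_norm_sub_eq_log_norm_one_sub hq.2] at h1
    have h2 : 0 < ‖1 - r * (q.1 * starRingEnd ℂ q.2)‖ := by linarith
    have h3 : ‖1 - r * (q.1 * starRingEnd ℂ q.2)‖ ≤ 2 := by
      refine (norm_sub_le _ _).trans ?_
      rw [norm_one, norm_mul, hu, mul_one, Complex.norm_real, Real.norm_eq_abs, abs_of_pos hr.1]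
      linarith [hr.2]
    have h4 := Real.log_le_log h2 h3
    have h5 := Real.log_le_log h0 h1
    rw [Real.log_mul two_ne_zero h2.ne'] at h5
    rw [norm_neg, Real.norm_eq_abs, abs_le]
    constructor
    · linarith [neg_abs_le (Real.log ‖q.1 - q.2‖)]
    · linarith [abs_nonneg (Real.log ‖q.1 - q.2‖)]
  · exact (integrable_const _).add hI.abs
  · filter_upwards [hae, hne] with q hq hq'
    rw [log_norm_sub_eq_log_norm_one_sub hq.2]
    have h0 : ‖1 - ((1 : ℝ) : ℂ) * (q.1 * starRingEnd ℂ q.2)‖ ≠ 0 := by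
      rw [Complex.ofReal_one, one_mul, ← log_norm_sub_eq_log_norm_one_sub hq.2]
      exact norm_ne_zero_iff.mpr (sub_ne_zero.mpr hq')
    have hn : ContinuousAt (fun r : ℝ => ‖1 - r * (q.1 * starRingEnd ℂ q.2)‖) 1 := by fun_prop
    have hc : ContinuousAt (fun r : ℝ => -Real.log ‖1 - r * (q.1 * starRingEnd ℂ q.2)‖) 1 :=
      (hn.log h0).neg
    have := hc.tendsto.mono_left (nhdsWithin_le_nhds (s := Iio 1))
    simpa using this

/-- Quantitative positive definiteness of the logarithmic kernel on the unit circle. -/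
theorem norm_moment_sub_sq_le {μ ν : Measure ℂ} [IsProbabilityMeasure μ] [IsProbabilityMeasure ν]
    (hμ : ∀ᵐ w ∂μ, ‖w‖ = 1) (hν : ∀ᵐ w ∂ν, ‖w‖ = 1) (h1 : FiniteMutualEnergy μ μ)
    (h2 : FiniteMutualEnergy ν ν) (h3 : FiniteMutualEnergy μ ν) (k : ℕ) :
    1 / k * ‖∫ w, w ^ k ∂μ - ∫ w, w ^ k ∂ν‖ ^ 2 ≤
      ∫ q : ℂ × ℂ, -Real.log ‖q.1 - q.2‖ ∂(μ.prod μ) +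
      ∫ q : ℂ × ℂ, -Real.log ‖q.1 - q.2‖ ∂(ν.prod ν) -
      2 * ∫ q : ℂ × ℂ, -Real.log ‖q.1 - q.2‖ ∂(μ.prod ν) := by
  have hlim := ((tendsto_abel_energy hμ hμ h1).add (tendsto_abel_energy hν hν h2)).sub
    ((tendsto_abel_energy hμ hν h3).const_mul 2)
  have hl : Tendsto (fun r : ℝ => r ^ k / k * ‖∫ w, w ^ k ∂μ - ∫ w, w ^ k ∂ν‖ ^ 2) (𝓝[<] 1)
      (𝓝 (1 ^ k / k * ‖∫ w, w ^ k ∂μ - ∫ w, w ^ k ∂ν‖ ^ 2)) :=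
    (Continuous.tendsto (by fun_prop) 1).mono_left nhdsWithin_le_nhds
  rw [one_pow] at hl
  refine le_of_tendsto_of_tendsto hl hlim ?_
  filter_upwards [Ioo_mem_nhdsLT zero_lt_one] with r hr
  have hs := ((hasSum_abel_energy hμ hμ hr.1.le hr.2).add
    (hasSum_abel_energy hν hν hr.1.le hr.2)).sub
    ((hasSum_abel_energy hμ hν hr.1.le hr.2).mul_left 2)
  have hterm : ∀ n : ℕ, r ^ n / n * ((∫ z, z ^ n ∂μ) * starRingEnd ℂ (∫ w, w ^ n ∂μ)).re +
      r ^ n / n * ((∫ z, z ^ n ∂ν) * starRingEnd ℂ (∫ w, w ^ n ∂ν)).re -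
      2 * (r ^ n / n * ((∫ z, z ^ n ∂μ) * starRingEnd ℂ (∫ w, w ^ n ∂ν)).re) =
      r ^ n / n * ‖∫ w, w ^ n ∂μ - ∫ w, w ^ n ∂ν‖ ^ 2 := by
    intro n
    rw [← Complex.normSq_eq_norm_sq, Complex.normSq_apply]
    simp only [Complex.mul_re, Complex.conj_re, Complex.conj_im, Complex.sub_re, Complex.sub_im]
    ring
  simp only [hterm] at hs
  -- The combination is a series of nonnegative terms `(r^n / n) |m_n(μ) - m_n(ν)|²`, with `m_n` the
  -- `n`-th moment, hence bounds each of them.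
  exact le_hasSum hs k fun n _ => mul_nonneg
    (div_nonneg (pow_nonneg hr.1.le _) n.cast_nonneg) (sq_nonneg _)

/-! ### The logarithmic energy and the equilibrium measure -/

theorem toENNReal_log_enorm {u : ℂ} (hu : u ≠ 0) :
    (ENNReal.log ‖u‖ₑ).toENNReal = ENNReal.ofReal (Real.log ‖u‖) ∧
    (-ENNReal.log ‖u‖ₑ).toENNReal = ENNReal.ofReal (-Real.log ‖u‖) := by
  rw [← ofReal_norm, ENNReal.log_ofReal_of_pos (norm_pos_iff.mpr hu), ← EReal.coe_neg]
  exact ⟨EReal.real_coe_toENNReal _, EReal.real_coe_toENNReal _⟩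

theorem lintegral_lintegral_eq_prod {μ : Measure ℂ} [IsProbabilityMeasure μ] {f : ℂ → ℝ≥0∞}
    (hf : Measurable f) :
    ∫⁻ z, ∫⁻ w, f (z - w) ∂μ ∂μ = ∫⁻ q : ℂ × ℂ, f (q.1 - q.2) ∂(μ.prod μ) :=
  (lintegral_prod _ (hf.comp (measurable_fst.sub measurable_snd)).aemeasurable).symm

theorem measurable_toENNReal_log_enorm :
    Measurable (fun u : ℂ => (ENNReal.log ‖u‖ₑ).toENNReal) ∧
    Measurable (fun u : ℂ => (-ENNReal.log ‖u‖ₑ).toENNReal) :=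
  ⟨(ENNReal.measurable_log.comp measurable_enorm).ereal_toENNReal,
    (ENNReal.measurable_log.comp measurable_enorm).neg.ereal_toENNReal⟩

theorem logEnergy_eq_of_finite {μ : Measure ℂ} [IsProbabilityMeasure μ]
    (h : FiniteMutualEnergy μ μ) :
    logEnergy μ = ((∫ q : ℂ × ℂ, -Real.log ‖q.1 - q.2‖ ∂(μ.prod μ) : ℝ) : EReal) := by
  obtain ⟨hne, hI⟩ := h
  have hI' : Integrable (fun q : ℂ × ℂ => -Real.log ‖q.1 - q.2‖) (μ.prod μ) := hI.neg
  have h1 : ∫⁻ q : ℂ × ℂ, (ENNReal.log ‖q.1 - q.2‖ₑ).toENNReal ∂(μ.prod μ) =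
      ∫⁻ q : ℂ × ℂ, ENNReal.ofReal (Real.log ‖q.1 - q.2‖) ∂(μ.prod μ) :=
    lintegral_congr_ae (hne.mono fun q hq => (toENNReal_log_enorm (sub_ne_zero.mpr hq)).1)
  have h2 : ∫⁻ q : ℂ × ℂ, (-ENNReal.log ‖q.1 - q.2‖ₑ).toENNReal ∂(μ.prod μ) =
      ∫⁻ q : ℂ × ℂ, ENNReal.ofReal (-Real.log ‖q.1 - q.2‖) ∂(μ.prod μ) :=
    lintegral_congr_ae (hne.mono fun q hq => (toENNReal_log_enorm (sub_ne_zero.mpr hq)).2)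
  have h3 : ∫⁻ q : ℂ × ℂ, ENNReal.ofReal (Real.log ‖q.1 - q.2‖) ∂(μ.prod μ) ≠ ⊤ :=
    ((lintegral_mono fun q => Real.ofReal_le_enorm _).trans_lt hI.2).ne
  have h4 : ∫⁻ q : ℂ × ℂ, ENNReal.ofReal (-Real.log ‖q.1 - q.2‖) ∂(μ.prod μ) ≠ ⊤ :=
    ((lintegral_mono fun q => Real.ofReal_le_enorm _).trans_lt hI'.2).ne
  have h5 := integral_eq_lintegral_pos_part_sub_lintegral_neg_part hI'
  simp only [neg_neg] at h5
  rw [logEnergy, lintegral_lintegral_eq_prod measurable_toENNReal_log_enorm.1,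
    lintegral_lintegral_eq_prod measurable_toENNReal_log_enorm.2, h1, h2, h5, EReal.coe_sub,
    EReal.coe_ennreal_toReal h3, EReal.coe_ennreal_toReal h4]

/-- On the circle the positive part of `log |z - w|` is at most `log 2`, so finite energy bounds the
other part too; since that part is `+∞` on the diagonal, the diagonal is a null set. -/
theorem finiteMutualEnergy_of_logEnergy_lt_top {μ : Measure ℂ} [IsProbabilityMeasure μ]
    (hμ : ∀ᵐ w ∂μ, ‖w‖ = 1) (h : logEnergy μ < ⊤) : FiniteMutualEnergy μ μ := by
  have hae := ae_prod_norm_eq_one hμ hμ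
  have hpos : ∀ᵐ q ∂(μ.prod μ), (ENNReal.log ‖q.1 - q.2‖ₑ).toENNReal ≤
      ENNReal.ofReal (Real.log 2) := by
    filter_upwards [hae] with q hq
    rcases eq_or_ne (q.1 - q.2) 0 with h0 | h0
    · simp [h0]
    · rw [(toENNReal_log_enorm h0).1]
      exact ENNReal.ofReal_le_ofReal (log_norm_sub_le_log_two hq.1.le hq.2.le)
  have h1 : ∫⁻ q : ℂ × ℂ, (ENNReal.log ‖q.1 - q.2‖ₑ).toENNReal ∂(μ.prod μ) ≠ ⊤ := by
    refine ((lintegral_mono_ae hpos).trans_lt ?_).ne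
    simp
  have h2 : ∫⁻ q : ℂ × ℂ, (-ENNReal.log ‖q.1 - q.2‖ₑ).toENNReal ∂(μ.prod μ) ≠ ⊤ := by
    intro htop
    rw [logEnergy, lintegral_lintegral_eq_prod measurable_toENNReal_log_enorm.1,
      lintegral_lintegral_eq_prod measurable_toENNReal_log_enorm.2, htop, EReal.coe_ennreal_top,
      EReal.top_sub] at h
    · exact lt_irrefl _ h
    · simpa using h1
  have hmeas : Measurable fun q : ℂ × ℂ => (-ENNReal.log ‖q.1 - q.2‖ₑ).toENNReal :=
    measurable_toENNReal_log_enorm.2.comp (measurable_fst.sub measurable_snd)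
  have hne : ∀ᵐ q ∂(μ.prod μ), q.1 ≠ q.2 := by
    filter_upwards [ae_lt_top hmeas h2] with q hq heq
    rw [heq] at hq
    simp at hq
  have hlogm : Measurable fun q : ℂ × ℂ => Real.log ‖q.1 - q.2‖ := by fun_prop
  refine ⟨hne, hlogm.aestronglyMeasurable, ?_⟩
  rw [hasFiniteIntegral_iff_norm]
  have hle : ∀ᵐ q ∂(μ.prod μ), ENNReal.ofReal ‖Real.log ‖q.1 - q.2‖‖ ≤
      (ENNReal.log ‖q.1 - q.2‖ₑ).toENNReal + (-ENNReal.log ‖q.1 - q.2‖ₑ).toENNReal := by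
    filter_upwards [hne] with q hq
    obtain ⟨e1, e2⟩ := toENNReal_log_enorm (sub_ne_zero.mpr hq)
    rw [e1, e2, Real.norm_eq_abs]
    rcases le_total 0 (Real.log ‖q.1 - q.2‖) with h0 | h0
    · rw [abs_of_nonneg h0]; exact le_self_add
    · rw [abs_of_nonpos h0]; exact le_add_self
  refine (lintegral_mono_ae hle).trans_lt ?_
  rw [lintegral_add_right _ hmeas]
  exact ENNReal.add_lt_top.mpr ⟨h1.lt_top, h2.lt_top⟩

theorem exists_exp_of_mem_bandSet {c : ℕ → ℂ} (hc : ∀ j, ‖c j‖ < 1) {p : ℕ} (hp : 0 < p) {z : ℂ}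
    (hz : z ∈ bandSet fun j : Fin p => c j) :
    ∃ Y : ℂ, Y ≠ 0 ∧ ‖Y‖ = 1 ∧ Y + Y⁻¹ = discSq c p z := by
  obtain ⟨hz1, h2⟩ := (mem_bandSet_iff hc hp z).mp hz
  have h1 := discriminant_re_sq hc hz1 p
  have h3 : -2 ≤ (discSq c p z).re := by
    nlinarith [sq_nonneg (discriminant (fun j : Fin p => c j) z).re]
  refine ⟨Complex.exp (Real.arccos ((discSq c p z).re / 2) * Complex.I), Complex.exp_ne_zero _,
    Complex.norm_exp_ofReal_mul_I _, ?_⟩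
  rw [exp_add_exp_neg, Real.cos_arccos (by linarith) (by linarith), discSq_eq_re c p hz1,
    Complex.ofReal_re]
  congr 1
  ring

/-- The potential of `ν_Δ` is constant on the bands. -/
theorem lintegral_log_of_mem_bandSet {c : ℕ → ℂ} (hc : ∀ j, ‖c j‖ < 1) {p : ℕ} (hp : 0 < p)
    {z : ℂ} (hz : z ∈ bandSet fun j : Fin p => c j) :
    ∫⁻ w, ENNReal.ofReal (Real.log 2 - Real.log ‖z - w‖)
        ∂(discriminantMeasure fun j : Fin p => c j) =
      ENNReal.ofReal (Real.log 2 - Real.log (rhoSq c p) / (2 * p)) ∧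
    ∫ w, Real.log ‖z - w‖ ∂(discriminantMeasure fun j : Fin p => c j) =
      Real.log (rhoSq c p) / (2 * p) := by
  obtain ⟨Y, hY, hY1, hYF⟩ := exists_exp_of_mem_bandSet hc hp hz
  have hz1 := ((mem_bandSet_iff hc hp z).mp hz).1
  have h1 := (lintegral_log_discriminantMeasure hc hp hz.1 hz1.le hY hYF).1
  have h2 := (integral_log_discriminantMeasure hc hp hz.1 hz1.le hY hYF).2
  rw [hY1, hz1, one_pow, mul_one, Real.log_one, abs_zero, add_zero] at h1 h2
  exact ⟨h1, h2⟩

/-- A given point is a root of `levelPoly` for at most one `x` in `(0, π)`, by injectivity of the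
cosine. -/
theorem discriminantMeasure_singleton {c : ℕ → ℂ} (hc : ∀ j, ‖c j‖ < 1) {p : ℕ} (hp : 0 < p)
    {z : ℂ} (hz : z ≠ 0) : discriminantMeasure (fun j : Fin p => c j) {z} = 0 := by
  have hm := measurableSet_singleton z
  rw [← lintegral_indicator_one hm, lintegral_discriminantMeasure_eq_roots hc hp
    (measurable_one.indicator hm)]
  refine mul_eq_zero_of_right _ ?_
  rw [setLIntegral_congr_fun_ae (g := fun _ => 0) measurableSet_Ioo, lintegral_zero]
  filter_upwards [ae_eval_levelPoly_ne_zero hc hz (p := p)] with x hx hx'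
  refine Multiset.sum_eq_zero fun y hy => ?_
  obtain ⟨w, hw, rfl⟩ := Multiset.mem_map.mp hy
  refine indicator_of_notMem (fun hwz => hx hx' ?_) _
  rw [← mem_singleton_iff.mp hwz]
  exact isRoot_of_mem_roots hw

/-- The potential of `ν_Δ` equals `log R / (2p)` on the bands, with `R` the product `rhoSq`, so its
mutual energy with every probability measure on the bands is the same constant, which is also its
own energy. -/
theorem finiteMutualEnergy_discriminantMeasure {c : ℕ → ℂ} (hc : ∀ j, ‖c j‖ < 1) {p : ℕ}
    (hp : 0 < p) {μ : Measure ℂ} [IsProbabilityMeasure μ]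
    (hμ : ∀ᵐ z ∂μ, z ∈ bandSet fun j : Fin p => c j) :
    FiniteMutualEnergy μ (discriminantMeasure fun j : Fin p => c j) ∧
    ∫ q : ℂ × ℂ, -Real.log ‖q.1 - q.2‖ ∂(μ.prod (discriminantMeasure fun j : Fin p => c j)) =
      -(Real.log (rhoSq c p) / (2 * p)) := by
  have := isProbabilityMeasure_discriminantMeasure hc hp
  have hν := ae_norm_eq_one_discriminantMeasure hc hp
  set ν := discriminantMeasure fun j : Fin p => c j
  have hμ1 : ∀ᵐ z ∂μ, ‖z‖ = 1 := hμ.mono fun z hz => ((mem_bandSet_iff hc hp z).mp hz).1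
  have hae := ae_prod_norm_eq_one hμ1 hν
  have hne : ∀ᵐ q ∂(μ.prod ν), q.1 ≠ q.2 := by
    have hd : MeasurableSet {q : ℂ × ℂ | q.1 = q.2} := measurableSet_eq_fun measurable_fst
      measurable_snd
    have h0 : μ.prod ν {q : ℂ × ℂ | q.1 = q.2} = 0 := by
      rw [Measure.measure_prod_null hd]
      filter_upwards [hμ] with z hz
      rw [show Prod.mk z ⁻¹' {q : ℂ × ℂ | q.1 = q.2} = {z} by
        ext w; simp only [mem_preimage, mem_ofPred_eq, mem_singleton_iff]; exact eq_comm]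
      exact discriminantMeasure_singleton hc hp hz.1
    filter_upwards [measure_eq_zero_iff_ae_notMem.mp h0] with q hq heq
    exact hq heq
  have hmeas : Measurable fun q : ℂ × ℂ => Real.log 2 - Real.log ‖q.1 - q.2‖ := by fun_prop
  have hI : Integrable (fun q : ℂ × ℂ => Real.log 2 - Real.log ‖q.1 - q.2‖) (μ.prod ν) := by
    refine ⟨hmeas.aestronglyMeasurable, ?_⟩
    rw [hasFiniteIntegral_iff_ofReal (hae.mono fun q hq =>
      sub_nonneg.mpr (log_norm_sub_le_log_two hq.1.le hq.2.le)),
      lintegral_prod _ hmeas.ennreal_ofReal.aemeasurable,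
      lintegral_congr_ae (hμ.mono fun z hz => (lintegral_log_of_mem_bandSet hc hp hz).1)]
    simp
  have hI' : Integrable (fun q : ℂ × ℂ => Real.log ‖q.1 - q.2‖) (μ.prod ν) :=
    ((integrable_const (Real.log 2)).sub hI).congr (ae_of_all _ fun q => by simp)
  refine ⟨⟨hne, hI'⟩, ?_⟩
  rw [integral_neg, integral_prod _ hI',
    integral_congr_ae (hμ.mono fun z hz => (lintegral_log_of_mem_bandSet hc hp hz).2)]
  simp

theorem measure_eq_of_moments {μ ν : Measure ℂ} [IsProbabilityMeasure μ] [IsProbabilityMeasure ν]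
    (hμ : ∀ᵐ w ∂μ, ‖w‖ = 1) (hν : ∀ᵐ w ∂ν, ‖w‖ = 1)
    (h : ∀ k : ℕ, ∫ w, w ^ k ∂μ = ∫ w, w ^ k ∂ν) : μ = ν := by
  refine ext_of_forall_integral_eq_of_IsFiniteMeasure fun f => ?_
  have := tendsto_integral_of_moments (ι := ℕ) (l := atTop) (μ := fun _ => μ) (fun _ => hμ) hν
    (fun k => by rw [h k]; exact tendsto_const_nhds) f
  exact tendsto_nhds_unique tendsto_const_nhds this

/-- `ν_Δ` is the equilibrium measure of the bands. -/
theorem isEquilibriumMeasure_discriminantMeasure {c : ℕ → ℂ} (hc : ∀ j, ‖c j‖ < 1) {p : ℕ}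
    (hp : 0 < p) :
    IsEquilibriumMeasure (bandSet fun j : Fin p => c j)
      (discriminantMeasure fun j : Fin p => c j) := by
  have hprob := isProbabilityMeasure_discriminantMeasure hc hp
  have hcompl := discriminantMeasure_compl_bandSet hc hp
  have hν1 := ae_norm_eq_one_discriminantMeasure hc hp
  obtain ⟨hνν, hνV⟩ := finiteMutualEnergy_discriminantMeasure hc hp
    (μ := discriminantMeasure fun j : Fin p => c j) hcompl
  have hlog := logEnergy_eq_of_finite hνν
  have hfin : logEnergy (discriminantMeasure fun j : Fin p => c j) < ⊤ := by
    rw [hlog]; exact EReal.coe_lt_top _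
  refine ⟨hprob, hcompl, hfin, fun μ hμ hμK hle => ?_⟩
  have hμ1 : ∀ᵐ z ∂μ, ‖z‖ = 1 := by
    refine measure_mono_null (fun w hw => ?_) hμK
    exact fun h => hw ((mem_bandSet_iff hc hp w).mp h).1
  have hμμ := finiteMutualEnergy_of_logEnergy_lt_top hμ1 (hle.trans_lt hfin)
  obtain ⟨hμν, hμνV⟩ := finiteMutualEnergy_discriminantMeasure hc hp (μ := μ) hμK
  rw [logEnergy_eq_of_finite hμμ, hlog, EReal.coe_le_coe_iff] at hle
  refine measure_eq_of_moments hμ1 hν1 fun k => ?_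
  rcases k.eq_zero_or_pos with rfl | hk
  · simp
  have hk' : (0 : ℝ) < k := by exact_mod_cast hk
  have h := norm_moment_sub_sq_le hμ1 hν1 hμμ hνν hμν k
  rw [hνV, hμνV] at h
  rw [hνV] at hle
  -- Mutual energy and energy of `ν_Δ` coincide, so the energy form of the difference is the excess
  -- energy of `μ`, which is at most `0`.
  have h0 : 1 / k * ‖∫ w, w ^ k ∂μ - ∫ w, w ^ k ∂(discriminantMeasure fun j : Fin p => c j)‖ ^ 2
      ≤ 0 := by linarith
  have h1 : ‖∫ w, w ^ k ∂μ - ∫ w, w ^ k ∂(discriminantMeasure fun j : Fin p => c j)‖ ^ 2 ≤ 0 :=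
    nonpos_of_mul_nonpos_right h0 (by positivity)
  have h2 : ‖∫ w, w ^ k ∂μ - ∫ w, w ^ k ∂(discriminantMeasure fun j : Fin p => c j)‖ = 0 := by
    nlinarith [norm_nonneg
      (∫ w, w ^ k ∂μ - ∫ w, w ^ k ∂(discriminantMeasure fun j : Fin p => c j))]
  exact sub_eq_zero.mp (norm_eq_zero.mp h2)

/-! ### Periodic Schur iterates -/

theorem exists_schurIter_fixedPoint {c : ℕ → ℂ} (hc : ∀ j, ‖c j‖ < 1) {p : ℕ} (hp : 0 < p) {z : ℂ}
    (hz : ‖z‖ ≤ 1 / 4) : ∃ b : ℂ, ‖b‖ ≤ 1 ∧ schurIter z c b p = b := by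
  have hz1 : ‖z‖ < 1 := by linarith
  set f : ℂ → ℂ := fun b => schurIter z c b p with hf
  set s := Metric.closedBall (0 : ℂ) 1 with hs
  have hmem : ∀ b, b ∈ s ↔ ‖b‖ ≤ 1 := fun b => mem_closedBall_zero_iff
  have hmaps : MapsTo f s s := fun b hb => (hmem _).mpr
    (norm_schurIter_le hz1 ((hmem _).mp hb) p fun i _ => hc i)
  have hcontr : ContractingWith (1 / 2) (hmaps.restrict f s s) := by
    refine ⟨by norm_num, LipschitzWith.of_dist_le_mul fun x y => ?_⟩
    rw [Subtype.dist_eq, Subtype.dist_eq, MapsTo.val_restrict_apply, MapsTo.val_restrict_apply,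
      dist_eq_norm, dist_eq_norm]
    refine (norm_schurIter_sub_le hz ((hmem _).mp x.2) ((hmem _).mp y.2) p fun i _ => hc i).trans ?_
    have h1 : ((1 : ℝ) / 2) ^ p ≤ (1 / 2) ^ 1 :=
      pow_le_pow_of_le_one (by norm_num) (by norm_num) hp
    have h2 : (((1 / 2 : NNReal)) : ℝ) = (1 / 2) ^ 1 := by norm_num
    rw [h2]
    exact mul_le_mul_of_nonneg_right h1 (norm_nonneg _)
  obtain ⟨b, hb, hfix, -⟩ := hcontr.exists_fixedPoint' Metric.isClosed_closedBall.isComplete hmaps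
    (x := 0) ((hmem 0).mpr (by simp)) (edist_ne_top _ _)
  exact ⟨b, (hmem b).mp hb, hfix⟩

/-- `schurStep` is the projective action of the transfer matrix on `(b, 1)`; its denominator is the
scalar split off at each step. -/
theorem szegoProd_mulVec {c : ℕ → ℂ} (hc : ∀ j, ‖c j‖ < 1) {z b : ℂ} (hz : ‖z‖ < 1) (hb : ‖b‖ ≤ 1)
    (n : ℕ) : (szegoProd c z n).mulVec ![b, 1] =
      (∏ i ∈ Finset.range n, (1 - c i * (z * schurIter z c b i))) • ![schurIter z c b n, 1] := by
  induction n with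
  | zero => simp [szegoProd, schurIter]
  | succ n ih =>
    have h1 : 1 - c n * (z * schurIter z c b n) ≠ 0 :=
      one_sub_ne_zero hz (hc n) (norm_schurIter_le hz hb n fun i _ => hc i)
    rw [szegoProd, ← Matrix.mulVec_mulVec, ih, Matrix.mulVec_smul, Finset.prod_range_succ,
      mul_smul]
    congr 1
    obtain ⟨h2, h3⟩ := szegoMatrix_mulVec (c n) z ![schurIter z c b n, 1]
    ext i
    fin_cases i
    · simp only [Fin.zero_eta, h2]
      simp only [schurIter, schurStep, Matrix.cons_val_zero, Matrix.cons_val_one, Pi.smul_apply,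
        smul_eq_mul]
      rw [mul_div_cancel₀ _ h1, mul_one]
    · simp only [Fin.mk_one, h3]
      simp

/-- The potential of `ν_Δ` near `0` in terms of a periodic orbit of Schur iterates. -/
theorem integral_log_eq_sum_schurIter {c : ℕ → ℂ} (hc : ∀ j, ‖c j‖ < 1) {p : ℕ} (hp : 0 < p)
    {z b : ℂ} (hz0 : z ≠ 0) (hz : ‖z‖ < 1) (hb : ‖b‖ ≤ 1) (hfix : schurIter z c b p = b) :
    p * ∫ w, Real.log ‖z - w‖ ∂(discriminantMeasure fun j : Fin p => c j) =
      ∑ i ∈ Finset.range p, Real.log ‖1 - c i * (z * schurIter z c b i)‖ := by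
  have hne : ∀ i, 1 - c i * (z * schurIter z c b i) ≠ 0 := fun i =>
    one_sub_ne_zero hz (hc i) (norm_schurIter_le hz hb i fun i _ => hc i)
  set l := ∏ i ∈ Finset.range p, (1 - c i * (z * schurIter z c b i)) with hl
  have hl0 : l ≠ 0 := Finset.prod_ne_zero_iff.mpr fun i _ => hne i
  have hev : (szegoProd c z p).mulVec ![b, 1] = l • ![b, 1] := by
    rw [szegoProd_mulVec hc hz hb, hfix]
  have hR := rhoSq_pos hc p
  have hz' := norm_pos_iff.mpr hz0
  set D : ℂ := rhoSq c p * z ^ p with hD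
  have hD0 : D ≠ 0 := mul_ne_zero (by exact_mod_cast hR.ne') (pow_ne_zero _ hz0)
  have hDn : ‖D‖ = rhoSq c p * ‖z‖ ^ p := by
    rw [hD, norm_mul, norm_pow, Complex.norm_real, Real.norm_eq_abs, abs_of_pos hR]
  have hchar : l ^ 2 - (tracePoly c p).eval z * l + D = 0 := by
    have h0 : (szegoProd c z p - l • (1 : Matrix (Fin 2) (Fin 2) ℂ)).det = 0 := by
      refine Matrix.exists_mulVec_eq_zero_iff.mp ⟨![b, 1], ?_, ?_⟩
      · intro h
        simpa using congrFun h 1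
      · rw [Matrix.sub_mulVec, hev, Matrix.smul_mulVec, Matrix.one_mulVec, sub_self]
    rw [← h0, eval_tracePoly, hD, ← det_szegoProd, Matrix.det_fin_two, Matrix.det_fin_two,
      Matrix.trace_fin_two]
    simp
    ring
  have hY : l ^ 2 / D + (l ^ 2 / D)⁻¹ = discSq c p z := by
    have h1 : (tracePoly c p).eval z = (l ^ 2 + D) / l := by
      field_simp
      linear_combination -hchar
    rw [discSq, ← hD, h1]
    field_simp
    ring
  have hq := form_eigenvector_le hc hp hz' hz hev
  simp only [Matrix.cons_val_zero, Matrix.cons_val_one, norm_one] at hq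
  have hb2 : ‖b‖ ^ 2 ≤ 1 := pow_le_one₀ (norm_nonneg _) hb
  -- As `|b| ≤ 1`, the form is nonpositive on `(b, 1)`, and its strict decrease forces `l` to be the
  -- eigenvalue of larger modulus. This decides the sign of `log |Y|`.
  have hlD : ‖D‖ < ‖l‖ ^ 2 := by
    rw [hDn]
    by_contra hcon
    have hD' : 0 < rhoSq c p * ‖z‖ ^ p := by positivity
    have h2 : 0 < rhoSq c p * ‖z‖ ^ p * ((1 - ‖z‖) * (‖b‖ ^ 2 + 1)) :=
      mul_pos hD' (mul_pos (by linarith) (by positivity))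
    nlinarith [mul_nonneg (sub_nonneg.mpr (not_lt.mp hcon)) (sub_nonneg.mpr hb2)]
  have hDpos : 0 < ‖D‖ := norm_pos_iff.mpr hD0
  have hlogY : |Real.log ‖l ^ 2 / D‖| = 2 * Real.log ‖l‖ - Real.log ‖D‖ := by
    rw [norm_div, norm_pow, abs_of_nonneg (Real.log_nonneg ((one_le_div hDpos).mpr hlD.le)),
      Real.log_div (by positivity) hDpos.ne', Real.log_pow]
    push_cast
    ring
  have hpp : (p : ℝ) ≠ 0 := by exact_mod_cast hp.ne'
  rw [(integral_log_discriminantMeasure hc hp hz0 hz.le (div_ne_zero (pow_ne_zero 2 hl0) hD0)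
    hY).2, hlogY, ← hDn, hl, norm_prod, Real.log_prod fun i _ => norm_ne_zero_iff.mpr (hne i)]
  generalize ∑ i ∈ Finset.range p, Real.log ‖1 - c i * (z * schurIter z c b i)‖ = S
  field_simp
  ring

theorem tendsto_schurIter {ι : Type*} {l : Filter ι} {z : ℂ} (hz : ‖z‖ < 1) {c : ι → ℕ → ℂ}
    {c' : ℕ → ℂ} (hc' : ∀ j, ‖c' j‖ < 1) {b : ι → ℂ} {b' : ℂ} (hb' : ‖b'‖ ≤ 1)
    (hb : Tendsto b l (𝓝 b')) (n : ℕ) (hc : ∀ j < n, Tendsto (fun i => c i j) l (𝓝 (c' j))) :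
    Tendsto (fun i => schurIter z (c i) (b i) n) l (𝓝 (schurIter z c' b' n)) := by
  induction n with
  | zero => exact hb
  | succ n ih =>
    have h1 := ih fun j hj => hc j (hj.trans n.lt_succ_self)
    have h2 := hc n n.lt_succ_self
    have h3 : 1 - c' n * (z * schurIter z c' b' n) ≠ 0 :=
      one_sub_ne_zero hz (hc' n) (norm_schurIter_le hz hb' n fun i _ => hc' i)
    exact ((h1.const_mul z).sub ((Complex.continuous_conj.tendsto _).comp h2)).div
      (tendsto_const_nhds.sub (h2.mul (h1.const_mul z))) h3

/-! ### Limits along ratio sequences -/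

theorem tendsto_ratio_pred {p : ℕ} {k N : ℕ → ℕ} {s : ℝ} (hk : Tendsto k atTop atTop)
    (hN : Tendsto N atTop atTop)
    (hr : Tendsto (fun i => ((k i * p : ℕ) : ℝ) / (N i : ℝ)) atTop (𝓝 s)) :
    Tendsto (fun i => (((k i - 1) * p : ℕ) : ℝ) / (N i : ℝ)) atTop (𝓝 s) := by
  have h1 : Tendsto (fun i => (p : ℝ) / (N i : ℝ)) atTop (𝓝 0) :=
    (tendsto_natCast_atTop_atTop.comp hN).const_div_atTop _
  have h2 := hr.sub h1
  rw [sub_zero] at h2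
  refine h2.congr' ?_
  filter_upwards [hk.eventually_ge_atTop 1] with i hi
  rw [← sub_div]
  congr 1
  obtain ⟨m, hm⟩ := Nat.exists_eq_add_of_le' hi
  rw [hm, Nat.add_sub_cancel]
  push_cast
  ring

/-- The Schur iterates converge to the periodic orbit of the limiting coefficients. -/
theorem tendsto_schurIter_ratio {α : ℕ → ℕ → ℂ} (hα : ∀ n N, ‖α n N‖ < 1) {p : ℕ} (hp : 0 < p)
    {c : ℕ → ℂ} (hc : ∀ j, ‖c j‖ < 1) {s : ℝ}
    (hlim : ∀ j < p, HasRatioLimit (fun k => k * p) (fun k N => α (k * p + j) N) s (c j))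
    {z b : ℂ} (hz : ‖z‖ ≤ 1 / 4) (hb : ‖b‖ ≤ 1) (hfix : schurIter z c b p = b) :
    HasRatioLimit (fun k => k * p) (fun k N => schurIter z (fun m => α m N) 1 (k * p)) s b := by
  have hz1 : ‖z‖ < 1 := by linarith
  set B : ℕ → ℕ → ℂ := fun k N => schurIter z (fun m => α m N) 1 (k * p) with hB
  have hB1 : ∀ k N, ‖B k N‖ ≤ 1 := fun k N =>
    norm_schurIter_le hz1 (by simp) _ fun i _ => hα i N
  -- Looking back `m` periods, the initial discrepancy, at most `2`, has been halved `m` times. The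
  -- claim ranges over all admissible sequences so that the induction may replace `k` by `k - 1`,
  -- which has the same ratio limit.
  have key : ∀ m : ℕ, ∀ k N : ℕ → ℕ, Tendsto k atTop atTop → Tendsto N atTop atTop →
      Tendsto (fun i => ((k i * p : ℕ) : ℝ) / (N i : ℝ)) atTop (𝓝 s) → ∀ ε > 0,
      ∀ᶠ i in atTop, ‖B (k i) (N i) - b‖ ≤ 2 * (1 / 2) ^ m + ε := by
    intro m
    induction m with
    | zero =>
      intro k N _ _ _ ε hε
      refine Eventually.of_forall fun i => (norm_sub_le _ _).trans ?_
      have := hB1 (k i) (N i)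
      rw [pow_zero]
      linarith
    | succ m ih =>
      intro k N hk hN hr ε hε
      have hk' : Tendsto (fun i => k i - 1) atTop atTop := (tendsto_sub_atTop_nat 1).comp hk
      have hr' := tendsto_ratio_pred hk hN hr
      have h1 := ih (fun i => k i - 1) N hk' hN hr' ε hε
      have h2 : Tendsto (fun i => schurIter z (fun j => α ((k i - 1) * p + j) (N i)) b p) atTop
          (𝓝 (schurIter z c b p)) :=
        tendsto_schurIter hz1 hc hb tendsto_const_nhds p fun j hj =>
          hlim j hj (fun i => k i - 1) N hk' hN hr'
      rw [hfix] at h2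
      have h3 := (Metric.tendsto_nhds.mp h2) (ε / 2) (by positivity)
      filter_upwards [h1, h3, hk.eventually_ge_atTop 1] with i hi1 hi3 hi
      rw [dist_eq_norm] at hi3
      have hstep : B (k i) (N i) =
          schurIter z (fun j => α ((k i - 1) * p + j) (N i)) (B (k i - 1) (N i)) p := by
        rw [hB]
        simp only
        rw [← schurIter_add z (fun m => α m (N i)), ← Nat.succ_mul, Nat.succ_eq_add_one,
          Nat.sub_add_cancel hi]
      have h4 := norm_schurIter_sub_le hz (hB1 (k i - 1) (N i)) hb p
        (a := fun j => α ((k i - 1) * p + j) (N i)) fun j _ => hα _ _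
      have h5 : ((1 : ℝ) / 2) ^ p ≤ (1 / 2) ^ 1 :=
        pow_le_pow_of_le_one (by norm_num) (by norm_num) hp
      -- The old error `ε` is halved and the change of coefficients costs a further `ε / 2`, so `ε`
      -- reproduces itself.
      have h6 : ((1 : ℝ) / 2) ^ p * ‖B (k i - 1) (N i) - b‖ ≤
          (1 / 2) ^ 1 * (2 * (1 / 2) ^ m + ε) :=
        mul_le_mul h5 hi1 (norm_nonneg _) (by norm_num)
      have h7 := norm_sub_le_norm_sub_add_norm_sub (B (k i) (N i))
        (schurIter z (fun j => α ((k i - 1) * p + j) (N i)) b p) b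
      rw [hstep] at h7 ⊢
      rw [pow_succ]
      linarith
  intro k N hk hN hr
  rw [Metric.tendsto_nhds]
  intro ε hε
  obtain ⟨m, hm⟩ := exists_pow_lt_of_lt_one (show 0 < ε / 4 by positivity)
    (show (1 / 2 : ℝ) < 1 by norm_num)
  filter_upwards [key m k N hk hN hr (ε / 4) (by positivity)] with i hi
  rw [dist_eq_norm]
  linarith

/-- The logarithmic increment of the orthogonal polynomials over one period. -/
noncomputable def blockLog (z : ℂ) (p : ℕ) (a : ℕ → ℂ) (k : ℕ) : ℝ :=
  ∑ j ∈ Finset.range p, Real.log ‖1 - a (k * p + j) * (z * schurIter z a 1 (k * p + j))‖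

theorem abs_log_one_sub_le {u : ℂ} (hu : ‖u‖ ≤ 1 / 4) : |Real.log ‖1 - u‖| ≤ 1 := by
  have h := abs_log_norm_one_sub_add_sum_le hu 0
  simp at h
  linarith

theorem norm_mul_mul_le_of_le {z a b : ℂ} (hz : ‖z‖ ≤ 1 / 4) (ha : ‖a‖ ≤ 1) (hb : ‖b‖ ≤ 1) :
    ‖a * (z * b)‖ ≤ 1 / 4 := by
  rw [norm_mul, norm_mul]
  have h1 : ‖z‖ * ‖b‖ ≤ ‖z‖ := mul_le_of_le_one_right (norm_nonneg _) hb
  exact (mul_le_of_le_one_left (by positivity) ha).trans (h1.trans hz)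

theorem abs_log_schurIter_le {a : ℕ → ℂ} (ha : ∀ n, ‖a n‖ < 1) {z : ℂ} (hz : ‖z‖ ≤ 1 / 4) {c : ℂ}
    (hc : ‖c‖ ≤ 1) (n : ℕ) : |Real.log ‖1 - c * (z * schurIter z a 1 n)‖| ≤ 1 :=
  abs_log_one_sub_le (norm_mul_mul_le_of_le hz hc
    (norm_schurIter_le (by linarith) (by simp) n fun i _ => ha i))

theorem abs_blockLog_le {a : ℕ → ℂ} (ha : ∀ n, ‖a n‖ < 1) {z : ℂ} (hz : ‖z‖ ≤ 1 / 4) (p k : ℕ) :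
    |blockLog z p a k| ≤ p := by
  refine (Finset.abs_sum_le_sum_abs _ _).trans ?_
  refine (Finset.sum_le_card_nsmul _ _ 1 fun j _ => abs_log_schurIter_le ha hz (ha _).le _).trans ?_
  simp

theorem sum_blockLog (z : ℂ) (p : ℕ) (a : ℕ → ℂ) (L : ℕ) :
    ∑ k ∈ Finset.range L, blockLog z p a k =
      ∑ i ∈ Finset.range (L * p), Real.log ‖1 - a i * (z * schurIter z a 1 i)‖ := by
  induction L with
  | zero => simp
  | succ L ih => rw [Finset.sum_range_succ, ih, Nat.succ_mul, Finset.sum_range_add, blockLog]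

theorem hasRatioLimit_blockLog {α : ℕ → ℕ → ℂ} (hα : ∀ n N, ‖α n N‖ < 1) {p : ℕ} (hp : 0 < p)
    {c : ℕ → ℂ} (hc : ∀ j, ‖c j‖ < 1) {s : ℝ}
    (hlim : ∀ j < p, HasRatioLimit (fun k => k * p) (fun k N => α (k * p + j) N) s (c j))
    {z : ℂ} (hz0 : z ≠ 0) (hz : ‖z‖ ≤ 1 / 4) :
    HasRatioLimit (fun k => k * p) (fun k N => blockLog z p (fun m => α m N) k) s
      (p * ∫ w, Real.log ‖z - w‖ ∂(discriminantMeasure fun j : Fin p => c j)) := by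
  have hz1 : ‖z‖ < 1 := by linarith
  obtain ⟨b, hb, hfix⟩ := exists_schurIter_fixedPoint hc hp hz
  rw [integral_log_eq_sum_schurIter hc hp hz0 hz1 hb hfix]
  intro k N hk hN hr
  refine tendsto_finsetSum _ fun j hj => ?_
  have hj' := Finset.mem_range.mp hj
  have h1 := tendsto_schurIter_ratio hα hp hc hlim hz hb hfix k N hk hN hr
  have h2 : Tendsto (fun i => schurIter z (fun m => α (k i * p + m) (N i))
      (schurIter z (fun m => α m (N i)) 1 (k i * p)) j) atTop (𝓝 (schurIter z c b j)) :=
    tendsto_schurIter hz1 hc hb h1 j fun m hm =>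
      hlim m (hm.trans hj') k N hk hN hr
  have h3 := hlim j hj' k N hk hN hr
  simp only [schurIter_add z (fun m => α m _) 1]
  refine Tendsto.log ?_ (norm_ne_zero_iff.mpr (one_sub_ne_zero hz1 (hc j)
    (norm_schurIter_le hz1 hb j fun i _ => hc i)))
  exact (tendsto_const_nhds.sub (h3.mul (h2.const_mul z))).norm

/-! ### The zero-counting measure -/

theorem integral_sum_dirac (s : Multiset ℂ) (f : ℂ → ℝ) :
    Integrable f (s.map fun z => Measure.dirac z).sum ∧
    ∫ z, f z ∂(s.map fun z => Measure.dirac z).sum = (s.map f).sum := by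
  induction s using Multiset.induction_on with
  | empty => simp
  | cons a s ih =>
    have h : Integrable f (Measure.dirac a) := integrable_dirac (by simp)
    rw [Multiset.map_cons, Multiset.sum_cons, Multiset.map_cons, Multiset.sum_cons,
      integral_add_measure h ih.1, ih.2, integral_dirac]
    exact ⟨h.add_measure ih.1, rfl⟩

theorem card_roots_popuc (β : ℂ) (a : ℕ → ℂ) (n : ℕ) : (popuc β a n).roots.card = n := by
  rw [splits_iff_card_roots.mp (IsAlgClosed.splits _), (popuc_monic β a n).2]

theorem isProbabilityMeasure_popucZeroMeasure (β : ℂ) (a : ℕ → ℂ) {n : ℕ} (hn : 0 < n) :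
    IsProbabilityMeasure (popucZeroMeasure β a n) := by
  have h : ∀ s : Multiset ℂ, (s.map fun z => Measure.dirac z).sum univ = (s.card : ℝ≥0∞) := by
    intro s
    induction s using Multiset.induction_on with
    | empty => simp
    | cons a s ih =>
      rw [Multiset.map_cons, Multiset.sum_cons, Measure.add_apply, ih, measure_univ,
        Multiset.card_cons]
      push_cast
      rw [add_comm]
  constructor
  rw [popucZeroMeasure, Measure.smul_apply, h, card_roots_popuc, smul_eq_mul]
  exact ENNReal.inv_mul_cancel (by exact_mod_cast hn.ne') (ENNReal.natCast_ne_top n)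

theorem ae_norm_eq_one_popucZeroMeasure {β : ℂ} (hβ : ‖β‖ = 1) {a : ℕ → ℂ} (ha : ∀ n, ‖a n‖ < 1)
    (n : ℕ) : ∀ᵐ w ∂(popucZeroMeasure β a n), ‖w‖ = 1 := by
  have h : ∀ s : Multiset ℂ, (∀ w ∈ s, ‖w‖ = 1) →
      ∀ᵐ w ∂(s.map fun z => Measure.dirac z).sum, ‖w‖ = 1 := by
    intro s
    induction s using Multiset.induction_on with
    | empty => simp
    | cons a s ih =>
      intro hs
      rw [Multiset.map_cons, Multiset.sum_cons, ae_add_measure_iff]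
      refine ⟨?_, ih fun w hw => hs w (Multiset.mem_cons_of_mem hw)⟩
      rw [ae_dirac_eq]
      exact hs a (Multiset.mem_cons_self a s)
  exact Measure.ae_smul_measure (h _ fun w hw =>
    norm_eq_one_of_popuc_root hβ ha (isRoot_of_mem_roots hw)) _

theorem integral_log_popucZeroMeasure {β : ℂ} (hβ : ‖β‖ = 1) {a : ℕ → ℂ} (ha : ∀ n, ‖a n‖ < 1)
    {z : ℂ} (hz : ‖z‖ ≤ 1 / 4) (n : ℕ) :
    ∫ w, Real.log ‖z - w‖ ∂(popucZeroMeasure β a (n + 1)) = ((n + 1 : ℕ) : ℝ)⁻¹ *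
      (Real.log ‖1 - β * (z * schurIter z a 1 n)‖ +
        ∑ i ∈ Finset.range n, Real.log ‖1 - a i * (z * schurIter z a 1 i)‖) := by
  have hz1 : ‖z‖ < 1 := by linarith
  have hb : ∀ i, ‖schurIter z a 1 i‖ ≤ 1 := fun i =>
    norm_schurIter_le hz1 (by simp) i fun i _ => ha i
  have hne : ∀ c : ℂ, ‖c‖ ≤ 1 → ∀ i, ‖1 - c * (z * schurIter z a 1 i)‖ ≠ 0 := by
    intro c hc i h0
    have h1 := norm_mul_mul_le_of_le hz hc (hb i)
    have h2 := norm_sub_norm_le 1 (c * (z * schurIter z a 1 i))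
    rw [h0, norm_one] at h2
    linarith
  have hval := norm_eval_popuc_succ hβ ha hz1 n
  have hne0 : (popuc β a (n + 1)).eval z ≠ 0 := by
    rw [← norm_ne_zero_iff, hval]
    exact mul_ne_zero (hne β hβ.le n) (Finset.prod_ne_zero_iff.mpr fun i _ => hne _ (ha i).le i)
  rw [popucZeroMeasure, integral_smul_measure, (integral_sum_dirac _ _).2,
    ← log_norm_eval_eq_sum (popuc_monic β a (n + 1)).1 hne0, hval,
    Real.log_mul (hne β hβ.le n) (Finset.prod_ne_zero_iff.mpr fun i _ => hne _ (ha i).le i),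
    Real.log_prod fun i _ => hne _ (ha i).le i, smul_eq_mul, ENNReal.toReal_inv,
    ENNReal.toReal_natCast]

/-- At most `p - 1` indices of an incomplete period and the factor with `β` are left over, each
contributing at most `1`; this is why the limit does not depend on `β`. -/
theorem abs_integral_log_popucZeroMeasure_sub_le {β : ℂ} (hβ : ‖β‖ = 1) {a : ℕ → ℂ}
    (ha : ∀ n, ‖a n‖ < 1) {z : ℂ} (hz : ‖z‖ ≤ 1 / 4) {p : ℕ} (hp : 0 < p) (n : ℕ) :
    |∫ w, Real.log ‖z - w‖ ∂(popucZeroMeasure β a (n + 1)) - ((n + 1 : ℕ) : ℝ)⁻¹ *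
      ∑ k ∈ Finset.range (n / p), blockLog z p a k| ≤ ((n + 1 : ℕ) : ℝ)⁻¹ * (p + 1) := by
  rw [integral_log_popucZeroMeasure hβ ha hz, ← mul_sub, abs_mul,
    abs_of_nonneg (inv_nonneg.mpr (Nat.cast_nonneg _))]
  refine mul_le_mul_of_nonneg_left ?_ (inv_nonneg.mpr (Nat.cast_nonneg _))
  have hn : n = n / p * p + n % p := by rw [mul_comm]; exact (Nat.div_add_mod n p).symm
  have hsplit : ∑ i ∈ Finset.range n, Real.log ‖1 - a i * (z * schurIter z a 1 i)‖ =
      ∑ k ∈ Finset.range (n / p), blockLog z p a k + ∑ i ∈ Finset.range (n % p),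
        Real.log ‖1 - a (n / p * p + i) * (z * schurIter z a 1 (n / p * p + i))‖ := by
    rw [sum_blockLog, ← Finset.sum_range_add]
    exact congrArg (fun m => ∑ i ∈ Finset.range m, Real.log ‖1 - a i * (z * schurIter z a 1 i)‖) hn
  rw [hsplit, add_sub_assoc, add_sub_cancel_left, add_comm (p : ℝ)]
  refine (abs_add_le _ _).trans (add_le_add (abs_log_schurIter_le ha hz hβ.le n) ?_)
  refine (Finset.abs_sum_le_sum_abs _ _).trans ((Finset.sum_le_card_nsmul _ _ 1
    fun j _ => abs_log_schurIter_le ha hz (ha _).le _).trans ?_)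
  rw [Finset.card_range, nsmul_one]
  exact_mod_cast (Nat.mod_lt n hp).le

/-! ### Riemann sums -/

/-- The integral of a step function as a Riemann sum. -/
theorem integral_comp_floor_div {h : ℝ} (hh : 0 < h) (F : ℕ → ℝ) (L : ℕ) :
    IntegrableOn (fun s : ℝ => F ⌊s / h⌋₊) (Ico 0 (L * h)) ∧
      ∫ s in Ico 0 (L * h), F ⌊s / h⌋₊ = h * ∑ k ∈ Finset.range L, F k := by
  induction L with
  | zero => simp
  | succ L ih =>
    have hLh : 0 ≤ L * h := by positivity
    have hle : L * h ≤ (L + 1 : ℕ) * h := by push_cast; nlinarith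
    have hconst : EqOn (fun s : ℝ => F ⌊s / h⌋₊) (fun _ => F L) (Ico (L * h) ((L + 1 : ℕ) * h)) := by
      intro s hs
      have : ⌊s / h⌋₊ = L := by
        rw [Nat.floor_eq_iff (div_nonneg (hLh.trans hs.1) hh.le), le_div_iff₀ hh, div_lt_iff₀ hh]
        exact ⟨hs.1, by simpa using hs.2⟩
      simp only [this]
    have hint : IntegrableOn (fun s : ℝ => F ⌊s / h⌋₊) (Ico (L * h) ((L + 1 : ℕ) * h)) :=
      IntegrableOn.congr_fun (integrableOn_const (by simp)) hconst.symm measurableSet_Ico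
    rw [← Ico_union_Ico_eq_Ico hLh hle]
    refine ⟨ih.1.union hint, ?_⟩
    rw [setIntegral_union (Ico_disjoint_Ico_same) measurableSet_Ico ih.1 hint, ih.2,
      setIntegral_congr_fun measurableSet_Ico hconst, Finset.sum_range_succ]
    simp only [integral_const, MeasurableSet.univ, measureReal_restrict_apply, univ_inter,
      Real.volume_real_Ico_of_le hle, smul_eq_mul]
    push_cast
    ring

/-- Riemann sums of a doubly indexed family converge to the integral of its ratio limit. -/
theorem tendsto_riemannSum_of_hasRatioLimit {t : ℝ} {p : ℕ} (hp : 0 < p)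
    {G : ℕ → ℕ → ℝ} {C : ℝ} (hG : ∀ k N, |G k N| ≤ C) {g : ℝ → ℝ}
    (hlim : ∀ᵐ s ∂(volume.restrict (Icc 0 t)), HasRatioLimit (fun k => k * p) G s (g s))
    {L N : ℕ → ℕ} (hN : Tendsto N atTop atTop)
    (hL : Tendsto (fun i => ((L i * p : ℕ) : ℝ) / N i) atTop (𝓝 t)) :
    Tendsto (fun i => (p / N i : ℝ) * ∑ k ∈ Finset.range (L i), G k (N i)) atTop
      (𝓝 (∫ s in Icc 0 t, g s)) := by
  have hp' : (0 : ℝ) < p := by exact_mod_cast hp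
  have hNr : Tendsto (fun i => (N i : ℝ)) atTop atTop := tendsto_natCast_atTop_atTop.comp hN
  have hL' : Tendsto (fun i => (L i : ℝ) * (p / N i)) atTop (𝓝 t) := by
    refine hL.congr fun i => ?_
    push_cast
    ring
  -- The Riemann sum is the integral of a step function with mesh `p / N`. At a fixed `s` its index
  -- `k = ⌊sN/p⌋` satisfies `kp/N → s`, so the ratio limit applies pointwise.
  set φ : ℕ → ℝ → ℝ := fun i => (Ico 0 ((L i : ℝ) * (p / N i))).indicator
    fun s => G ⌊s / (p / N i : ℝ)⌋₊ (N i) with hφ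
  have hC : 0 ≤ C := (abs_nonneg _).trans (hG 0 0)
  have hval : ∀ᶠ i in atTop, ∫ s, φ i s = (p / N i : ℝ) * ∑ k ∈ Finset.range (L i), G k (N i) := by
    filter_upwards [hNr.eventually_gt_atTop 0] with i hi
    rw [hφ]
    simp only
    rw [integral_indicator measurableSet_Ico,
      (integral_comp_floor_div (div_pos hp' hi) (fun k => G k (N i)) (L i)).2]
  refine Tendsto.congr' hval ?_
  rw [← integral_indicator measurableSet_Icc]
  refine tendsto_integral_filter_of_dominated_convergence
    ((Ico 0 (t + 1)).indicator fun _ => C) ?_ ?_ ?_ ?_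
  · refine Eventually.of_forall fun i => Measurable.aestronglyMeasurable ?_
    refine Measurable.indicator ?_ measurableSet_Ico
    exact (measurable_from_nat (f := fun k => G k (N i))).comp
      (Nat.measurable_floor.comp (measurable_id.div_const _))
  · filter_upwards [hL'.eventually_le_const (lt_add_one t)] with i hi
    refine Eventually.of_forall fun s => ?_
    rw [hφ, Real.norm_eq_abs]
    simp only [indicator]
    by_cases hs : s ∈ Ico 0 ((L i : ℝ) * (p / N i))
    · rw [if_pos hs, if_pos ⟨hs.1, hs.2.trans_le hi⟩]
      exact hG _ _
    · rw [if_neg hs, abs_zero]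
      split_ifs <;> simp [hC]
  · exact (integrable_indicator_iff measurableSet_Ico).mpr (integrableOn_const (by simp))
  -- At `s = 0` the index does not tend to infinity, and at `s = t` the indicator need not converge;
  -- both points are null.
  · filter_upwards [(ae_restrict_iff' measurableSet_Icc).mp hlim, Measure.ae_ne volume 0,
      Measure.ae_ne volume t] with s hs hs0 hst
    by_cases hmem : s ∈ Icc 0 t
    · have hs1 : 0 < s := lt_of_le_of_ne hmem.1 hs0.symm
      have hs2 : s < t := lt_of_le_of_ne hmem.2 hst
      rw [indicator_of_mem hmem]
      have hfl : Tendsto (fun i => ⌊s / (p / N i : ℝ)⌋₊) atTop atTop := by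
        refine tendsto_nat_floor_atTop.comp ?_
        refine (hNr.const_mul_atTop (div_pos hs1 hp')).congr fun i => ?_
        rw [div_div_eq_mul_div, div_mul_eq_mul_div]
      have hrat : Tendsto (fun i => ((⌊s / (p / N i : ℝ)⌋₊ * p : ℕ) : ℝ) / N i) atTop (𝓝 s) := by
        have h1 := ((tendsto_nat_floor_mul_div_atTop (div_pos hs1 hp').le).comp hNr).mul_const
          (p : ℝ)
        rw [div_mul_cancel₀ _ hp'.ne'] at h1
        refine h1.congr fun i => ?_
        have h2 : s / (p / N i : ℝ) = s / p * N i := by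
          rw [div_div_eq_mul_div, div_mul_eq_mul_div]
        simp only [Function.comp_apply]
        rw [h2]
        push_cast
        ring
      refine (hs hmem _ _ hfl hN hrat).congr' ?_
      filter_upwards [hL'.eventually_const_lt hs2] with i hi
      rw [hφ]
      simp only
      rw [indicator_of_mem (show s ∈ Ico 0 ((L i : ℝ) * (p / N i)) from ⟨hs1.le, hi⟩)]
    · rw [indicator_of_notMem hmem]
      refine tendsto_const_nhds.congr' ?_
      have : ∀ᶠ i in atTop, s ∉ Ico 0 ((L i : ℝ) * (p / N i)) := by
        rcases lt_or_ge s 0 with h | h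
        · exact Eventually.of_forall fun i hi => absurd hi.1 (not_le.mpr h)
        · have h' : t < s := by
            by_contra hcon
            exact hmem ⟨h, not_lt.mp hcon⟩
          filter_upwards [hL'.eventually_le_const h'] with i hi hi'
          exact absurd hi'.2 (not_lt.mpr hi)
      filter_upwards [this] with i hi
      exact (indicator_of_notMem hi _).symm

/-! ### The averaged measure -/

section Average

variable {t : ℝ} {ν : ℝ → Measure ℂ}

theorem lintegral_averageMeasure (hν : AEMeasurable ν (volume.restrict (Icc 0 t)))
    {f : ℂ → ℝ≥0∞} (hf : Measurable f) :
    ∫⁻ w, f w ∂(averageMeasure t ν) =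
      ENNReal.ofReal t⁻¹ * ∫⁻ s in Icc 0 t, ∫⁻ w, f w ∂(ν s) := by
  rw [averageMeasure, lintegral_smul_measure, Measure.lintegral_bind hν hf.aemeasurable,
    smul_eq_mul]

theorem isProbabilityMeasure_averageMeasure (ht : 0 < t)
    (hν : AEMeasurable ν (volume.restrict (Icc 0 t)))
    (hprob : ∀ s ∈ Icc 0 t, IsProbabilityMeasure (ν s)) :
    IsProbabilityMeasure (averageMeasure t ν) := by
  constructor
  rw [← lintegral_one, lintegral_averageMeasure hν measurable_const,
    setLIntegral_congr_fun measurableSet_Icc (g := fun _ => 1) fun s hs => by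
      have := hprob s hs
      simp]
  simp only [lintegral_one, Measure.restrict_apply_univ, Real.volume_Icc, sub_zero]
  rw [← ENNReal.ofReal_mul (inv_nonneg.mpr ht.le), inv_mul_cancel₀ ht.ne', ENNReal.ofReal_one]

theorem ae_norm_eq_one_averageMeasure (hν : AEMeasurable ν (volume.restrict (Icc 0 t)))
    (hcirc : ∀ s ∈ Icc 0 t, ∀ᵐ w ∂(ν s), ‖w‖ = 1) : ∀ᵐ w ∂(averageMeasure t ν), ‖w‖ = 1 := by
  have hm : MeasurableSet {w : ℂ | ‖w‖ = 1} := measurableSet_eq_fun measurable_norm measurable_const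
  rw [ae_iff]
  change averageMeasure t ν {w : ℂ | ‖w‖ = 1}ᶜ = 0
  rw [← lintegral_indicator_one hm.compl, lintegral_averageMeasure hν
    (measurable_one.indicator hm.compl), setLIntegral_congr_fun measurableSet_Icc
    (g := fun _ => 0) fun s hs => by
      simp only
      rw [lintegral_indicator_one hm.compl]
      exact ae_iff.mp (hcirc s hs)]
  simp

/-- Adding `1` makes the kernel nonnegative for `|z| ≤ 1/4`, so the exchange of integrals for the
averaged measure can be made with `lintegral`. -/
theorem integral_log_eq_toReal_lintegral {m : Measure ℂ} [IsProbabilityMeasure m]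
    (hm : ∀ᵐ w ∂m, ‖w‖ = 1) {z : ℂ} (hz : ‖z‖ ≤ 1 / 4) :
    ∫ w, Real.log ‖z - w‖ ∂m + 1 =
      (∫⁻ w, ENNReal.ofReal (Real.log ‖z - w‖ + 1) ∂m).toReal := by
  have hint := integrable_log_norm_sub hm hz
  rw [← integral_eq_lintegral_of_nonneg_ae, integral_add hint (integrable_const _)]
  · simp
  · filter_upwards [hm] with w hw
    have := abs_le.mp (abs_log_norm_sub_le hz hw)
    simp only [Pi.zero_apply]
    linarith
  · exact (hint.add (integrable_const _)).aestronglyMeasurable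

/-- The potential of the average is the average of the potentials. -/
theorem integral_log_averageMeasure (ht : 0 < t)
    (hν : AEMeasurable ν (volume.restrict (Icc 0 t)))
    (hprob : ∀ s ∈ Icc 0 t, IsProbabilityMeasure (ν s))
    (hcirc : ∀ s ∈ Icc 0 t, ∀ᵐ w ∂(ν s), ‖w‖ = 1) {z : ℂ} (hz : ‖z‖ ≤ 1 / 4) :
    ∫ w, Real.log ‖z - w‖ ∂(averageMeasure t ν) =
      t⁻¹ * ∫ s in Icc 0 t, ∫ w, Real.log ‖z - w‖ ∂(ν s) := by
  have := isProbabilityMeasure_averageMeasure ht hν hprob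
  have hmeas : Measurable fun w : ℂ => ENNReal.ofReal (Real.log ‖z - w‖ + 1) := by fun_prop
  set F : ℝ → ℝ≥0∞ := fun s => ∫⁻ w, ENNReal.ofReal (Real.log ‖z - w‖ + 1) ∂(ν s) with hF
  have hFm : AEMeasurable F (volume.restrict (Icc 0 t)) :=
    (Measure.measurable_lintegral hmeas).comp_aemeasurable hν
  have hF2 : ∀ s ∈ Icc 0 t, F s ≤ 2 := by
    intro s hs
    have := hprob s hs
    calc F s ≤ ∫⁻ _, 2 ∂(ν s) := by
          refine lintegral_mono_ae ?_
          filter_upwards [hcirc s hs] with w hw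
          have := abs_le.mp (abs_log_norm_sub_le hz hw)
          exact (ENNReal.ofReal_le_ofReal (by linarith : _ ≤ (2 : ℝ))).trans (by simp)
      _ = 2 := by simp
  have hFae : ∀ᵐ s ∂(volume.restrict (Icc 0 t)), F s ≤ 2 :=
    (ae_restrict_iff' measurableSet_Icc).mpr (Eventually.of_forall hF2)
  have hU : ∀ s ∈ Icc 0 t, ∫ w, Real.log ‖z - w‖ ∂(ν s) = (F s).toReal - 1 := by
    intro s hs
    have := hprob s hs
    rw [hF, ← integral_log_eq_toReal_lintegral (hcirc s hs) hz, add_sub_cancel_right]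
  have hFint : Integrable (fun s => (F s).toReal) (volume.restrict (Icc 0 t)) := by
    refine integrable_toReal_of_lintegral_ne_top hFm (ne_of_lt ?_)
    refine (lintegral_mono_ae hFae).trans_lt ?_
    simp only [lintegral_const, Measure.restrict_apply_univ, Real.volume_Icc]
    exact ENNReal.mul_lt_top (by simp) (by simp)
  have hone : ∫ _ in Icc 0 t, (1 : ℝ) = t := by simp [ht.le]
  rw [setIntegral_congr_fun measurableSet_Icc hU, integral_sub hFint (integrable_const _), hone,
    integral_toReal hFm (hFae.mono fun s hs => hs.trans_lt (by simp)), mul_sub,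
    inv_mul_cancel₀ ht.ne', eq_sub_iff_add_eq, integral_log_eq_toReal_lintegral
      (ae_norm_eq_one_averageMeasure hν hcirc) hz, lintegral_averageMeasure hν hmeas,
    ENNReal.toReal_mul, ENNReal.toReal_ofReal (inv_nonneg.mpr ht.le)]

end Average

/-! ### Measurable dependence on the coefficients -/

theorem continuous_szegoProd (n : ℕ) :
    Continuous fun q : (ℕ → ℂ) × ℂ => szegoProd q.1 q.2 n := by
  induction n with
  | zero => exact continuous_const
  | succ n ih =>
    simp only [szegoProd]
    refine Continuous.matrix_mul ?_ ih
    refine continuous_matrix fun i j => ?_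
    have h1 : Continuous fun q : (ℕ → ℂ) × ℂ => q.1 n := (continuous_apply n).comp continuous_fst
    have h2 : Continuous fun q : (ℕ → ℂ) × ℂ => starRingEnd ℂ (q.1 n) :=
      Complex.continuous_conj.comp h1
    fin_cases i <;> fin_cases j <;> simp [szegoMatrix] <;> fun_prop

theorem continuous_norm_eval_tracePoly (p : ℕ) :
    Continuous fun q : (ℕ → ℂ) × ℝ =>
      ‖(tracePoly q.1 p).eval (Complex.exp (q.2 * Complex.I))‖ ^ 2 := by
  simp only [eval_tracePoly]
  have h : Continuous fun q : (ℕ → ℂ) × ℝ => (q.1, Complex.exp (q.2 * Complex.I)) := by fun_prop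
  exact (((continuous_szegoProd p).comp h).matrix_trace.norm).pow 2

theorem measurable_rhoSq (p : ℕ) : Measurable fun c : ℕ → ℂ => rhoSq c p := by
  unfold rhoSq
  fun_prop

theorem measurable_discAngle (p : ℕ) :
    Measurable fun q : (ℕ → ℂ) × ℝ => discAngle q.1 p q.2 :=
  ((continuous_norm_eval_tracePoly p).measurable.div
    ((measurable_rhoSq p).comp measurable_fst)).sub_const 2

theorem measurable_deriv_discAngle (p : ℕ) :
    Measurable fun q : (ℕ → ℂ) × ℝ => deriv (discAngle q.1 p) q.2 := by
  have h : (fun q : (ℕ → ℂ) × ℝ => deriv (discAngle q.1 p) q.2) = fun q =>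
      deriv (fun θ : ℝ => ‖(tracePoly q.1 p).eval (Complex.exp (θ * Complex.I))‖ ^ 2) q.2 /
        rhoSq q.1 p := by
    funext q
    change deriv (fun θ : ℝ => _ / rhoSq q.1 p - 2) q.2 = _
    rw [deriv_sub_const, deriv_div_const]
  rw [h]
  exact (measurable_deriv_with_param
    (f := fun (c : ℕ → ℂ) (θ : ℝ) => ‖(tracePoly c p).eval (Complex.exp (θ * Complex.I))‖ ^ 2)
    (continuous_norm_eval_tracePoly p)).div
    ((measurable_rhoSq p).comp measurable_fst)

/-- The measure `ν_Δ` depends measurably on the coefficients. -/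
theorem measurable_discriminantMeasure {X : Type*} [MeasurableSpace X] {c : X → ℕ → ℂ}
    (hcm : Measurable c) (hc : ∀ x j, ‖c x j‖ < 1) {p : ℕ} (hp : 0 < p) :
    Measurable fun x => discriminantMeasure fun j : Fin p => c x j := by
  refine Measure.measurable_of_measurable_coe _ fun B hB => ?_
  have hpair : Measurable fun q : X × ℝ => (c q.1, q.2) := by fun_prop
  have hA := (measurable_discAngle p).comp hpair
  have hD := (measurable_deriv_discAngle p).comp hpair
  have hmem : MeasurableSet {q : X × ℝ | q.2 ∈ bandAngles (c q.1) p} :=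
    (measurable_snd measurableSet_Ioc).inter (hA measurableSet_Ioo)
  have hexp : Measurable fun q : X × ℝ => Complex.exp (q.2 * Complex.I) := by fun_prop
  have hind : Measurable (B.indicator (1 : ℂ → ℝ≥0∞)) := measurable_one.indicator hB
  have hint : Measurable fun q : X × ℝ => {q : X × ℝ | q.2 ∈ bandAngles (c q.1) p}.indicator
      (fun q => ENNReal.ofReal
        (|deriv (discAngle (c q.1) p) q.2| / √(4 - discAngle (c q.1) p q.2 ^ 2)) *
          B.indicator (1 : ℂ → ℝ≥0∞) (Complex.exp (q.2 * Complex.I))) q := by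
    refine Measurable.indicator (Measurable.mul ?_ (hind.comp hexp)) hmem
    exact ((hD.norm).div ((measurable_const.sub (hA.pow_const 2)).sqrt)).ennreal_ofReal
  convert (hint.lintegral_prod_right' (ν := volume)).const_mul (ENNReal.ofReal ((2 * Real.pi * p)⁻¹)) using 2
    with x
  rw [← lintegral_indicator_one hB, lintegral_discriminantMeasure (hc x) hp hind,
    ← lintegral_indicator (measurableSet_bandAngles _ _)]
  rfl

theorem aemeasurable_discriminantMeasure {t : ℝ} {p : ℕ} (hp : 0 < p) {a : Fin p → ℝ → ℂ}
    (ha_meas : ∀ j, AEMeasurable (a j) (volume.restrict (Icc 0 t)))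
    (ha_disk : ∀ j, ∀ s ∈ Icc (0 : ℝ) t, ‖a j s‖ < 1) :
    AEMeasurable (fun s => discriminantMeasure fun j => a j s) (volume.restrict (Icc 0 t)) := by
  -- A measurable representative may leave the disk on a null set, while the joint measurability
  -- lemma needs `|c| < 1` everywhere; it is replaced by `0` there.
  set b : ℝ → ℕ → ℂ := fun s i => if h : i < p then
    {x | ‖(ha_meas ⟨i, h⟩).mk _ x‖ < 1}.indicator ((ha_meas ⟨i, h⟩).mk _) s else 0 with hb
  have hbm : Measurable b := by
    refine measurable_pi_lambda _ fun i => ?_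
    by_cases h : i < p
    · simp only [hb, h, dite_true]
      have hm := (ha_meas ⟨i, h⟩).measurable_mk
      exact hm.indicator (measurableSet_lt hm.norm measurable_const)
    · simp only [hb, h, dite_false]
      exact measurable_const
  have hb1 : ∀ s i, ‖b s i‖ < 1 := by
    intro s i
    by_cases h : i < p
    · simp only [hb, h, dite_true, indicator]
      split_ifs with h1
      · exact h1
      · simp
    · simp [hb, h]
  refine ⟨_, measurable_discriminantMeasure hbm hb1 hp, ?_⟩
  filter_upwards [ae_all_iff.mpr fun j => (ha_meas j).ae_eq_mk,
    ae_restrict_mem measurableSet_Icc] with s hs hmem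
  congr 1
  funext j
  have hj : ‖(ha_meas j).mk _ s‖ < 1 := by
    rw [← hs j]
    exact ha_disk j s hmem
  simp only [hb, j.isLt, dite_true]
  rw [indicator_of_mem (by exact hj)]
  exact hs j

/-! ### The limit of the zero counting measures -/

/-- Rounding down to a multiple of `p` changes the numerator by less than `p`, negligible against
`N`. -/
theorem tendsto_ratio_block {p : ℕ} (hp : 0 < p) {m N : ℕ → ℕ} {t : ℝ}
    (hN : Tendsto N atTop atTop) (hm : Tendsto (fun i => (m i : ℝ) / N i) atTop (𝓝 t)) :
    Tendsto (fun i => ((m i / p * p : ℕ) : ℝ) / N i) atTop (𝓝 t) := by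
  have hNr : Tendsto (fun i => (N i : ℝ)) atTop atTop := tendsto_natCast_atTop_atTop.comp hN
  have hlow : Tendsto (fun i => (m i : ℝ) / N i - p / N i) atTop (𝓝 t) := by
    simpa using hm.sub (hNr.const_div_atTop (p : ℝ))
  refine tendsto_of_tendsto_of_tendsto_of_le_of_le hlow hm (fun i => ?_) fun i => ?_
  · simp only
    rw [← sub_div]
    gcongr
    have h1 := Nat.div_add_mod (m i) p
    have h2 := Nat.mod_lt (m i) hp
    rw [sub_le_iff_le_add]
    exact_mod_cast (by rw [mul_comm]; omega : m i ≤ m i / p * p + p)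
  · simp only
    gcongr
    exact Nat.div_mul_le_self _ _

/-- The potentials of the zero counting measures converge near `0`. -/
theorem tendsto_integral_log_popucZeroMeasure {t : ℝ} (ht : 0 < t) {p : ℕ} (hp : 0 < p)
    {α : ℕ → ℕ → ℂ} (hα : ∀ n N, ‖α n N‖ < 1) {z : ℂ} (hz : ‖z‖ ≤ 1 / 4) {U : ℝ → ℝ}
    (hU : ∀ᵐ s ∂(volume.restrict (Icc 0 t)), HasRatioLimit (fun k => k * p)
      (fun k N => blockLog z p (fun m => α m N) k) s (p * U s))
    {β : ℂ} (hβ : ‖β‖ = 1) {m N : ℕ → ℕ} (hm : Tendsto m atTop atTop)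
    (hN : Tendsto N atTop atTop)
    (hmN : Tendsto (fun i => ((m i + 1 : ℕ) : ℝ) / N i) atTop (𝓝 t)) :
    Tendsto (fun i => ∫ w, Real.log ‖z - w‖
      ∂(popucZeroMeasure β (fun k => α k (N i)) (m i + 1))) atTop
      (𝓝 (t⁻¹ * ∫ s in Icc 0 t, U s)) := by
  have hp' : (0 : ℝ) < p := by exact_mod_cast hp
  have hNr : Tendsto (fun i => (N i : ℝ)) atTop atTop := tendsto_natCast_atTop_atTop.comp hN
  have hmr : Tendsto (fun i => ((m i + 1 : ℕ) : ℝ)) atTop atTop :=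
    tendsto_natCast_atTop_atTop.comp ((tendsto_add_atTop_nat 1).comp hm)
  have hmN' : Tendsto (fun i => (m i : ℝ) / N i) atTop (𝓝 t) := by
    have h := hmN.sub (hNr.const_div_atTop (1 : ℝ))
    rw [sub_zero] at h
    refine h.congr fun i => ?_
    push_cast
    ring
  have hR := tendsto_riemannSum_of_hasRatioLimit hp
    (fun k N => abs_blockLog_le (fun m => hα m N) hz p k) hU hN (tendsto_ratio_block hp hN hmN')
  rw [integral_const_mul] at hR
  have hmain : Tendsto (fun i => ((m i + 1 : ℕ) : ℝ)⁻¹ * ∑ k ∈ Finset.range (m i / p),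
      blockLog z p (fun j => α j (N i)) k) atTop (𝓝 (t⁻¹ * ∫ s in Icc 0 t, U s)) := by
    have h := (hmN.inv₀ ht.ne').mul (hR.const_mul (p : ℝ)⁻¹)
    rw [inv_mul_cancel_left₀ hp'.ne'] at h
    refine h.congr' ?_
    filter_upwards [hNr.eventually_gt_atTop 0] with i hi
    generalize ∑ k ∈ Finset.range (m i / p), blockLog z p (fun j => α j (N i)) k = S
    have : ((m i + 1 : ℕ) : ℝ) ≠ 0 := by positivity
    field_simp
  have herr : Tendsto (fun i => ((m i + 1 : ℕ) : ℝ)⁻¹ * ((p : ℝ) + 1)) atTop (𝓝 0) := by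
    simpa using hmr.inv_tendsto_atTop.mul_const ((p : ℝ) + 1)
  have hdiff := squeeze_zero_norm (fun i => (Real.norm_eq_abs _).trans_le <|
    abs_integral_log_popucZeroMeasure_sub_le hβ (fun j => hα j (N i)) hz hp (m i)) herr
  simpa using hdiff.add hmain

theorem theorem4p5 (t : ℝ) (ht : 0 < t) (p : ℕ) (hp : 0 < p)
    (a : Fin p → ℝ → ℂ)
    (ha_meas : ∀ j, AEMeasurable (a j) (volume.restrict (Icc 0 t)))
    (ha_disk : ∀ j, ∀ s ∈ Icc (0 : ℝ) t, ‖a j s‖ < 1)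
    (α : ℕ → ℕ → ℂ) (hα_disk : ∀ n N, ‖α n N‖ < 1)
    (hα_lim : ∀ j : Fin p, ∀ᵐ s ∂(volume.restrict (Icc 0 t)),
      HasRatioLimit (fun k => k * p) (fun k N => α (k * p + j) N) s (a j s))
    (β : ℂ) (hβ : ‖β‖ = 1) :
    (∀ s ∈ Icc (0 : ℝ) t,
      IsEquilibriumMeasure (bandSet fun j => a j s) (discriminantMeasure fun j => a j s)) ∧
    AEMeasurable (fun s => discriminantMeasure fun j => a j s) (volume.restrict (Icc 0 t)) ∧
    ∀ f : ℂ →ᵇ ℝ,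
      HasRatioLimit (fun n => n)
        (fun n N => ∫ z, f z ∂(popucZeroMeasure β (fun m => α m N) n)) t
        (∫ z, f z ∂(averageMeasure t fun s => discriminantMeasure fun j => a j s)) := by
  set c : ℝ → ℕ → ℂ := fun s i => if h : i < p then a ⟨i, h⟩ s else 0 with hcdef
  have hca : ∀ s, (fun j => a j s) = fun j : Fin p => c s j := by
    intro s
    funext j
    simp [hcdef]
  have hc : ∀ s ∈ Icc (0 : ℝ) t, ∀ i, ‖c s i‖ < 1 := by
    intro s hs i
    by_cases h : i < p
    · simpa [hcdef, h] using ha_disk ⟨i, h⟩ s hs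
    · simp [hcdef, h]
  have hmeas := aemeasurable_discriminantMeasure hp ha_meas ha_disk
  refine ⟨fun s hs => ?_, hmeas, fun f n N hn hN hnN => ?_⟩
  · rw [hca]
    exact isEquilibriumMeasure_discriminantMeasure (hc s hs) hp
  have hprob : ∀ s ∈ Icc 0 t, IsProbabilityMeasure (discriminantMeasure fun j => a j s) := by
    intro s hs
    rw [hca]
    exact isProbabilityMeasure_discriminantMeasure (hc s hs) hp
  have hcirc : ∀ s ∈ Icc 0 t, ∀ᵐ w ∂(discriminantMeasure fun j => a j s), ‖w‖ = 1 := by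
    intro s hs
    rw [hca]
    exact ae_norm_eq_one_discriminantMeasure (hc s hs) hp
  have := isProbabilityMeasure_averageMeasure ht hmeas hprob
  -- For `n = 0` the counting measure is zero, so the degree is written as a successor; this agrees
  -- with `n i` eventually.
  have hpred : ∀ᶠ i in atTop, n i - 1 + 1 = n i := by
    filter_upwards [hn.eventually_ge_atTop 1] with i hi
    omega
  have (i : ℕ) : IsProbabilityMeasure
      (popucZeroMeasure β (fun m => α m (N i)) (n i - 1 + 1)) :=
    isProbabilityMeasure_popucZeroMeasure _ _ (Nat.succ_pos _)
  have hlim := tendsto_integral_of_potential (l := atTop)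
    (μ := fun i => popucZeroMeasure β (fun m => α m (N i)) (n i - 1 + 1))
    (fun i => ae_norm_eq_one_popucZeroMeasure hβ (fun m => hα_disk m (N i)) _)
    (ae_norm_eq_one_averageMeasure hmeas hcirc) (fun z hz0 hz => ?_) f
  · exact hlim.congr' (hpred.mono fun i hi => by simp only [hi])
  · rw [integral_log_averageMeasure ht hmeas hprob hcirc hz]
    refine tendsto_integral_log_popucZeroMeasure ht hp hα_disk hz ?_ hβ
      ((tendsto_sub_atTop_nat 1).comp hn) hN (hnN.congr' (hpred.mono fun i hi => by
        simp only [hi]))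
    filter_upwards [ae_all_iff.mpr hα_lim, ae_restrict_mem measurableSet_Icc] with s hs hmem
    rw [hca]
    refine hasRatioLimit_blockLog hα_disk hp (hc s hmem) (fun j hj => ?_) hz0 hz
    simpa [hcdef, hj] using hs ⟨j, hj⟩
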